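/- Consider integer programs in standard form $$\max\{c^Tx : Ax=b,\ x\ge 0,\ x\in\mathbb Z^n\},\qquad A\in\mathbb Z^{m\times n},\ b\in\mathbb Z^m,\ c\in\mathbb Z^n. \tag{IP}$$ Time is measured on a random access machine whose cells hold integers and whose elementary instructions (loading a constant, addition, subtraction, indirect load and store, branching on positivity) take one unit of time each. To solve (IP) means to report that it is infeasible, or to report that it is unbounded (has feasible solutions of arbitrarily large objective value), or to output an optimal solution. (1) There are a machine program and a constant $C$ such that for all $m,n\ge 1$, all $A,b,c$ as above and every integer $\Delta\ge 1$ that bounds the absolute values of all entries of $A$, the program, given $m,n,A,b,c$, solves (IP) in a time $T$ with $$T\le n\cdot (C\,m\Delta)^{2m}\cdot \max\{1,\|b\|_1\}^2 \qquad\text{and}\qquad T\le C\,mn + C\,(m\Delta)^{Cm}\cdot\max\{1,\|b\|_\infty\}^2 .$$ That is, (IP) is solved in time $n\cdot O(m\Delta)^{2m}\cdot\|b\|_1^2$, and, up to the time $O(mn)$ for reading $A$, in time $(m\Delta)^{O(m)}\cdot\|b\|_\infty^2$. (2) Let $A,b,c$ be as above (now with any $m,n\ge 0$) and let the integer $\Delta\ge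 0$ bound the absolute values of all entries of $A$. Let $D$ be the weighted digraph whose nodes are the points of $\mathbb Z^m$ at $\ell_\infty$-distance at most $2m\Delta$ from some point of the line segment from $0$ to $b$, with an arc of weight $c_j$ from $x$ to $y$ for each $j$ such that $y-x$ is the $j$-th column of $A$. The length of a walk is the sum of the weights of its arcs. Then (IP) is feasible if and only if $D$ has a directed walk from $0$ to $b$. If (IP) is feasible, then it is unbounded if and only if $D$ contains a directed cycle (closed walk, not necessarily simple) of strictly positive length that is reachable from $0$. An integer $v$ is the optimal value of (IP), attained by an optimal solution, if and only if $v$ is the maximum length of a directed walk from $0$ to $b$ in $D$. -/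

import Mathlib

/-! ## Integer programs in standard form -/

namespace StdIP

open Matrix

/-- The feasible set `{x ∈ ℤⁿ : A x = b, x ≥ 0}`. -/
def feasibleSet {m n : ℕ} (A : Matrix (Fin m) (Fin n) ℤ) (b : Fin m → ℤ) : Set (Fin n → ℤ) :=
  {x | A *ᵥ x = b ∧ ∀ j, 0 ≤ x j}

/-- `x` is an optimal solution of `max {cᵀx : A x = b, x ≥ 0, x ∈ ℤⁿ}`. -/
def IsOptimal {m n : ℕ} (A : Matrix (Fin m) (Fin n) ℤ) (b : Fin m → ℤ) (c : Fin n → ℤ)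
    (x : Fin n → ℤ) : Prop :=
  x ∈ feasibleSet A b ∧ ∀ y ∈ feasibleSet A b, c ⬝ᵥ y ≤ c ⬝ᵥ x

/-- The integer program has feasible solutions of arbitrarily large objective value. -/
def IsUnbounded {m n : ℕ} (A : Matrix (Fin m) (Fin n) ℤ) (b : Fin m → ℤ) (c : Fin n → ℤ) : Prop :=
  ∀ M : ℤ, ∃ x ∈ feasibleSet A b, M < c ⬝ᵥ x

/-- `‖b‖₁`. -/
def norm1 {m : ℕ} (b : Fin m → ℤ) : ℕ := ∑ i, (b i).natAbs

/-- `‖b‖_∞`. -/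
def normSup {m : ℕ} (b : Fin m → ℤ) : ℕ := Finset.univ.sup fun i => (b i).natAbs

/-! ## The digraph of partial sums -/

/-- The lattice points at `ℓ_∞`-distance at most `2 m Δ` from some point of the segment `[0, b]`. -/
def nodes {m : ℕ} (b : Fin m → ℤ) (Δ : ℕ) : Set (Fin m → ℤ) :=
  {x | ∃ s : ℝ, 0 ≤ s ∧ s ≤ 1 ∧ ∀ i, |(x i : ℝ) - s * (b i : ℝ)| ≤ 2 * (m : ℝ) * (Δ : ℝ)}

/-- Directed walks in the digraph with node set `S` that has, for every column `j` of `A` and every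
`x`, an arc labelled `j` from `x` to `x + A e_j` whenever both ends lie in `S`.
`IsWalk A S x p y`: the list `p` of arc labels is that of a walk from `x` to `y`. -/
inductive IsWalk {m n : ℕ} (A : Matrix (Fin m) (Fin n) ℤ) (S : Set (Fin m → ℤ)) :
    (Fin m → ℤ) → List (Fin n) → (Fin m → ℤ) → Prop
  | nil (x : Fin m → ℤ) (hx : x ∈ S) : IsWalk A S x [] x
  | cons (x y : Fin m → ℤ) (j : Fin n) (p : List (Fin n)) (hx : x ∈ S)
      (h : IsWalk A S (fun i => x i + A i j) p y) : IsWalk A S x (j :: p) y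

/-- The length of a walk: an arc labelled `j` has weight `c j`. -/
def weight {n : ℕ} (c : Fin n → ℤ) (p : List (Fin n)) : ℤ := (p.map c).sum

end StdIP

/-! ## A random access machine with a step count

The machine has registers and a random access memory, all of whose cells hold integers. Its only
arithmetic operations are addition and subtraction; there is indirect addressing, and the only test
is for positivity of a register. Every elementary instruction and every evaluation of a test takes
one unit of time. A program is a fixed finite object, so only finitely many registers are used by it
and it does not depend on the input. -/

namespace RAM

/-- A configuration: contents of the registers and of the memory. -/
structure State where
  reg : ℕ → ℤ
  mem : ℤ → ℤ

/-- Programs. -/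
inductive Prog where
  /-- `reg r := k` -/
  | const (r : ℕ) (k : ℤ)
  /-- `reg r := reg s + reg t` -/
  | add (r s t : ℕ)
  /-- `reg r := reg s - reg t` -/
  | sub (r s t : ℕ)
  /-- `reg r := mem (reg s)` -/
  | load (r s : ℕ)
  /-- `mem (reg r) := reg s` -/
  | store (r s : ℕ)
  /-- run `p`, then `q` -/
  | seq (p q : Prog)
  /-- if `reg r > 0` then run `p` else run `q` -/
  | ite (r : ℕ) (p q : Prog)
  /-- while `reg r > 0` run `p` -/
  | loop (r : ℕ) (p : Prog)

/-- Write `v` into register `r`. -/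
def State.setReg (σ : State) (r : ℕ) (v : ℤ) : State := { σ with reg := Function.update σ.reg r v }

/-- Write `v` into the memory cell with address `a`. -/
def State.setMem (σ : State) (a v : ℤ) : State := { σ with mem := Function.update σ.mem a v }

/-- `Runs p σ t τ`: started in configuration `σ`, the program `p` halts after exactly `t` steps in
configuration `τ`. -/
inductive Runs : Prog → State → ℕ → State → Prop
  | const (r : ℕ) (k : ℤ) (σ : State) : Runs (.const r k) σ 1 (σ.setReg r k)
  | add (r s t : ℕ) (σ : State) : Runs (.add r s t) σ 1 (σ.setReg r (σ.reg s + σ.reg t))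
  | sub (r s t : ℕ) (σ : State) : Runs (.sub r s t) σ 1 (σ.setReg r (σ.reg s - σ.reg t))
  | load (r s : ℕ) (σ : State) : Runs (.load r s) σ 1 (σ.setReg r (σ.mem (σ.reg s)))
  | store (r s : ℕ) (σ : State) : Runs (.store r s) σ 1 (σ.setMem (σ.reg r) (σ.reg s))
  | seq (p q : Prog) (σ τ υ : State) (t u : ℕ) (hp : Runs p σ t τ) (hq : Runs q τ u υ) :
      Runs (.seq p q) σ (t + u) υ
  | ite_pos (r : ℕ) (p q : Prog) (σ τ : State) (t : ℕ) (hr : 0 < σ.reg r) (hp : Runs p σ t τ) :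
      Runs (.ite r p q) σ (t + 1) τ
  | ite_neg (r : ℕ) (p q : Prog) (σ τ : State) (t : ℕ) (hr : σ.reg r ≤ 0) (hq : Runs q σ t τ) :
      Runs (.ite r p q) σ (t + 1) τ
  | loop_done (r : ℕ) (p : Prog) (σ : State) (hr : σ.reg r ≤ 0) : Runs (.loop r p) σ 1 σ
  | loop_step (r : ℕ) (p : Prog) (σ τ υ : State) (t u : ℕ) (hr : 0 < σ.reg r)
      (hp : Runs p σ t τ) (hl : Runs (.loop r p) τ u υ) : Runs (.loop r p) σ (t + u + 1) υ

end RAM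

namespace StdIP

/-- The input word `m, n, A, b, c`, where `A` is listed column by column. -/
def inputWord {m n : ℕ} (A : Matrix (Fin m) (Fin n) ℤ) (b : Fin m → ℤ) (c : Fin n → ℤ) : List ℤ :=
  [(m : ℤ), (n : ℤ)] ++ (List.ofFn fun j : Fin n => List.ofFn fun i : Fin m => A i j).flatten
    ++ List.ofFn b ++ List.ofFn c

/-- The initial configuration: the input word stands in the memory cells `0, 1, 2, …`; all other
cells and all registers are zero. -/
def initialState {m n : ℕ} (A : Matrix (Fin m) (Fin n) ℤ) (b : Fin m → ℤ) (c : Fin n → ℤ) :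
    RAM.State where
  reg := fun _ => 0
  mem := fun a => if 0 ≤ a then (inputWord A b c).getD a.toNat 0 else 0

/-- The configuration `σ` is a correct answer to the integer program: register `0` holds
`0` if the program is infeasible, `1` if the memory cells `0, …, n - 1` hold an optimal solution,
and `2` if it is unbounded. -/
def IsAnswer {m n : ℕ} (A : Matrix (Fin m) (Fin n) ℤ) (b : Fin m → ℤ) (c : Fin n → ℤ)
    (σ : RAM.State) : Prop :=
  (σ.reg 0 = 0 ∧ feasibleSet A b = ∅) ∨
  (σ.reg 0 = 1 ∧ IsOptimal A b c (fun j : Fin n => σ.mem ((j : ℕ) : ℤ))) ∨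
  (σ.reg 0 = 2 ∧ IsUnbounded A b c)

end StdIP

/-!
Feasible solutions and walks correspond to each other: the arcs of a walk from `0` to `b`, counted
by label, form a feasible solution of the same objective value, and a feasible solution lists
columns of `A` that sum to `b`. By the Steinitz lemma (`Steinitz.exists_order`) these columns can be
ordered such that their partial sums stay within distance `2 m Δ` of the segment from `0` to `b`, so
that the list becomes a walk in the digraph (`StdIP.exists_isWalk_of_mem`). The Steinitz lemma is
proved by removing the vectors one after the other: a vertex of a polytope of weights has few
fractional entries, hence an entry `0`, and the vector that belongs to it can be removed. In the same
way an integral ray `y ≥ 0`, `A y = 0`, `cᵀ y > 0` is a positive closed walk through `0`. Such a ray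
exists if the program is unbounded, since by Dickson's lemma two members of a sequence of feasible
solutions of increasing objective value are comparable, and their difference is a ray
(`StdIP.exists_ray_of_isUnbounded`); conversely a positive closed walk gives a ray.

The algorithm computes longest walks from `0` by the Bellman-Ford method, on a slightly larger node
set: the lattice points of the cubes of radius `R = 2 m Δ + 2` around the roundings `⌊k b / K⌋`,
`0 ≤ k ≤ K`, where `K = max {1, ‖b‖_∞}`. Both the enlargement to `R` and the use of `K + 1` cubes
only affect constants: there are at most `(K + 1) (2 R + 1) ^ m` nodes. Lattice points are encoded by
integers in a base so large that codes of nodes and of their neighbours are distinct, which makes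
the test for membership and the step along an arc a matter of one addition and one access to an
array. Equal columns are merged, and only the one of largest cost is kept, so that a node has
at most `min {n, (2 Δ + 1) ^ m}` arcs. As many rounds as there are nodes find the best walks with that
many arcs. If one more round brings an improvement, there is a positive cycle
(`Solver.posCycle_of_improves`); if it does not, what is recorded is optimal
(`Solver.le_of_fixed`). Recorded walks are kept as linked lists, from which the solution is read off.

The method is written in a small language with variables, arrays and counted loops, whose total
semantics and cost are defined by recursion. A compiler into the random access machine is proved
correct once and for all (`Loop.Cmd.compile_ends`); what remains is to follow the program with
invariants (`Loop.Spec`, `Solver.solver_spec`) and to estimate its cost (`Solver.solverCost_le`).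
-/

/-! ### The Steinitz lemma -/

namespace Steinitz

variable {ι : Type*} [Fintype ι] {m : ℕ}

/-- The polytope of weights `0 ≤ l ≤ 1` of total mass `r`, supported in `s`, for which the weighted
sum of the vectors `v i` vanishes. -/
def polytope (v : ι → Fin m → ℝ) (s : Finset ι) (r : ℝ) : Set (ι → ℝ) :=
  {l | (∀ i, 0 ≤ l i ∧ l i ≤ 1) ∧ (∀ i, i ∉ s → l i = 0) ∧ (∀ k, ∑ i, l i * v i k = 0) ∧
    ∑ i, l i = r}

lemma isCompact_polytope (v : ι → Fin m → ℝ) (s : Finset ι) (r : ℝ) :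
    IsCompact (polytope v s r) := by
  have hc : IsClosed (polytope v s r) := by
    unfold polytope
    simp only [Set.ofPred_and, Set.ofPred_forall]
    refine (isClosed_iInter fun i => IsClosed.inter ?_ ?_).inter
      ((isClosed_iInter fun i => isClosed_iInter fun _ => ?_).inter
        ((isClosed_iInter fun k => ?_).inter ?_))
    · exact isClosed_le continuous_const (continuous_apply i)
    · exact isClosed_le (continuous_apply i) continuous_const
    · exact isClosed_eq (continuous_apply i) continuous_const
    · exact isClosed_eq (by fun_prop) continuous_const
    · exact isClosed_eq (by fun_prop) continuous_const
  refine (isCompact_Icc (a := (0 : ι → ℝ)) (b := 1)).of_isClosed_subset hc ?_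
  intro l hl
  exact ⟨fun i => (hl.1 i).1, fun i => (hl.1 i).2⟩

/-- At an extreme point of the polytope at most `m + 1` weights are fractional: the polytope is cut
out of a cube by `m + 1` equations. -/
lemma card_fractional_le {v : ι → Fin m → ℝ} {s : Finset ι} {r : ℝ} {l : ι → ℝ}
    (hl : l ∈ (polytope v s r).extremePoints ℝ) :
    (Finset.univ.filter fun i => 0 < l i ∧ l i < 1).card ≤ m + 1 := by
  classical
  set F := Finset.univ.filter fun i => 0 < l i ∧ l i < 1 with hF
  rw [mem_extremePoints] at hl
  obtain ⟨⟨h01, hs, hv, hr⟩, hext⟩ := hl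
  by_contra! hcard
  let w : F → (Fin m → ℝ) × ℝ := fun i => (v i, 1)
  have hdep : ¬ LinearIndependent ℝ w := by
    intro h
    have := h.fintype_card_le_finrank
    simp at this
    omega
  obtain ⟨g, hg, i₀, hi₀⟩ := Fintype.not_linearIndependent_iff.1 hdep
  -- the dependency, extended by zero, is a direction along which `l` can move both ways
  let u : ι → ℝ := fun i => if h : i ∈ F then g ⟨i, h⟩ else 0
  have hsum : ∀ f : ι → ℝ, ∑ i, u i * f i = ∑ i : F, g i * f i := by
    intro f
    rw [← Finset.sum_subset (Finset.subset_univ F), ← Finset.sum_coe_sort F]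
    · refine Finset.sum_congr rfl fun i _ => ?_
      simp [u]
    · intro i _ hi
      simp [u, hi]
  have hu1 : ∑ i, u i = 0 := by
    have := congrArg Prod.snd hg
    have h2 := hsum fun _ => 1
    simp only [mul_one] at h2
    rw [h2]
    simpa [w, Prod.snd_sum] using this
  have huv : ∀ k, ∑ i, u i * v i k = 0 := by
    intro k
    have := congrFun (congrArg Prod.fst hg) k
    rw [hsum fun i => v i k]
    simpa [w, Prod.fst_sum, Finset.sum_apply] using this
  obtain ⟨ε, hε, hεl⟩ : ∃ ε : ℝ, 0 < ε ∧ ∀ i, ε * |u i| ≤ l i ∧ ε * |u i| ≤ 1 - l i := by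
    have hev : ∀ i, ∀ᶠ ε in nhdsWithin (0 : ℝ) (Set.Ioi 0),
        ε * |u i| ≤ l i ∧ ε * |u i| ≤ 1 - l i := by
      intro i
      by_cases hi : i ∈ F
      · have hi' := (Finset.mem_filter.1 hi).2
        have ht : Filter.Tendsto (fun ε : ℝ => ε * |u i|) (nhdsWithin 0 (Set.Ioi 0)) (nhds 0) := by
          have : Filter.Tendsto (fun ε : ℝ => ε * |u i|) (nhds 0) (nhds (0 * |u i|)) :=
            (continuous_id.mul continuous_const).tendsto 0
          rw [zero_mul] at this
          exact this.mono_left nhdsWithin_le_nhds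
        exact (ht.eventually_le_const hi'.1).and (ht.eventually_le_const (by linarith [hi'.2]))
      · refine Filter.Eventually.of_forall fun ε => ?_
        have := h01 i
        simp only [u, hi, dite_false, abs_zero, mul_zero]
        constructor <;> linarith
    obtain ⟨ε, h1, h2⟩ := ((Filter.eventually_all.2 hev).and self_mem_nhdsWithin).exists
    exact ⟨ε, h2, h1⟩
  have hmem : ∀ δ : ℝ, |δ| = ε → (fun i => l i + δ * u i) ∈ polytope v s r := by
    intro δ hδ
    refine ⟨fun i => ?_, fun i hi => ?_, fun k => ?_, ?_⟩
    · have h1 := hεl i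
      have h2 : |δ * u i| = ε * |u i| := by rw [abs_mul, hδ]
      have h3 := abs_le.1 h2.le
      constructor <;> linarith [h3.1, h3.2, h1.1, h1.2]
    · have : i ∉ F := by
        intro h
        have := (Finset.mem_filter.1 h).2.1
        rw [hs i hi] at this
        exact lt_irrefl _ this
      simp [u, this, hs i hi]
    · simp only [add_mul, Finset.sum_add_distrib, hv k, mul_assoc, ← Finset.mul_sum, huv k]
      simp
    · simp only [Finset.sum_add_distrib, hr, ← Finset.mul_sum, hu1]
      simp
  have hseg : l ∈ openSegment ℝ (fun i => l i + ε * u i) (fun i => l i + -ε * u i) := by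
    refine ⟨1 / 2, 1 / 2, by norm_num, by norm_num, by norm_num, ?_⟩
    ext i
    simp
    ring
  have := (hext _ (hmem ε (abs_of_pos hε)) _ (hmem (-ε) (by simp [abs_of_pos hε])) hseg).1
  have := congrFun this i₀
  simp only [add_eq_left, mul_eq_zero, hε.ne', false_or] at this
  apply hi₀
  simpa [u] using this

/-- If the weights on `s` have mass `|s| - m`, then some index can be dropped from `s` without
losing this property. -/
lemma exists_erase {v : ι → Fin m → ℝ} [DecidableEq ι] {s : Finset ι} {k : ℕ} (hk : m ≤ k)
    (hs : s.card = k + 1) (h : (polytope v s ((k : ℝ) + 1 - m)).Nonempty) :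
    ∃ i ∈ s, (polytope v (s.erase i) ((k : ℝ) - m)).Nonempty := by
  have hmk : (m : ℝ) ≤ k := by exact_mod_cast hk
  have hne : (polytope v s ((k : ℝ) - m)).Nonempty := by
    obtain ⟨l, h01, hl, hv, hr⟩ := h
    set q : ℝ := ((k : ℝ) - m) / (k + 1 - m) with hq
    have hpos : (0 : ℝ) < k + 1 - m := by linarith
    have hq0 : 0 ≤ q := div_nonneg (by linarith) hpos.le
    have hq1 : q ≤ 1 := (div_le_one hpos).2 (by linarith)
    refine ⟨fun i => q * l i, fun i => ⟨mul_nonneg hq0 (h01 i).1, ?_⟩, fun i hi => ?_,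
      fun k => ?_, ?_⟩
    · exact mul_le_one₀ hq1 (h01 i).1 (h01 i).2
    · simp [hl i hi]
    · simp only [mul_assoc, ← Finset.mul_sum, hv k, mul_zero]
    · rw [← Finset.mul_sum, hr, hq, div_mul_cancel₀ _ hpos.ne']
  obtain ⟨l, hl⟩ := (isCompact_polytope v s _).extremePoints_nonempty hne
  have hF := card_fractional_le hl
  obtain ⟨h01, hls, hv, hr⟩ := hl.1
  suffices ∃ i ∈ s, l i = 0 by
    obtain ⟨i, hi, hi0⟩ := this
    refine ⟨i, hi, l, h01, fun j hj => ?_, hv, hr⟩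
    by_cases hji : j = i
    · rw [hji, hi0]
    · exact hls j fun h => hj (Finset.mem_erase.2 ⟨hji, h⟩)
  -- otherwise at least `k - m` weights equal `1`, which leaves no mass for the others
  by_contra! hpos
  have hpos' : ∀ i ∈ s, 0 < l i := fun i hi => lt_of_le_of_ne (h01 i).1 (hpos i hi).symm
  set F := Finset.univ.filter fun i => 0 < l i ∧ l i < 1 with hFdef
  have hFs : F ⊆ s := by
    intro i hi
    by_contra h
    have := (Finset.mem_filter.1 hi).2.1
    rw [hls i h] at this
    exact lt_irrefl _ this
  have hsum : ∑ i ∈ s, l i = (k : ℝ) - m := by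
    rw [← hr]
    exact Finset.sum_subset (Finset.subset_univ s) fun i _ hi => hls i hi
  rw [← Finset.sum_sdiff hFs] at hsum
  have h1 : ∑ i ∈ s \ F, l i = (s \ F).card := by
    rw [Finset.card_eq_sum_ones, Nat.cast_sum]
    refine Finset.sum_congr rfl fun i hi => ?_
    obtain ⟨hi1, hi2⟩ := Finset.mem_sdiff.1 hi
    have : ¬ l i < 1 := fun h => hi2 (Finset.mem_filter.2 ⟨Finset.mem_univ i, hpos' i hi1, h⟩)
    push_cast
    linarith [(h01 i).2]
  have h2 : (s \ F).card + F.card = k + 1 := by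
    rw [Finset.card_sdiff_add_card_eq_card hFs, hs]
  have h2' : ((s \ F).card : ℝ) + F.card = k + 1 := by exact_mod_cast h2
  have hF' : (F.card : ℝ) ≤ m + 1 := by exact_mod_cast hF
  have h3 : 0 ≤ ∑ i ∈ F, l i := Finset.sum_nonneg fun i _ => (h01 i).1
  have h4 : F.Nonempty → 0 < ∑ i ∈ F, l i := fun h =>
    Finset.sum_pos (fun i hi => (Finset.mem_filter.1 hi).2.1) h
  rcases F.eq_empty_or_nonempty with hemp | hne
  · rw [hemp] at h2' h3
    simp only [Finset.card_empty, Nat.cast_zero, Finset.sum_empty] at h2' h3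
    rw [hemp] at hsum h1
    simp only [Finset.sum_empty] at hsum
    have : (m : ℝ) ≥ 0 := Nat.cast_nonneg m
    linarith
  · linarith [h4 hne]

/-- The invariant of the Steinitz ordering: `s` is small, or it carries weights of mass
`|s| - m`. -/
def Good (v : ι → Fin m → ℝ) (s : Finset ι) : Prop :=
  s.card ≤ m ∨ (polytope v s ((s.card : ℝ) - m)).Nonempty

/-- If `l` are the weights on a good set `s`, then the sum over `s` equals the sum with
weights `1 - l`, whose total mass is `m`. -/
lemma Good.abs_sum_le {v : ι → Fin m → ℝ} {s : Finset ι} {C : ℝ} (h : Good v s)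
    (hC : 0 ≤ C) (hv : ∀ i k, |v i k| ≤ C) (k : Fin m) : |∑ i ∈ s, v i k| ≤ m * C := by
  rcases h with h | ⟨l, h01, hls, hlv, hr⟩
  · calc |∑ i ∈ s, v i k| ≤ ∑ i ∈ s, |v i k| := Finset.abs_sum_le_sum_abs _ _
      _ ≤ ∑ i ∈ s, C := Finset.sum_le_sum fun i _ => hv i k
      _ = s.card * C := by simp
      _ ≤ m * C := by
        have : (s.card : ℝ) ≤ m := by exact_mod_cast h
        gcongr
  · have e1 : ∑ i ∈ s, l i * v i k = 0 := by
      rw [← hlv k]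
      refine Finset.sum_subset (Finset.subset_univ s) fun i _ hi => ?_
      rw [hls i hi, zero_mul]
    have e2 : ∑ i ∈ s, l i = s.card - m := by
      rw [← hr]
      exact Finset.sum_subset (Finset.subset_univ s) fun i _ hi => hls i hi
    calc |∑ i ∈ s, v i k| = |∑ i ∈ s, (1 - l i) * v i k| := by
          simp only [sub_mul, one_mul, Finset.sum_sub_distrib, e1, sub_zero]
      _ ≤ ∑ i ∈ s, |(1 - l i) * v i k| := Finset.abs_sum_le_sum_abs _ _
      _ ≤ ∑ i ∈ s, (1 - l i) * C := by
          refine Finset.sum_le_sum fun i _ => ?_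
          rw [abs_mul, abs_of_nonneg (by linarith [(h01 i).2])]
          exact mul_le_mul_of_nonneg_left (hv i k) (by linarith [(h01 i).2])
      _ = m * C := by
          rw [← Finset.sum_mul, Finset.sum_sub_distrib, e2]
          simp

/-- The Steinitz ordering of a good set, built from its last element backwards. -/
lemma Good.exists_order {v : ι → Fin m → ℝ} {C : ℝ} (hC : 0 ≤ C)
    (hv : ∀ i k, |v i k| ≤ C) : ∀ (t : ℕ) (s : Finset ι), s.card = t → Good v s →
    ∃ L : List ι, (L : Multiset ι) = s.val ∧
      ∀ a k, |((L.take a).map fun i => v i k).sum| ≤ m * C := by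
  classical
  intro t
  induction t with
  | zero =>
    intro s hs _
    obtain rfl := Finset.card_eq_zero.1 hs
    refine ⟨[], by simp, fun a k => ?_⟩
    simp only [List.take_nil, List.map_nil, List.sum_nil, abs_zero]
    positivity
  | succ t ih =>
    intro s hs hgood
    obtain ⟨i, hi, hgi⟩ : ∃ i ∈ s, Good v (s.erase i) := by
      by_cases htm : t + 1 ≤ m
      · obtain ⟨i, hi⟩ : s.Nonempty := Finset.card_pos.1 (by omega)
        exact ⟨i, hi, Or.inl (by rw [Finset.card_erase_of_mem hi]; omega)⟩
      · rcases hgood with h | h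
        · omega
        · rw [hs] at h
          push_cast at h
          obtain ⟨i, hi, h'⟩ := exists_erase (by omega) hs h
          refine ⟨i, hi, Or.inr ?_⟩
          rwa [Finset.card_erase_of_mem hi, hs, Nat.add_sub_cancel]
    obtain ⟨L, hL, hLs⟩ := ih (s.erase i) (by rw [Finset.card_erase_of_mem hi, hs]; rfl) hgi
    have hval : ((L ++ [i] : List ι) : Multiset ι) = s.val := by
      rw [← Multiset.coe_add, hL, Finset.erase_val, add_comm]
      exact Multiset.cons_erase hi
    refine ⟨L ++ [i], hval, fun a k => ?_⟩
    by_cases ha : a ≤ L.length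
    · rw [List.take_append_of_le_length ha]
      exact hLs a k
    · rw [List.take_of_length_le (by simp; omega)]
      have := hgood.abs_sum_le hC hv k
      rwa [Finset.sum, ← hval] at this

/-- **Steinitz lemma** with the constant of Grinberg and Sevastyanov: finitely many vectors of
`ℝᵐ` of sup norm at most `C` and with sum zero can be ordered such that all partial sums have
norm at most `m C`. -/
theorem exists_order (v : ι → Fin m → ℝ) {C : ℝ} (hC : 0 ≤ C) (hv : ∀ i k, |v i k| ≤ C)
    (h0 : ∀ k, ∑ i, v i k = 0) :
    ∃ L : List ι, (L : Multiset ι) = Finset.univ.val ∧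
      ∀ a k, |((L.take a).map fun i => v i k).sum| ≤ m * C := by
  refine Good.exists_order hC hv _ Finset.univ rfl ?_
  by_cases hm : Fintype.card ι ≤ m
  · exact Or.inl hm
  · refine Or.inr ?_
    have hm' : (m : ℝ) ≤ Fintype.card ι := by exact_mod_cast (not_le.1 hm).le
    have hpos : (0 : ℝ) < Fintype.card ι := by exact_mod_cast (by omega)
    rw [Finset.card_univ]
    refine ⟨fun _ => ((Fintype.card ι : ℝ) - m) / Fintype.card ι, fun i => ⟨?_, ?_⟩, ?_, ?_, ?_⟩
    · exact div_nonneg (by linarith) hpos.le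
    · exact (div_le_one hpos).2 (by linarith [Nat.cast_nonneg (α := ℝ) m])
    · intro i hi
      exact absurd (Finset.mem_univ i) hi
    · intro k
      rw [← Finset.mul_sum, h0, mul_zero]
    · simp only [Finset.sum_const, Finset.card_univ, nsmul_eq_mul]
      field_simp

end Steinitz

/-! ### Walks and integer solutions -/

namespace StdIP

open Matrix

variable {m n : ℕ} {A : Matrix (Fin m) (Fin n) ℤ} {b : Fin m → ℤ} {c : Fin n → ℤ}
  {S : Set (Fin m → ℤ)}

/-- The sum of the columns of `A` listed by `p`. -/
def colSum (A : Matrix (Fin m) (Fin n) ℤ) (p : List (Fin n)) (i : Fin m) : ℤ :=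
  (p.map fun j => A i j).sum

lemma isWalk_iff (x : Fin m → ℤ) (p : List (Fin n)) (y : Fin m → ℤ) :
    IsWalk A S x p y ↔ (∀ a, x + colSum A (p.take a) ∈ S) ∧ y = x + colSum A p := by
  have hnil : ∀ x : Fin m → ℤ, x + colSum A [] = x := fun x => by ext i; simp [colSum]
  constructor
  · intro h
    induction h with
    | nil x hx => simpa [hnil] using hx
    | cons x y j p hx h ih =>
      have hcons : ∀ q, (fun i => x i + A i j) + colSum A q = x + colSum A (j :: q) := by
        intro q
        ext i
        simp [colSum, add_assoc]
      refine ⟨fun a => ?_, ih.2.trans (hcons p)⟩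
      cases a with
      | zero => simpa [hnil] using hx
      | succ a =>
        rw [List.take_succ_cons, ← hcons]
        exact ih.1 a
  · rintro ⟨h, rfl⟩
    induction p generalizing x with
    | nil =>
      rw [hnil]
      exact .nil x (by simpa [hnil] using h 0)
    | cons j p ih =>
      have hcons : ∀ q, (fun i => x i + A i j) + colSum A q = x + colSum A (j :: q) := by
        intro q
        ext i
        simp [colSum, add_assoc]
      rw [← hcons]
      refine .cons x _ j p (by simpa [hnil] using h 0) (ih _ fun a => ?_)
      rw [hcons]
      exact h (a + 1)

lemma IsWalk.mono {S' : Set (Fin m → ℤ)} (hS : S ⊆ S') {x y : Fin m → ℤ} {p : List (Fin n)}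
    (h : IsWalk A S x p y) : IsWalk A S' x p y := by
  rw [isWalk_iff] at h ⊢
  exact ⟨fun a => hS (h.1 a), h.2⟩

lemma weight_append (p q : List (Fin n)) : weight c (p ++ q) = weight c p + weight c q := by
  simp [weight]

/-- How often each column is listed by `p`. -/
def countVec (p : List (Fin n)) (j : Fin n) : ℤ := p.count j

lemma sum_map_eq_sum_count (p : List (Fin n)) (f : Fin n → ℤ) :
    (p.map f).sum = ∑ j, f j * countVec p j := by
  induction p with
  | nil => simp [countVec]
  | cons a p ih =>
    have : ∀ j, f j * countVec (a :: p) j = f j * countVec p j + if j = a then f j else 0 := by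
      intro j
      simp only [countVec, List.count_cons]
      by_cases h : j = a
      · subst h; simp [mul_add]
      · simp [h, Ne.symm h]
    simp [this, Finset.sum_add_distrib, ih, add_comm]

lemma mulVec_countVec (p : List (Fin n)) : A *ᵥ countVec p = colSum A p := by
  ext i
  simp [colSum, sum_map_eq_sum_count, Matrix.mulVec, dotProduct]

lemma dotProduct_countVec (p : List (Fin n)) : c ⬝ᵥ countVec p = weight c p := by
  simp [weight, sum_map_eq_sum_count, dotProduct]

lemma countVec_nonneg (p : List (Fin n)) (j : Fin n) : 0 ≤ countVec p j := by
  simp [countVec]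

lemma exists_countVec_eq (x : Fin n → ℤ) (hx : ∀ j, 0 ≤ x j) :
    ∃ p : List (Fin n), countVec p = x := by
  refine ⟨(∑ j, Multiset.replicate (x j).toNat j : Multiset (Fin n)).toList, ?_⟩
  ext j
  rw [countVec, ← Multiset.coe_count, Multiset.coe_toList, Multiset.count_sum']
  simp [Multiset.count_replicate, hx]

lemma colSum_perm {p q : List (Fin n)} (h : p.Perm q) : colSum A p = colSum A q := by
  ext i
  exact (h.map _).sum_eq

lemma weight_perm {p q : List (Fin n)} (h : p.Perm q) : weight c p = weight c q :=
  (h.map _).sum_eq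

/-- The columns listed by `p` can be reordered such that their partial sums stay near the segment
from `0` to their sum: apply the Steinitz lemma to the columns, each diminished by the average. -/
lemma exists_perm_isWalk {Δ : ℕ} (hA : ∀ i j, (A i j).natAbs ≤ Δ) (p : List (Fin n))
    (hb : colSum A p = b) : ∃ q, q.Perm p ∧ IsWalk A (nodes b Δ) 0 q b := by
  have hA' : ∀ i j, |(A i j : ℝ)| ≤ Δ := by
    intro i j
    have := hA i j
    rw [← Int.cast_abs, Int.abs_eq_natAbs]
    exact_mod_cast this
  set t := p.length with ht
  have hpsum : ∀ i, ∑ k : Fin t, (A i p[k] : ℝ) = b i := by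
    intro i
    rw [← hb, colSum]
    push_cast
    rw [← List.sum_ofFn]
    congr 1
    apply List.ext_getElem <;> simp [ht]
  have hbt : ∀ i, |(b i : ℝ) / t| ≤ Δ := by
    intro i
    rcases Nat.eq_zero_or_pos t with h0 | hpos
    · simp [h0]
    · have hpos' : (0 : ℝ) < t := by exact_mod_cast hpos
      rw [abs_div, abs_of_pos hpos', div_le_iff₀ hpos', ← hpsum]
      calc |∑ k : Fin t, (A i p[k] : ℝ)| ≤ ∑ k : Fin t, |(A i p[k] : ℝ)| :=
            Finset.abs_sum_le_sum_abs _ _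
        _ ≤ ∑ k : Fin t, (Δ : ℝ) := Finset.sum_le_sum fun k _ => hA' _ _
        _ = Δ * t := by simp [mul_comm]
  obtain ⟨L, hL, hLs⟩ := Steinitz.exists_order (ι := Fin t)
    (fun k i => (A i p[k] : ℝ) - (b i : ℝ) / t) (C := 2 * Δ) (by positivity)
    (fun k i => by
      have h1 := abs_le.1 (hA' i p[k])
      have h2 := abs_le.1 (hbt i)
      rw [abs_le]
      constructor <;> linarith [h1.1, h1.2, h2.1, h2.2])
    (fun i => by
      rw [Finset.sum_sub_distrib, hpsum]
      rcases Nat.eq_zero_or_pos t with h0 | hpos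
      · rw [← hpsum]
        have : IsEmpty (Fin t) := by rw [h0]; infer_instance
        simp
      · have hpos' : (t : ℝ) ≠ 0 := by exact_mod_cast hpos.ne'
        simp only [Finset.sum_const, Finset.card_univ, Fintype.card_fin, nsmul_eq_mul]
        field_simp
        simp)
  have hperm : L.Perm (List.finRange t) := by
    rw [← Multiset.coe_eq_coe, hL]
    rfl
  have hlen : L.length = t := by simpa using hperm.length_eq
  have hq : (L.map fun k => p[k]).Perm p := by
    have := hperm.map fun k => p[k]
    refine this.trans (List.Perm.of_eq ?_)
    apply List.ext_getElem <;> simp [ht]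
  refine ⟨L.map fun k => p[k], hq, ?_⟩
  rw [isWalk_iff, colSum_perm hq, hb]
  refine ⟨fun a => ?_, by simp⟩
  rw [zero_add]
  refine ⟨((L.take a).length : ℝ) / t, by positivity, ?_, fun i => ?_⟩
  · apply div_le_one_of_le₀ _ (by positivity)
    have : (L.take a).length ≤ t := by
      rw [List.length_take, hlen]
      exact min_le_right _ _
    exact_mod_cast this
  · have h := hLs a i
    have e : ((L.take a).map fun k => (A i p[k] : ℝ) - (b i : ℝ) / t).sum
        = (colSum A ((L.map fun k => p[k]).take a) i : ℝ)
          - ((L.take a).length : ℝ) / t * b i := by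
      rw [List.map_take.symm, colSum]
      generalize L.take a = L'
      clear h
      induction L' with
      | nil => simp
      | cons k L' ih =>
        simp only [List.map_cons, List.sum_cons, List.length_cons, Int.cast_add] at ih ⊢
        rw [ih]
        push_cast
        ring
    rw [e] at h
    linarith [h]

lemma IsWalk.countVec_mem {p : List (Fin n)} (h : IsWalk A S 0 p b) :
    countVec p ∈ feasibleSet A b := by
  rw [isWalk_iff, zero_add] at h
  exact ⟨by rw [mulVec_countVec, h.2], countVec_nonneg p⟩

lemma exists_isWalk_of_mem {Δ : ℕ} (hA : ∀ i j, (A i j).natAbs ≤ Δ) {x : Fin n → ℤ}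
    (hx : x ∈ feasibleSet A b) (c : Fin n → ℤ) :
    ∃ p, IsWalk A (nodes b Δ) 0 p b ∧ weight c p = c ⬝ᵥ x := by
  obtain ⟨p, rfl⟩ := exists_countVec_eq x hx.2
  obtain ⟨q, hqp, hq⟩ := exists_perm_isWalk (b := b) hA p (by rw [← mulVec_countVec, hx.1])
  exact ⟨q, hq, by rw [weight_perm hqp, dotProduct_countVec]⟩

lemma feasible_iff {Δ : ℕ} (hA : ∀ i j, (A i j).natAbs ≤ Δ) (hS : nodes b Δ ⊆ S) :
    (feasibleSet A b).Nonempty ↔ ∃ p, IsWalk A S 0 p b := by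
  constructor
  · rintro ⟨x, hx⟩
    obtain ⟨p, hp, _⟩ := exists_isWalk_of_mem hA hx 0
    exact ⟨p, hp.mono hS⟩
  · rintro ⟨p, hp⟩
    exact ⟨_, hp.countVec_mem⟩

lemma isUnbounded_of_ray {x y : Fin n → ℤ} (hx : x ∈ feasibleSet A b)
    (hy : y ∈ feasibleSet A 0) (hc : 0 < c ⬝ᵥ y) : IsUnbounded A b c := by
  intro M
  set N : ℤ := |M| + |c ⬝ᵥ x| + 1 with hN
  have hN0 : 0 ≤ N := by positivity
  refine ⟨x + N • y, ⟨?_, fun j => ?_⟩, ?_⟩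
  · rw [mulVec_add, mulVec_smul, hx.1, hy.1]
    simp
  · have := mul_nonneg hN0 (hy.2 j)
    have := hx.2 j
    simp only [Pi.add_apply, Pi.smul_apply, smul_eq_mul]
    linarith
  · rw [dotProduct_add, dotProduct_smul, smul_eq_mul]
    have h1 : N * 1 ≤ N * (c ⬝ᵥ y) := by gcongr; omega
    have h2 := le_abs_self M
    have h3 := neg_abs_le (c ⬝ᵥ x)
    linarith

/-- An unbounded integer program has an improving integral ray: among feasible points of
increasing objective value two are comparable, by Dickson's lemma. -/
lemma exists_ray_of_isUnbounded (h : IsUnbounded A b c) :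
    ∃ y ∈ feasibleSet A 0, 0 < c ⬝ᵥ y := by
  choose f hf hfM using h
  let g : ℕ → Fin n → ℤ := fun k => Nat.rec (f 0) (fun _ x => f (c ⬝ᵥ x)) k
  have hgmem : ∀ k, g k ∈ feasibleSet A b := by
    intro k
    cases k with
    | zero => exact hf 0
    | succ k => exact hf _
  have hgmono : StrictMono fun k => c ⬝ᵥ g k := strictMono_nat_of_lt_succ fun k => hfM _
  obtain ⟨k, l, hkl, hle⟩ :=
    wellQuasiOrdered_le (α := Fin n → ℕ) fun k j => (g k j).toNat
  refine ⟨g l - g k, ⟨?_, fun j => ?_⟩, ?_⟩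
  · rw [mulVec_sub, (hgmem l).1, (hgmem k).1, sub_self]
  · have h1 : (g k j).toNat ≤ (g l j).toNat := hle j
    have h2 := (hgmem k).2 j
    have h3 := (hgmem l).2 j
    simp only [Pi.sub_apply]
    omega
  · rw [dotProduct_sub]
    linarith [hgmono hkl]

lemma isUnbounded_of_cycle (hf : (feasibleSet A b).Nonempty) {x : Fin m → ℤ} {q : List (Fin n)}
    (hq : IsWalk A S x q x) (hc : 0 < weight c q) : IsUnbounded A b c := by
  obtain ⟨z, hz⟩ := hf
  refine isUnbounded_of_ray hz (y := countVec q) ⟨?_, countVec_nonneg q⟩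
    (by rwa [dotProduct_countVec])
  rw [isWalk_iff] at hq
  rw [mulVec_countVec]
  exact (add_eq_left.1 hq.2.symm)

lemma nodes_zero_subset (b : Fin m → ℤ) (Δ : ℕ) : nodes 0 Δ ⊆ nodes b Δ := by
  rintro x ⟨s, _, _, h⟩
  exact ⟨0, le_rfl, zero_le_one, fun i => by simpa using h i⟩

lemma isUnbounded_iff {Δ : ℕ} (hA : ∀ i j, (A i j).natAbs ≤ Δ) (hS : nodes b Δ ⊆ S)
    (hf : (feasibleSet A b).Nonempty) :
    IsUnbounded A b c ↔
      ∃ x p q, IsWalk A S 0 p x ∧ IsWalk A S x q x ∧ 0 < weight c q := by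
  constructor
  · intro h
    obtain ⟨y, hy, hcy⟩ := exists_ray_of_isUnbounded h
    obtain ⟨q, hq, hqw⟩ := exists_isWalk_of_mem hA hy c
    have hq' := hq.mono ((nodes_zero_subset b Δ).trans hS)
    refine ⟨0, [], q, .nil 0 ?_, hq', by rwa [hqw]⟩
    have := ((isWalk_iff _ _ _).1 hq').1 0
    rwa [List.take_zero, show colSum A [] = 0 from rfl, add_zero] at this
  · rintro ⟨x, p, q, _, hq, hc⟩
    exact isUnbounded_of_cycle hf hq hc

lemma walk_weights_eq {Δ : ℕ} (hA : ∀ i j, (A i j).natAbs ≤ Δ) (hS : nodes b Δ ⊆ S) :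
    {w | ∃ p, IsWalk A S 0 p b ∧ weight c p = w} = {w | ∃ x ∈ feasibleSet A b, c ⬝ᵥ x = w} := by
  ext w
  constructor
  · rintro ⟨p, hp, rfl⟩
    exact ⟨_, hp.countVec_mem, dotProduct_countVec p⟩
  · rintro ⟨x, hx, rfl⟩
    obtain ⟨p, hp, hw⟩ := exists_isWalk_of_mem hA hx c
    exact ⟨p, hp.mono hS, hw⟩

lemma optimal_value_iff {Δ : ℕ} (hA : ∀ i j, (A i j).natAbs ≤ Δ) (hS : nodes b Δ ⊆ S) (v : ℤ) :
    (∃ x, IsOptimal A b c x ∧ c ⬝ᵥ x = v) ↔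
      IsGreatest {w | ∃ p, IsWalk A S 0 p b ∧ weight c p = w} v := by
  rw [walk_weights_eq hA hS]
  constructor
  · rintro ⟨x, ⟨hx, hopt⟩, rfl⟩
    refine ⟨⟨x, hx, rfl⟩, ?_⟩
    rintro _ ⟨y, hy, rfl⟩
    exact hopt y hy
  · rintro ⟨⟨x, hx, rfl⟩, hub⟩
    exact ⟨x, ⟨hx, fun y hy => hub ⟨y, hy, rfl⟩⟩, rfl⟩

end StdIP

/-! ### A loop language on the random access machine -/

namespace RAM

/-- Started in `σ`, the program `p` halts within `N` steps in a configuration with property `Q`. -/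
def Ends (p : Prog) (σ : State) (N : ℕ) (Q : State → Prop) : Prop :=
  ∃ t τ, Runs p σ t τ ∧ t ≤ N ∧ Q τ

namespace Ends

variable {p q : Prog} {σ : State} {N N' a b r s t : ℕ} {k : ℤ} {Q Q' : State → Prop}

lemma mono (h : Ends p σ N Q) (hN : N ≤ N') (hQ : ∀ τ, Q τ → Q' τ) : Ends p σ N' Q' := by
  obtain ⟨t, τ, h1, h2, h3⟩ := h
  exact ⟨t, τ, h1, h2.trans hN, hQ _ h3⟩

lemma const (h : Q (σ.setReg r k)) : Ends (.const r k) σ 1 Q := ⟨1, _, .const _ _ _, le_rfl, h⟩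

lemma add (h : Q (σ.setReg r (σ.reg s + σ.reg t))) : Ends (.add r s t) σ 1 Q :=
  ⟨1, _, .add _ _ _ _, le_rfl, h⟩

lemma sub (h : Q (σ.setReg r (σ.reg s - σ.reg t))) : Ends (.sub r s t) σ 1 Q :=
  ⟨1, _, .sub _ _ _ _, le_rfl, h⟩

lemma load (h : Q (σ.setReg r (σ.mem (σ.reg s)))) : Ends (.load r s) σ 1 Q :=
  ⟨1, _, .load _ _ _, le_rfl, h⟩

lemma store (h : Q (σ.setMem (σ.reg r) (σ.reg s))) : Ends (.store r s) σ 1 Q :=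
  ⟨1, _, .store _ _ _, le_rfl, h⟩

lemma seq (h : Ends p σ a fun τ => Ends q τ b Q) : Ends (.seq p q) σ (a + b) Q := by
  obtain ⟨t, τ, h1, h2, u, υ, h3, h4, h5⟩ := h
  exact ⟨t + u, υ, .seq _ _ _ _ _ _ _ h1 h3, add_le_add h2 h4, h5⟩

lemma ite (hp : 0 < σ.reg r → Ends p σ N Q) (hq : σ.reg r ≤ 0 → Ends q σ N Q) :
    Ends (.ite r p q) σ (N + 1) Q := by
  rcases lt_or_ge 0 (σ.reg r) with h | h
  · obtain ⟨t, τ, h1, h2, h3⟩ := hp h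
    exact ⟨t + 1, τ, .ite_pos _ _ _ _ _ _ h h1, by omega, h3⟩
  · obtain ⟨t, τ, h1, h2, h3⟩ := hq h
    exact ⟨t + 1, τ, .ite_neg _ _ _ _ _ _ h h1, by omega, h3⟩

end Ends

@[simp] lemma State.reg_setReg (σ : State) (r s : ℕ) (v : ℤ) :
    (σ.setReg r v).reg s = if s = r then v else σ.reg s := by
  simp [State.setReg, Function.update_apply]

@[simp] lemma State.mem_setReg (σ : State) (r : ℕ) (v : ℤ) : (σ.setReg r v).mem = σ.mem := rfl

@[simp] lemma State.reg_setMem (σ : State) (a v : ℤ) : (σ.setMem a v).reg = σ.reg := rfl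

@[simp] lemma State.mem_setMem (σ : State) (a v x : ℤ) :
    (σ.setMem a v).mem x = if x = a then v else σ.mem x := by
  simp [State.setMem, Function.update_apply]

end RAM

/-! The language has variables and arrays indexed by all integers. Its only loops are counted ones,
so that every command has a total functional semantics. -/

namespace Loop

open RAM

/-- Integer expressions over variables `V` and arrays `T`. -/
inductive Expr (V T : Type) where
  | var (v : V)
  | lit (k : ℤ)
  | add (a b : Expr V T)
  | sub (a b : Expr V T)
  | get (t : T) (i : Expr V T)

/-- Commands. In `for_ v e c` the body `c` is run `e` times, where `e` is evaluated once, and `v` is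
set to `0, 1, 2, …` before the successive runs. -/
inductive Cmd (V T : Type) where
  | set (v : V) (e : Expr V T)
  | put (t : T) (i e : Expr V T)
  | seq (p q : Cmd V T)
  | ite (e : Expr V T) (p q : Cmd V T)
  | for_ (v : V) (e : Expr V T) (c : Cmd V T)

/-- Contents of the variables and arrays. -/
structure Store (V T : Type) where
  var : V → ℤ
  arr : T → ℤ → ℤ

variable {V T : Type} [DecidableEq V] [DecidableEq T]

/-- Assign `x` to the variable `v`. -/
def Store.setVar (M : Store V T) (v : V) (x : ℤ) : Store V T :=
  { M with var := Function.update M.var v x }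

/-- Assign `x` to the entry `i` of the array `t`. -/
def Store.setArr (M : Store V T) (t : T) (i x : ℤ) : Store V T :=
  { M with arr := Function.update M.arr t (Function.update (M.arr t) i x) }

omit [DecidableEq T] in
@[simp] lemma Store.var_setVar (M : Store V T) (v w : V) (x : ℤ) :
    (M.setVar v x).var w = if w = v then x else M.var w := by
  simp [Store.setVar, Function.update_apply]

omit [DecidableEq T] in
@[simp] lemma Store.arr_setVar (M : Store V T) (v : V) (x : ℤ) : (M.setVar v x).arr = M.arr := rfl

omit [DecidableEq V] in
@[simp] lemma Store.var_setArr (M : Store V T) (t : T) (i x : ℤ) : (M.setArr t i x).var = M.var :=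
  rfl

omit [DecidableEq V] in
@[simp] lemma Store.arr_setArr (M : Store V T) (t s : T) (i x : ℤ) :
    (M.setArr t i x).arr s = if s = t then Function.update (M.arr t) i x else M.arr s := by
  by_cases h : s = t
  · subst h; simp [Store.setArr]
  · simp [Store.setArr, h]

/-- Value of an expression. -/
@[simp] def Expr.eval : Expr V T → Store V T → ℤ
  | var v, M => M.var v
  | lit k, _ => k
  | add a b, M => a.eval M + b.eval M
  | sub a b, M => a.eval M - b.eval M
  | get t i, M => M.arr t (i.eval M)

/-- Number of machine steps for an expression. -/
@[simp] def Expr.cost : Expr V T → ℕ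
  | var _ => 2
  | lit _ => 1
  | add a b => a.cost + b.cost + 1
  | sub a b => a.cost + b.cost + 1
  | get _ i => i.cost + 11

namespace Cmd

/-- The effect of a command. -/
def denote : Cmd V T → Store V T → Store V T
  | set v e, M => M.setVar v (e.eval M)
  | put t i e, M => M.setArr t (i.eval M) (e.eval M)
  | seq p q, M => q.denote (p.denote M)
  | ite e p q, M => if 0 < e.eval M then p.denote M else q.denote M
  | for_ v e c, M => Nat.rec M (fun i M' => c.denote (M'.setVar v i)) (e.eval M).toNat

/-- The store after `k` runs of the body `c` of a loop with running variable `v`. -/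
def iter (v : V) (c : Cmd V T) (M : Store V T) (k : ℕ) : Store V T :=
  Nat.rec M (fun i M' => c.denote (M'.setVar v i)) k

/-- Number of machine steps that suffice for a command. -/
def cost : Cmd V T → Store V T → ℕ
  | set _ e, _ => e.cost + 2
  | put _ i e, _ => i.cost + e.cost + 11
  | seq p q, M => p.cost M + q.cost (p.denote M)
  | ite e p q, M => e.cost + 1 + if 0 < e.eval M then p.cost M else q.cost M
  | for_ v e c, M => e.cost + 4 +
      ∑ i ∈ Finset.range (e.eval M).toNat, (c.cost ((iter v c M i).setVar v i) + 6)

/-- Whether the command assigns to the variable `w`. -/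
def writesVar : Cmd V T → V → Bool
  | set v _, w => w = v
  | put _ _ _, _ => false
  | seq p q, w => p.writesVar w || q.writesVar w
  | ite _ p q, w => p.writesVar w || q.writesVar w
  | for_ v _ c, w => w = v || c.writesVar w

/-- Whether the command assigns to the array `s`. -/
def writesArr : Cmd V T → T → Bool
  | set _ _, _ => false
  | put t _ _, s => s = t
  | seq p q, s => p.writesArr s || q.writesArr s
  | ite _ p q, s => p.writesArr s || q.writesArr s
  | for_ _ _ c, s => c.writesArr s

lemma var_denote (c : Cmd V T) (M : Store V T) (w : V) (h : c.writesVar w = false) :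
    (c.denote M).var w = M.var w := by
  induction c generalizing M with
  | set v e => simp_all [writesVar, denote]
  | put t i e => simp [denote]
  | seq p q ihp ihq =>
    simp only [writesVar, Bool.or_eq_false_iff] at h
    rw [denote, ihq _ h.2, ihp _ h.1]
  | ite e p q ihp ihq =>
    simp only [writesVar, Bool.or_eq_false_iff] at h
    rw [denote]
    split_ifs
    exacts [ihp _ h.1, ihq _ h.2]
  | for_ v e c ih =>
    simp only [writesVar, Bool.or_eq_false_iff, decide_eq_false_iff_not] at h
    rw [denote]
    induction (e.eval M).toNat with
    | zero => rfl
    | succ k ihk =>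
      simp only []
      rw [ih _ h.2, Store.var_setVar, if_neg h.1, ihk]

lemma arr_denote (c : Cmd V T) (M : Store V T) (s : T) (h : c.writesArr s = false) :
    (c.denote M).arr s = M.arr s := by
  induction c generalizing M with
  | set v e => simp [denote]
  | put t i e => simp_all [writesArr, denote]
  | seq p q ihp ihq =>
    simp only [writesArr, Bool.or_eq_false_iff] at h
    rw [denote, ihq _ h.2, ihp _ h.1]
  | ite e p q ihp ihq =>
    simp only [writesArr, Bool.or_eq_false_iff] at h
    rw [denote]
    split_ifs
    exacts [ihp _ h.1, ihq _ h.2]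
  | for_ v e c ih =>
    rw [denote]
    induction (e.eval M).toNat with
    | zero => rfl
    | succ k ihk =>
      simp only []
      rw [ih _ h, Store.arr_setVar, ihk]

end Cmd

/-! The compiler. Variable number `k` is kept in register `4 k`; a loop at nesting depth `d` uses the
registers `4 d + 1` and `4 d + 2`; the registers `4 d + 3` hold intermediate values. -/

/-- The memory address of the entry `i` of array number `t`. Array number `0` covers the
nonnegative addresses, where the input stands; the other entries are spread over the negative
addresses. -/
def adr (t : ℕ) (i : ℤ) : ℤ :=
  if t = 0 then (if 0 ≤ i then i else 32 * i)
  else if 0 < i then -(32 * i + t) else 32 * i - (16 + t)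

lemma adr_inj {t s : ℕ} {i j : ℤ} (ht : t < 16) (hs : s < 16) :
    adr t i = adr s j ↔ t = s ∧ i = j := by
  constructor
  · unfold adr
    intro h
    split_ifs at h <;> omega
  · rintro ⟨rfl, rfl⟩
    rfl

/-- Multiply register `r` by `32`. -/
def shiftProg (r : ℕ) : Prog :=
  .seq (.add r r r) (.seq (.add r r r) (.seq (.add r r r) (.seq (.add r r r) (.add r r r))))

/-- Replace the content `i` of register `4 d + 3` by `adr t i`. -/
def adrProg (t d : ℕ) : Prog :=
  if t = 0 then
    .seq (.const (4 * d + 7) 1) (.seq (.add (4 * d + 7) (4 * d + 3) (4 * d + 7))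
      (.ite (4 * d + 7) (.const (4 * d + 7) 0) (shiftProg (4 * d + 3))))
  else
    .ite (4 * d + 3)
      (.seq (shiftProg (4 * d + 3)) (.seq (.const (4 * d + 7) t)
        (.seq (.add (4 * d + 3) (4 * d + 3) (4 * d + 7)) (.seq (.const (4 * d + 7) 0)
          (.sub (4 * d + 3) (4 * d + 7) (4 * d + 3))))))
      (.seq (shiftProg (4 * d + 3)) (.seq (.const (4 * d + 7) (16 + t))
        (.sub (4 * d + 3) (4 * d + 3) (4 * d + 7))))

lemma shiftProg_ends (r : ℕ) (σ : State) (Q : State → Prop)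
    (h : ∀ τ : State, τ.mem = σ.mem → τ.reg r = 32 * σ.reg r →
      (∀ s, s ≠ r → τ.reg s = σ.reg s) → Q τ) :
    Ends (shiftProg r) σ 5 Q := by
  refine (Ends.seq (a := 1) (b := 4) (Ends.add (Ends.seq (a := 1) (b := 3) (Ends.add
    (Ends.seq (a := 1) (b := 2) (Ends.add (Ends.seq (a := 1) (b := 1) (Ends.add
    (Ends.add (h _ ?_ ?_ ?_)))))))))) 
  · simp
  · simp only [State.reg_setReg, if_true]; ring
  · intro s hs; simp [hs]

lemma adrProg_ends (t d : ℕ) (σ : State) (Q : State → Prop)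
    (h : ∀ τ : State, τ.mem = σ.mem → τ.reg (4 * d + 3) = adr t (σ.reg (4 * d + 3)) →
      (∀ s, s ≠ 4 * d + 3 → s ≠ 4 * d + 7 → τ.reg s = σ.reg s) → Q τ) :
    Ends (adrProg t d) σ 10 Q := by
  unfold adrProg
  split_ifs with ht
  · refine Ends.mono (Ends.seq (a := 1) (b := 7) (Ends.const (Ends.seq (a := 1) (b := 6)
      (Ends.add (Ends.ite (N := 5) (fun hp => Ends.mono (Ends.const (h _ ?_ ?_ ?_)) (by norm_num)
        fun _ h => h) (fun hp => shiftProg_ends _ _ _ fun τ h1 h2 h3 => h τ ?_ ?_ ?_))))))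
      (by norm_num) fun _ h => h
    · simp
    · simp only [State.reg_setReg] at hp
      simp at hp
      simp [adr, ht]
      omega
    · intro s h1 h2; simp [h2]
    · simpa using h1
    · rw [h2]
      simp only [State.reg_setReg] at hp
      simp at hp
      simp [adr, ht]
      omega
    · intro s h4 h5
      rw [h3 s h4]
      simp [h5]
  · refine Ends.mono (Ends.ite (N := 9) (fun hp => Ends.seq (a := 5) (b := 4)
      (shiftProg_ends _ _ _ fun τ h1 h2 h3 => Ends.seq (a := 1) (b := 3) (Ends.const
        (Ends.seq (a := 1) (b := 2) (Ends.add (Ends.seq (a := 1) (b := 1) (Ends.const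
          (Ends.sub (h _ ?_ ?_ ?_)))))))))
      (fun hp => Ends.mono (Ends.seq (a := 5) (b := 2)
        (shiftProg_ends _ _ _ fun τ h1 h2 h3 => Ends.seq (a := 1) (b := 1) (Ends.const
          (Ends.sub (h _ ?_ ?_ ?_))))) (by norm_num) fun _ h => h)) (by norm_num) fun _ h => h
    · simpa using h1
    · simp [adr, ht, hp, h2]
    · intro s h4 h5
      simp [h4, h5, h3]
    · simpa using h1
    · simp [adr, ht, not_lt.2 hp, h2]
    · intro s h4 h5
      simp [h4, h5, h3]

/-- A numbering of the variables, and of the arrays by `0, …, 15`. -/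
structure Layout (V T : Type) where
  var : V → ℕ
  var_inj : Function.Injective var
  arr : T → ℕ
  arr_inj : Function.Injective arr
  arr_lt : ∀ t, arr t < 16

/-- The machine configuration `σ` represents the store `M`. -/
structure Rep (l : Layout V T) (σ : State) (M : Store V T) : Prop where
  var : ∀ v, σ.reg (4 * l.var v) = M.var v
  arr : ∀ t i, σ.mem (adr (l.arr t) i) = M.arr t i

/-- Code that leaves the value of an expression in register `4 d + 3` and changes no other
registers than intermediate ones. -/
def Expr.compile (l : Layout V T) : Expr V T → ℕ → Prog
  | var v, d => .seq (.const (4 * d + 7) 0) (.add (4 * d + 3) (4 * l.var v) (4 * d + 7))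
  | lit k, d => .const (4 * d + 3) k
  | add a b, d => .seq (a.compile l d) (.seq (b.compile l (d + 1))
      (.add (4 * d + 3) (4 * d + 3) (4 * (d + 1) + 3)))
  | sub a b, d => .seq (a.compile l d) (.seq (b.compile l (d + 1))
      (.sub (4 * d + 3) (4 * d + 3) (4 * (d + 1) + 3)))
  | get t i, d => .seq (i.compile l d) (.seq (adrProg (l.arr t) d)
      (.load (4 * d + 3) (4 * d + 3)))

/-- `τ` differs from `σ` only in registers for intermediate values of number at least `d`. -/
def TempEq (d : ℕ) (σ τ : State) : Prop :=
  τ.mem = σ.mem ∧ ∀ r, (∀ k, d ≤ k → r ≠ 4 * k + 3) → τ.reg r = σ.reg r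

lemma TempEq.trans {d : ℕ} {σ τ υ : State} (h1 : TempEq d σ τ) (h2 : TempEq d τ υ) :
    TempEq d σ υ :=
  ⟨h2.1.trans h1.1, fun r hr => (h2.2 r hr).trans (h1.2 r hr)⟩

lemma TempEq.mono {d e : ℕ} {σ τ : State} (hde : d ≤ e) (h : TempEq e σ τ) : TempEq d σ τ :=
  ⟨h.1, fun r hr => h.2 r fun k hk => hr k (hde.trans hk)⟩

lemma TempEq.setReg {d e : ℕ} (σ : State) (hde : d ≤ e) (x : ℤ) :
    TempEq d σ (σ.setReg (4 * e + 3) x) :=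
  ⟨rfl, fun r hr => by simp [hr e hde]⟩

omit [DecidableEq V] [DecidableEq T] in
lemma TempEq.rep {l : Layout V T} {d : ℕ} {σ τ : State} {M : Store V T} (h : TempEq d σ τ)
    (hr : Rep l σ M) : Rep l τ M :=
  ⟨fun v => by rw [h.2 _ fun k _ => by omega, hr.var], fun t i => by rw [h.1, hr.arr]⟩

omit [DecidableEq V] [DecidableEq T] in
lemma Expr.compile_ends (l : Layout V T) (e : Expr V T) (M : Store V T) :
    ∀ (d : ℕ) (σ : State) (Q : State → Prop), Rep l σ M →
      (∀ τ, TempEq d σ τ → τ.reg (4 * d + 3) = e.eval M → Q τ) →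
      Ends (e.compile l d) σ e.cost Q := by
  induction e with
  | var v =>
    intro d σ Q hr h
    refine Ends.seq (a := 1) (b := 1) (Ends.const (Ends.add (h _ ?_ ?_)))
    · exact (TempEq.setReg σ (e := d + 1) (by omega) _).trans (TempEq.setReg _ le_rfl _)
    · have : ¬ 4 * l.var v = 4 * d + 7 := by omega
      simp [hr.var, this]
  | lit k =>
    intro d σ Q hr h
    exact Ends.const (h _ (TempEq.setReg _ le_rfl _) (by simp))
  | add a b iha ihb =>
    intro d σ Q hr h
    refine Ends.mono (Ends.seq (b := b.cost + 1) (iha d σ _ hr fun τ h1 h2 => Ends.seq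
      (ihb (d + 1) τ _ (h1.rep hr) fun υ h3 h4 => Ends.add (h _ ?_ ?_))))
      (by simp [add_assoc]) fun _ h => h
    · exact (h1.trans (h3.mono (by omega))).trans (TempEq.setReg _ le_rfl _)
    · rw [State.reg_setReg, if_pos rfl, h4, h3.2 _ fun k hk => by omega, h2, eval]
  | sub a b iha ihb =>
    intro d σ Q hr h
    refine Ends.mono (Ends.seq (b := b.cost + 1) (iha d σ _ hr fun τ h1 h2 => Ends.seq
      (ihb (d + 1) τ _ (h1.rep hr) fun υ h3 h4 => Ends.sub (h _ ?_ ?_))))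
      (by simp [add_assoc]) fun _ h => h
    · exact (h1.trans (h3.mono (by omega))).trans (TempEq.setReg _ le_rfl _)
    · rw [State.reg_setReg, if_pos rfl, h4, h3.2 _ fun k hk => by omega, h2, eval]
  | get t i ih =>
    intro d σ Q hr h
    refine Ends.seq (b := 11) (ih d σ _ hr fun τ h1 h2 => Ends.seq (a := 10) (b := 1)
      (adrProg_ends _ _ _ _ fun υ h3 h4 h5 => Ends.load (h _ ?_ ?_)))
    · refine TempEq.trans (TempEq.trans h1 ⟨h3, fun r hr => h5 r (hr d le_rfl) ?_⟩)
        (TempEq.setReg _ le_rfl _)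
      exact hr (d + 1) (by omega)
    · rw [State.reg_setReg, if_pos rfl, h4, h3, h2, (h1.rep hr).arr, eval]

/-- Code for a command that stands at loop depth `d`. -/
def Cmd.compile (l : Layout V T) : Cmd V T → ℕ → Prog
  | set v e, _ => .seq (e.compile l 0) (.seq (.const 7 0) (.add (4 * l.var v) 3 7))
  | put t i e, _ => .seq (i.compile l 0) (.seq (adrProg (l.arr t) 0)
      (.seq (e.compile l 1) (.store 3 7)))
  | seq p q, d => .seq (p.compile l d) (q.compile l d)
  | ite e p q, d => .seq (e.compile l 0) (.ite 3 (p.compile l d) (q.compile l d))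
  | for_ v e c, d => .seq (e.compile l 0) (.seq (.const 7 0) (.seq (.add (4 * d + 1) 3 7)
      (.seq (.const (4 * d + 2) 0) (.loop (4 * d + 1)
        (.seq (.const 3 0) (.seq (.add (4 * l.var v) (4 * d + 2) 3) (.seq (c.compile l (d + 1))
          (.seq (.const 3 1) (.seq (.add (4 * d + 2) (4 * d + 2) 3)
            (.sub (4 * d + 1) (4 * d + 1) 3))))))))))

/-- The loop registers of depth less than `d` agree. -/
def LoopEq (d : ℕ) (σ τ : State) : Prop :=
  ∀ k, k < d → τ.reg (4 * k + 1) = σ.reg (4 * k + 1) ∧ τ.reg (4 * k + 2) = σ.reg (4 * k + 2)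

lemma TempEq.loopEq {e d : ℕ} {σ τ : State} (h : TempEq e σ τ) : LoopEq d σ τ :=
  fun _ _ => ⟨h.2 _ fun _ _ => by omega, h.2 _ fun _ _ => by omega⟩

lemma LoopEq.trans {d : ℕ} {σ τ υ : State} (h1 : LoopEq d σ τ) (h2 : LoopEq d τ υ) :
    LoopEq d σ υ :=
  fun k hk => ⟨(h2 k hk).1.trans (h1 k hk).1, (h2 k hk).2.trans (h1 k hk).2⟩

omit [DecidableEq T] in
lemma Rep.setVar {l : Layout V T} {σ : State} {M : Store V T} (h : Rep l σ M) (v : V) {x y : ℤ}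
    (hxy : x = y) : Rep l (σ.setReg (4 * l.var v) x) (M.setVar v y) := by
  subst hxy
  refine ⟨fun w => ?_, fun t i => h.arr t i⟩
  by_cases hw : w = v
  · simp [hw]
  · have : l.var w ≠ l.var v := fun h => hw (l.var_inj h)
    simp [hw, this, h.var]

omit [DecidableEq V] [DecidableEq T] in
lemma Rep.setReg {l : Layout V T} {σ : State} {M : Store V T} (h : Rep l σ M) (r : ℕ) (x : ℤ)
    (hr : r % 4 ≠ 0) : Rep l (σ.setReg r x) M := by
  refine ⟨fun w => ?_, fun t i => h.arr t i⟩
  have : ¬ 4 * l.var w = r := by omega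
  simp [this, h.var]

omit [DecidableEq V] in
lemma Rep.setArr {l : Layout V T} {σ : State} {M : Store V T} (h : Rep l σ M) (t : T) {i a x y : ℤ}
    (ha : a = adr (l.arr t) i) (hxy : x = y) : Rep l (σ.setMem a x) (M.setArr t i y) := by
  subst hxy ha
  refine ⟨fun w => h.var w, fun s j => ?_⟩
  rw [State.mem_setMem]
  by_cases hs : s = t
  · subst hs
    by_cases hj : j = i
    · simp [hj]
    · simp [hj, adr_inj (l.arr_lt s) (l.arr_lt s), h.arr]
  · have : l.arr s ≠ l.arr t := fun h => hs (l.arr_inj h)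
    simp [hs, adr_inj (l.arr_lt s) (l.arr_lt t), h.arr, this]

lemma setReg_loopEq {d : ℕ} (σ : State) (r : ℕ) (x : ℤ)
    (hr : ∀ k, k < d → r ≠ 4 * k + 1 ∧ r ≠ 4 * k + 2) : LoopEq d σ (σ.setReg r x) := by
  intro k hk
  simp [(hr k hk).1.symm, (hr k hk).2.symm]

lemma Cmd.compile_ends (l : Layout V T) (c : Cmd V T) :
    ∀ (M : Store V T) (d : ℕ) (σ : State), Rep l σ M →
      Ends (c.compile l d) σ (c.cost M) fun τ => Rep l τ (c.denote M) ∧ LoopEq d σ τ := by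
  induction c with
  | set v e =>
    intro M d σ hr
    refine Ends.seq (b := 2) (e.compile_ends l M 0 σ _ hr fun τ h1 h2 => Ends.seq (a := 1) (b := 1)
      (Ends.const (Ends.add ⟨?_, ?_⟩)))
    · exact ((h1.rep hr).setReg 7 0 (by norm_num)).setVar v (by simpa using h2)
    · refine h1.loopEq.trans ((setReg_loopEq _ _ _ ?_).trans (setReg_loopEq _ _ _ ?_)) <;>
      · intro k hk
        omega
  | put t i e =>
    intro M d σ hr
    refine Ends.mono (Ends.seq (b := 10 + (e.cost + 1)) (i.compile_ends l M 0 σ _ hr fun τ h1 h2 =>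
      Ends.seq (a := 10) (adrProg_ends _ 0 _ _ fun υ h3 h4 h5 => Ends.seq (b := 1) ?_)))
      (by simp only [cost]; omega) fun _ h => h
    have h6 : TempEq 0 σ υ :=
      h1.trans ⟨h3, fun r hr => h5 r (hr 0 le_rfl) (hr 1 (by norm_num))⟩
    refine e.compile_ends l M 1 υ _ (h6.rep hr) fun ω h7 h8 => Ends.store ⟨?_, ?_⟩
    · refine ((h7.rep (h6.rep hr)).setArr t ?_ (by simpa using h8))
      rw [h7.2 3 fun k hk => by omega]
      simpa [h2] using h4
    · have : LoopEq d σ ω := h6.loopEq.trans h7.loopEq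
      intro k hk
      simpa using this k hk
  | seq p q ihp ihq =>
    intro M d σ hr
    refine Ends.seq (Ends.mono (ihp M d σ hr) le_rfl fun τ h => ?_)
    exact Ends.mono (ihq _ d τ h.1) le_rfl fun υ h' => ⟨h'.1, h.2.trans h'.2⟩
  | ite e p q ihp ihq =>
    intro M d σ hr
    refine Ends.mono (Ends.seq (b := (if 0 < e.eval M then p.cost M else q.cost M) + 1)
      (e.compile_ends l M 0 σ _ hr fun τ h1 h2 => Ends.ite (fun hp => ?_) (fun hp => ?_)))
      (by simp only [cost]; omega) fun _ h => h
    all_goals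
      replace hp : _ := hp
      rw [show τ.reg 3 = e.eval M from h2] at hp
      simp only [denote]
    · simp only [if_pos hp]
      exact Ends.mono (ihp M d τ (h1.rep hr)) le_rfl fun υ h => ⟨h.1, h1.loopEq.trans h.2⟩
    · simp only [if_neg (not_lt.2 hp)]
      exact Ends.mono (ihq M d τ (h1.rep hr)) le_rfl fun υ h => ⟨h.1, h1.loopEq.trans h.2⟩
  | for_ v e c ih =>
    intro M d σ hr
    set K := (e.eval M).toNat with hK
    -- the machine loop, started when `K - i` runs are left
    have key : ∀ (j i : ℕ) (τ : State), i + j = K → Rep l τ (iter v c M i) →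
        (τ.reg (4 * d + 1)).toNat = j → τ.reg (4 * d + 2) = i →
        Ends (.loop (4 * d + 1) (.seq (.const 3 0) (.seq (.add (4 * l.var v) (4 * d + 2) 3)
          (.seq (c.compile l (d + 1)) (.seq (.const 3 1) (.seq (.add (4 * d + 2) (4 * d + 2) 3)
            (.sub (4 * d + 1) (4 * d + 1) 3))))))) τ
          (1 + ∑ k ∈ Finset.Ico i K, (c.cost ((iter v c M k).setVar v k) + 6))
          fun υ => Rep l υ (iter v c M K) ∧ LoopEq d τ υ := by
      intro j
      induction j with
      | zero =>
        intro i τ hi hrep hcnt hidx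
        obtain rfl : i = K := by omega
        exact ⟨1, τ, .loop_done _ _ _ (by omega), by simp, hrep, fun k _ => ⟨rfl, rfl⟩⟩
      | succ j ihj =>
        intro i τ hi hrep hcnt hidx
        have hlt : i < K := by omega
        have hbody : Ends (.seq (.const 3 0) (.seq (.add (4 * l.var v) (4 * d + 2) 3)
          (.seq (c.compile l (d + 1)) (.seq (.const 3 1) (.seq (.add (4 * d + 2) (4 * d + 2) 3)
            (.sub (4 * d + 1) (4 * d + 1) 3)))))) τ
            (c.cost ((iter v c M i).setVar v i) + 5) fun υ => Rep l υ (iter v c M (i + 1)) ∧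
              LoopEq d τ υ ∧ (υ.reg (4 * d + 1)).toNat = j ∧ υ.reg (4 * d + 2) = (i + 1 : ℕ) := by
          refine Ends.mono (Ends.seq (a := 1) (Ends.const (Ends.seq (a := 1) (Ends.add
            (Ends.seq (Ends.mono (ih ((iter v c M i).setVar v i) (d + 1) _
              ((hrep.setReg 3 0 (by norm_num)).setVar v ?_)) le_rfl fun υ hυ => Ends.seq (a := 1)
                (b := 2) (Ends.const (Ends.seq (a := 1) (b := 1) (Ends.add (Ends.sub ?_)))))))))) 
            (le_of_eq (by ring)) fun _ h => h
          · simp [hidx]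
          · obtain ⟨hυ1, hυ2⟩ := hυ
            have hL : ∀ k, k < d + 1 → υ.reg (4 * k + 1) = τ.reg (4 * k + 1) ∧
                υ.reg (4 * k + 2) = τ.reg (4 * k + 2) := by
              intro k hk
              have h1 : ¬ 4 * k + 1 = 4 * l.var v := by omega
              have h2 : ¬ 4 * k + 2 = 4 * l.var v := by omega
              have h3 : ¬ 4 * k + 2 = 3 := by omega
              have h4 : ¬ 4 * k + 1 = 3 := by omega
              have := hυ2 k hk
              simpa [h1, h2, h3, h4] using this
            have hd := hL d (by omega)
            have e1 : ¬ 4 * d + 1 = 3 := by omega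
            have e2 : ¬ 4 * d + 2 = 3 := by omega
            refine ⟨?_, fun k hk => ?_, ?_, ?_⟩
            · exact ((hυ1.setReg _ _ (by norm_num)).setReg _ _ (by omega)).setReg _ _ (by omega)
            · have h1 : ¬ 4 * k + 1 = 4 * d + 1 := by omega
              have h2 : ¬ 4 * k + 2 = 4 * d + 2 := by omega
              have h3 : ¬ 4 * k + 2 = 3 := by omega
              have h4 : ¬ 4 * k + 1 = 3 := by omega
              have h5 : ¬ 4 * k = 4 * d + 1 := by omega
              have h6 : ¬ 4 * k + 2 = 4 * d + 1 := by omega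
              have := hL k (by omega)
              have h7 : ¬ k = d := by omega
              simp [h3, h4, h5, h6, h7, this]
            · simp [e1, hd.1]
              omega
            · simp [hd.2, hidx, e2]
        obtain ⟨t, υ, h1, h2, h3, h4, h5, h6⟩ := hbody
        obtain ⟨u, ω, h7, h8, h9, h10⟩ := ihj (i + 1) υ (by omega) h3 h5 h6
        refine ⟨t + u + 1, ω, .loop_step _ _ _ _ _ _ _ (by omega) h1 h7, ?_, h9, h4.trans h10⟩
        rw [Finset.sum_eq_sum_Ico_succ_bot hlt]
        omega
    refine Ends.mono (Ends.seq (e.compile_ends l M 0 σ _ hr fun τ h1 h2 => Ends.seq (a := 1)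
      (Ends.const (Ends.seq (a := 1) (Ends.add (Ends.seq (a := 1) (Ends.const (Ends.mono
        (key K 0 _ (by simp) ?_ ?_ ?_) le_rfl ?_)))))))) ?_ fun _ h => h
    · exact (((h1.rep hr).setReg _ _ (by norm_num)).setReg _ _ (by omega)).setReg _ _ (by omega)
    · have h2' : τ.reg 3 = e.eval M := h2
      simp [h2', hK]
    · simp
    · rintro υ ⟨h3, h4⟩
      refine ⟨h3, LoopEq.trans ?_ h4⟩
      refine h1.loopEq.trans (((setReg_loopEq _ _ _ ?_).trans (setReg_loopEq _ _ _ ?_)).trans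
        (setReg_loopEq _ _ _ ?_)) <;>
      · intro k hk
        omega
    · simp only [cost, ← hK, Finset.range_eq_Ico]
      omega

end Loop

/-! ### Rules for reasoning about loop programs -/

namespace Loop

variable {V T : Type} [DecidableEq V] [DecidableEq T]

instance : Add (Expr V T) := ⟨Expr.add⟩

instance : Sub (Expr V T) := ⟨Expr.sub⟩

omit [DecidableEq V] [DecidableEq T] in
@[simp] lemma Expr.eval_add (a b : Expr V T) (M : Store V T) :
    (a + b).eval M = a.eval M + b.eval M := rfl

omit [DecidableEq V] [DecidableEq T] in
@[simp] lemma Expr.eval_sub (a b : Expr V T) (M : Store V T) :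
    (a - b).eval M = a.eval M - b.eval M := rfl

omit [DecidableEq V] [DecidableEq T] in
@[simp] lemma Expr.cost_add (a b : Expr V T) : (a + b).cost = a.cost + b.cost + 1 := rfl

omit [DecidableEq V] [DecidableEq T] in
@[simp] lemma Expr.cost_sub (a b : Expr V T) : (a - b).cost = a.cost + b.cost + 1 := rfl

lemma Cmd.denote_set (v : V) (e : Expr V T) (M : Store V T) :
    (Cmd.set v e).denote M = M.setVar v (e.eval M) := rfl

lemma Cmd.denote_seq (p q : Cmd V T) (M : Store V T) :
    (Cmd.seq p q).denote M = q.denote (p.denote M) := rfl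

lemma Cmd.denote_ite (e : Expr V T) (p q : Cmd V T) (M : Store V T) :
    (Cmd.ite e p q).denote M = if 0 < e.eval M then p.denote M else q.denote M := rfl

/-- `M'` agrees with `M` on everything that `c` does not write. -/
structure Frame (c : Cmd V T) (M M' : Store V T) : Prop where
  var : ∀ v, c.writesVar v = false → M'.var v = M.var v
  arr : ∀ t, c.writesArr t = false → M'.arr t = M.arr t

/-- The command leads from `M` to a store with property `Q`, at cost at most `N`. -/
def Spec (c : Cmd V T) (M : Store V T) (N : ℕ) (Q : Store V T → Prop) : Prop :=
  Q (c.denote M) ∧ c.cost M ≤ N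

lemma frame_denote (c : Cmd V T) (M : Store V T) : Frame c M (c.denote M) :=
  ⟨fun v h => c.var_denote M v h, fun t h => c.arr_denote M t h⟩

/-- The cost of a command without loops is bounded by a number that can be read off from it. -/
def Cmd.flatCost : Cmd V T → Option ℕ
  | set _ e => some (e.cost + 2)
  | put _ i e => some (i.cost + e.cost + 11)
  | seq p q => p.flatCost.bind fun a => q.flatCost.map fun b => a + b
  | ite e p q => p.flatCost.bind fun a => q.flatCost.map fun b => e.cost + 1 + max a b
  | for_ _ _ _ => none

lemma Cmd.cost_le_flatCost (c : Cmd V T) : ∀ (N : ℕ), c.flatCost = some N → ∀ M, c.cost M ≤ N := by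
  induction c with
  | set v e => intro N h M; simp [flatCost] at h; simp [cost, h]
  | put t i e => intro N h M; simp [flatCost] at h; simp [cost, h]
  | seq p q ihp ihq =>
    intro N h M
    simp only [flatCost, Option.bind_eq_some_iff, Option.map_eq_some_iff] at h
    obtain ⟨a, ha, b, hb, rfl⟩ := h
    exact add_le_add (ihp a ha _) (ihq b hb _)
  | ite e p q ihp ihq =>
    intro N h M
    simp only [flatCost, Option.bind_eq_some_iff, Option.map_eq_some_iff] at h
    obtain ⟨a, ha, b, hb, rfl⟩ := h
    have h1 := ihp a ha M
    have h2 := ihq b hb M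
    simp only [cost]
    split_ifs <;> omega
  | for_ v e c => intro N h; simp [flatCost] at h

namespace Spec

variable {c p q : Cmd V T} {M : Store V T} {N N' a b : ℕ} {Q Q' : Store V T → Prop}

lemma mono (h : Spec c M N Q) (hN : N ≤ N') (hQ : ∀ M', Frame c M M' → Q M' → Q' M') :
    Spec c M N' Q' :=
  ⟨hQ _ (frame_denote c M) h.1, h.2.trans hN⟩

/-- A command without loops is evaluated symbolically. -/
lemma flat (hN : (c.flatCost.elim false fun a => decide (a ≤ N)) = true) (h : Q (c.denote M)) :
    Spec c M N Q := by
  refine ⟨h, ?_⟩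
  cases ha : c.flatCost with
  | none => simp [ha] at hN
  | some a =>
    simp only [ha, Option.elim_some, decide_eq_true_eq] at hN
    exact (c.cost_le_flatCost a ha M).trans hN

lemma seq (hp : Spec p M a Q') (hq : ∀ M', Frame p M M' → Q' M' → Spec q M' b Q) :
    Spec (.seq p q) M (a + b) Q :=
  have h := hq _ (frame_denote p M) hp.1
  ⟨h.1, add_le_add hp.2 h.2⟩

lemma set_seq {v : V} {e : Expr V T} (hq : Spec q (M.setVar v (e.eval M)) b Q) :
    Spec (.seq (.set v e) q) M (e.cost + 2 + b) Q :=
  ⟨hq.1, Nat.add_le_add_left hq.2 _⟩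

lemma put_seq {t : T} {i e : Expr V T} (hq : Spec q (M.setArr t (i.eval M) (e.eval M)) b Q) :
    Spec (.seq (.put t i e) q) M (i.cost + e.cost + 11 + b) Q :=
  ⟨hq.1, Nat.add_le_add_left hq.2 _⟩

lemma ite {e : Expr V T} (hp : 0 < e.eval M → Spec p M N Q) (hq : e.eval M ≤ 0 → Spec q M N Q) :
    Spec (.ite e p q) M (e.cost + 1 + N) Q := by
  rcases lt_or_ge 0 (e.eval M) with h | h
  · have := hp h
    exact ⟨by rw [Cmd.denote, if_pos h]; exact this.1, by rw [Cmd.cost, if_pos h]; have := this.2; omega⟩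
  · have := hq h
    exact ⟨by rw [Cmd.denote, if_neg (not_lt.2 h)]; exact this.1,
      by rw [Cmd.cost, if_neg (not_lt.2 h)]; have := this.2; omega⟩

/-- The invariant rule for loops whose body has a cost that depends on the number of the run. -/
lemma for_sum {v : V} {e : Expr V T} (J : ℕ → Store V T → Prop) (k : ℕ) (f : ℕ → ℕ)
    (hk : e.eval M = k) (h0 : J 0 M)
    (hstep : ∀ i < k, ∀ M', Frame (.for_ v e c) M M' → J i M' →
      Spec c (M'.setVar v i) (f i) (J (i + 1))) :
    Spec (.for_ v e c) M (e.cost + 4 + ∑ i ∈ Finset.range k, (f i + 6)) (J k) := by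
  have hk' : (e.eval M).toNat = k := by omega
  have key : ∀ i, i ≤ k → J i (Cmd.iter v c M i) ∧ Frame (.for_ v e c) M (Cmd.iter v c M i) := by
    intro i
    induction i with
    | zero => exact fun _ => ⟨h0, ⟨fun _ _ => rfl, fun _ _ => rfl⟩⟩
    | succ i ih =>
      intro hi
      obtain ⟨h1, h2⟩ := ih (by omega)
      refine ⟨(hstep i (by omega) _ h2 h1).1, fun w hw => ?_, fun t ht => ?_⟩
      · have hw' := hw
        simp only [Cmd.writesVar, Bool.or_eq_false_iff, decide_eq_false_iff_not] at hw'
        rw [← h2.var w hw]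
        change (c.denote _).var w = _
        rw [c.var_denote _ w hw'.2, Store.var_setVar, if_neg hw'.1]
        rfl
      · rw [← h2.arr t ht]
        change (c.denote _).arr t = _
        rw [c.arr_denote _ t ht, Store.arr_setVar]
        rfl
  refine ⟨?_, ?_⟩
  · rw [Cmd.denote, hk']
    exact (key k le_rfl).1
  · rw [Cmd.cost, hk']
    refine Nat.add_le_add_left (Finset.sum_le_sum fun i hi => ?_) _
    have hi' := Finset.mem_range.1 hi
    have := (hstep i hi' _ (key i hi'.le).2 (key i hi'.le).1).2
    omega

lemma for_ {v : V} {e : Expr V T} (J : ℕ → Store V T → Prop) (k N : ℕ)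
    (hk : e.eval M = k) (h0 : J 0 M)
    (hstep : ∀ i < k, ∀ M', Frame (.for_ v e c) M M' → J i M' →
      Spec c (M'.setVar v i) N (J (i + 1))) :
    Spec (.for_ v e c) M (e.cost + 4 + k * (N + 6)) (J k) := by
  have := for_sum (v := v) J k (fun _ => N) hk h0 hstep
  simpa using this

end Spec

/-- The first entries of the array `f` are those of the list `L`. -/
def IsList (f : ℤ → ℤ) (L : List ℤ) : Prop := ∀ (i : ℕ) (h : i < L.length), f i = L[i]

lemma IsList.nil (f : ℤ → ℤ) : IsList f [] := fun i h => absurd h (by simp)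

lemma IsList.push {f : ℤ → ℤ} {L : List ℤ} (h : IsList f L) {k x : ℤ} (hk : k = L.length) :
    IsList (Function.update f k x) (L ++ [x]) := by
  intro i hi
  subst hk
  rw [List.length_append, List.length_singleton] at hi
  by_cases hi' : i = L.length
  · subst hi'; simp
  · have h2 : i < L.length := by omega
    rw [Function.update_of_ne (by exact_mod_cast hi'), List.getElem_append_left h2, h i h2]

end Loop

/-! ### The program -/

namespace Solver

open Loop

/-- The variables of the program. -/
inductive Var
  | ans | m | n | mn | len | D | K | R | B | pos | cpos | nc | top | bc | q | N | cells | save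
  | i | j | k | l | x | y | z | w | g | h | p | s | u | v | cnt
  deriving DecidableEq

/-- The arrays of the program; `io` holds the input and, at the end, the output. -/
inductive Arr
  | io | pow | tab | best | cols | box | frac | node | mark | val | ptr | lab | prv
  deriving DecidableEq

/-- The numbering of variables and arrays by their order of declaration. -/
def layout : Layout Var Arr where
  var := Var.ctorIdx
  var_inj := Function.LeftInverse.injective (g := Var.ofNat) Var.ofNat_ctorIdx
  arr := Arr.ctorIdx
  arr_inj := Function.LeftInverse.injective (g := Arr.ofNat) Arr.ofNat_ctorIdx
  arr_lt := fun t => by cases t <;> decide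

/-- A variable as an expression. -/
abbrev V (a : Var) : Expr Var Arr := .var a

/-- An integer constant as an expression. -/
abbrev L (k : ℤ) : Expr Var Arr := .lit k

/-- An array entry as an expression. -/
abbrev G (t : Arr) (i : Expr Var Arr) : Expr Var Arr := .get t i

local infixr:60 " ;; " => Cmd.seq

/-- The command without effect. -/
abbrev skip : Cmd Var Arr := .set .x (V .x)

/-- Read the dimensions and compute `m n` and the places of `b` and `c` in the input. -/
def readDims : Cmd Var Arr :=
  .set .m (G .io (L 0)) ;; .set .n (G .io (L 1)) ;; .set .mn (L 0) ;;
  .for_ .j (V .n) (.set .mn (V .mn + V .m)) ;;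
  .set .cpos (L 2 + V .mn + V .m)

/-- Replace `a` by the maximum of `1` and the absolute values of `len` consecutive input cells. -/
def maxAbs (a : Var) : Cmd Var Arr :=
  .set a (L 1) ;;
  .for_ .i (V .len)
    (.set .y (G .io (V .pos + V .i)) ;;
     .ite (V .y - V a) (.set a (V .y)) skip ;;
     .ite (L 0 - V .y - V a) (.set a (L 0 - V .y)) skip)

/-- Compute the bounds `D` and `K` for the entries of `A` and of `b`, the radius `R = 2 m D + 2`
of the neighbourhood of the segment, and the base `B` of the encoding. -/
def bounds : Cmd Var Arr :=
  .set .pos (L 2) ;; .set .len (V .mn) ;; maxAbs .D ;;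
  .set .pos (L 2 + V .mn) ;; .set .len (V .m) ;; maxAbs .K ;;
  .set .R (L 0) ;; .for_ .i (V .m) (.set .R (V .R + V .D)) ;;
  .set .R (V .R + V .R + L 2) ;;
  .set .B (V .K + V .R + V .D) ;; .set .B (V .B + V .B + L 1)

/-- Tabulate the powers `B ^ i` and the products `v B ^ i` for `|v| ≤ D`, the latter at place
`i B + v`. -/
def tables : Cmd Var Arr :=
  .set .g (L 1) ;; .set .p (L 0) ;;
  .for_ .i (V .m)
    (.put .pow (V .i) (V .g) ;; .set .w (L 0) ;;
     .for_ .k (V .D + L 1)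
       (.put .tab (V .p + V .k) (V .w) ;; .put .tab (V .p - V .k) (L 0 - V .w) ;;
        .set .w (V .w + V .g)) ;;
     .set .h (L 0) ;;
     .for_ .k (V .B) (.set .h (V .h + V .g)) ;;
     .set .g (V .h) ;; .set .p (V .p + V .B))

/-- Enter column `j` with code `s`: list the code if it is new, and keep the best column for it. -/
def enterColumn : Cmd Var Arr :=
  .ite (G .best (V .s))
    (.ite (G .io (V .cpos + V .j) - G .io (V .cpos + (G .best (V .s) - L 1)))
      (.put .best (V .s) (V .j + L 1)) skip)
    (.put .cols (V .nc) (V .s) ;; .set .nc (V .nc + L 1) ;; .put .best (V .s) (V .j + L 1))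

/-- List the distinct column codes, with a best column for each. -/
def columns : Cmd Var Arr :=
  .set .pos (L 2) ;; .set .nc (L 0) ;;
  .for_ .j (V .n)
    (.set .s (L 0) ;; .set .p (L 0) ;;
     .for_ .i (V .m)
       (.set .s (V .s + G .tab (V .p + G .io (V .pos))) ;; .set .p (V .p + V .B) ;;
        .set .pos (V .pos + L 1)) ;;
     enterColumn)

/-- List the codes of the lattice points of the cube of radius `R`, one dimension at a time. -/
def boxPoints : Cmd Var Arr :=
  .put .box (L 0) (L 0) ;; .set .top (L 1) ;;
  .for_ .i (V .m)
    (.set .h (G .pow (V .i)) ;; .set .cnt (V .top) ;;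
     .for_ .l (V .cnt)
       (.set .y (G .box (V .l)) ;; .set .z (V .y) ;;
        .for_ .k (V .R)
          (.set .y (V .y + V .h) ;; .set .z (V .z - V .h) ;;
           .put .box (V .top) (V .y) ;; .put .box (V .top + L 1) (V .z) ;;
           .set .top (V .top + L 2))))

/-- Enter the code `u` into the list of nodes unless it is marked already. -/
def enterNode : Cmd Var Arr :=
  .set .u (V .q + G .box (V .l)) ;;
  .ite (G .mark (V .u)) skip
    (.put .mark (V .u) (L 1) ;; .put .node (V .N) (V .u) ;; .set .N (V .N + L 1))

/-- Pass from `⌊k b / K⌋` to `⌊(k + 1) b / K⌋`, coordinate by coordinate. -/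
def advance : Cmd Var Arr :=
  .for_ .i (V .m)
    (.set .y (G .frac (V .i) + G .io (L 2 + V .mn + V .i)) ;;
     .ite (V .y - (V .K - L 1))
       (.set .y (V .y - V .K) ;; .set .q (V .q + G .pow (V .i)))
       (.ite (L 0 - V .y)
         (.set .y (V .y + V .K) ;; .set .q (V .q - G .pow (V .i))) skip) ;;
     .put .frac (V .i) (V .y))

/-- List the codes of the points in the cubes of radius `R` around the points `⌊k b / K⌋`. -/
def nodePoints : Cmd Var Arr :=
  .set .q (L 0) ;; .set .N (L 0) ;;
  .for_ .k (V .K + L 1) (.set .bc (V .q) ;; .for_ .l (V .top) enterNode ;; advance)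

/-- Record a walk to `v` of weight `w` that ends with an arc of code `s` out of `u`. -/
def record : Cmd Var Arr :=
  .set .cells (V .cells + L 1) ;; .put .lab (V .cells) (G .best (V .s)) ;;
  .put .prv (V .cells) (G .ptr (V .u)) ;; .put .ptr (V .v) (V .cells) ;; .put .val (V .v) (V .w)

/-- Relax the arc of code `cols l` out of `u`. -/
def relax : Cmd Var Arr :=
  .set .s (G .cols (V .l)) ;; .set .v (V .u + V .s) ;;
  .ite (G .ptr (V .u))
    (.ite (G .mark (V .v))
      (.set .w (G .val (V .u) + G .io (V .cpos + (G .best (V .s) - L 1))) ;;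
       .ite (G .ptr (V .v)) (.ite (V .w - G .val (V .v)) record skip) record)
      skip)
    skip

/-- One more round of the Bellman-Ford method than there are nodes. A recorded walk is a chain of
cells that hold the last arc and a pointer to the rest; cell `1` stands for the empty walk. -/
def bellmanFord : Cmd Var Arr :=
  .set .cells (L 1) ;; .put .ptr (L 0) (L 1) ;;
  .for_ .k (V .N + L 1)
    (.set .save (V .cells) ;;
     .for_ .i (V .N) (.set .u (G .node (V .i)) ;; .for_ .l (V .nc) relax))

/-- Write the solution that belongs to the recorded walk to `bc`. -/
def traceback : Cmd Var Arr :=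
  .for_ .j (V .n) (.put .io (V .j) (L 0)) ;; .set .p (G .ptr (V .bc)) ;;
  .for_ .k (V .cells)
    (.ite (V .p - L 1)
      (.set .y (G .lab (V .p) - L 1) ;; .put .io (V .y) (G .io (V .y) + L 1) ;;
       .set .p (G .prv (V .p)))
      skip) ;;
  .set .ans (L 1)

/-- The result is unboundedness if the last round found an improvement. -/
def report : Cmd Var Arr :=
  .ite (G .ptr (V .bc))
    (.ite (V .cells - V .save) (.set .ans (L 2)) traceback) (.set .ans (L 0))

/-- The whole program. -/
def solver : Cmd Var Arr :=
  readDims ;; bounds ;; tables ;; columns ;; boxPoints ;; nodePoints ;; bellmanFord ;; report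

end Solver

namespace Solver

open Loop StdIP

/-! ### Reading the input -/

/-- The array `f` holds the input word. -/
structure IsInput {m n : ℕ} (A : Matrix (Fin m) (Fin n) ℤ) (b : Fin m → ℤ) (c : Fin n → ℤ)
    (f : ℤ → ℤ) : Prop where
  rows : f 0 = m
  cols : f 1 = n
  matrix : ∀ (i : Fin m) (j : Fin n), f (2 + j * m + i) = A i j
  rhs : ∀ i : Fin m, f (2 + m * n + i) = b i
  cost : ∀ j : Fin n, f (2 + m * n + m + j) = c j

variable {m n : ℕ} {A : Matrix (Fin m) (Fin n) ℤ} {b : Fin m → ℤ} {c : Fin n → ℤ}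

lemma readDims_spec {M : Store Var Arr} (hI : IsInput A b c (M.arr .io)) :
    Spec readDims M (100 + n * 100) fun M' =>
      M'.var .m = m ∧ M'.var .n = n ∧ M'.var .mn = m * n ∧ M'.var .cpos = 2 + m * n + m := by
  refine Spec.mono (Spec.set_seq (Spec.set_seq (Spec.set_seq (Spec.seq
    (Spec.for_ (fun i M' => M'.var .mn = m * i) n 20 (by simp [hI.cols]) (by simp) ?_)
    (b := 20) (Q := fun M' => M'.var .m = m ∧ M'.var .n = n ∧ M'.var .mn = m * n ∧
      M'.var .cpos = 2 + m * n + m) ?_)))) ?_ fun M' _ h => h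
  · intro i hi M' hF h
    have h1 := hF.var .m rfl
    simp [hI.rows] at h1
    refine Spec.flat rfl ?_
    simp [Cmd.denote, h, h1]
    ring
  · intro M' hF h
    have h1 := hF.var .m rfl
    have h2 := hF.var .n rfl
    simp [hI.rows, hI.cols] at h1 h2
    refine Spec.flat rfl ?_
    simp [Cmd.denote, h, h1, h2]
  · simp
    omega

lemma maxAbs_spec (a : Var) (ha : a = .D ∨ a = .K) {M : Store Var Arr} {len : ℕ}
    (hlen : M.var .len = len) :
    Spec (maxAbs a) M (20 + len * 100) fun M' =>
      1 ≤ M'.var a ∧ (∀ i < len, |M.arr .io (M.var .pos + i)| ≤ M'.var a) ∧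
      ∀ x : ℤ, 1 ≤ x → (∀ i < len, |M.arr .io (M.var .pos + i)| ≤ x) → M'.var a ≤ x := by
  have hne : a ≠ .y ∧ a ≠ .i ∧ a ≠ .x ∧ a ≠ .pos ∧ a ≠ .len := by
    rcases ha with rfl | rfl <;> decide
  obtain ⟨hy, hi, hx, hpos, hl⟩ := hne
  refine Spec.mono (Spec.set_seq (Spec.for_ (fun k M' => 1 ≤ M'.var a ∧
      (∀ i < k, |M.arr .io (M.var .pos + i)| ≤ M'.var a) ∧
      ∀ x : ℤ, 1 ≤ x → (∀ i < len, |M.arr .io (M.var .pos + i)| ≤ x) → M'.var a ≤ x)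
      len 90 (by simp [hlen, hl.symm]) (by simpa using fun x hx _ => hx) ?_)) ?_ fun M' _ h => h
  · rintro k hk M' hF ⟨h1, h2, h3⟩
    have e1 : M'.var .pos = M.var .pos := by
      rw [hF.var .pos (by simp [Cmd.writesVar, hpos.symm])]
      simp [hpos.symm]
    have e2 : M'.arr .io = M.arr .io := hF.arr .io rfl
    refine Spec.flat rfl ?_
    set X := M.arr .io (M.var .pos + k) with hX
    suffices H : ((Cmd.seq (.set .y (G .io (V .pos + V .i))) (.seq
        (.ite (V .y - V a) (.set a (V .y)) skip)
        (.ite (L 0 - V .y - V a) (.set a (L 0 - V .y)) skip))).denote (M'.setVar .i k)).var a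
        = max (M'.var a) |X| by
      simp only [H]
      refine ⟨h1.trans (le_max_left _ _), fun i hik => ?_, fun x hx1 hx2 => ?_⟩
      · rcases Nat.lt_succ_iff_lt_or_eq.1 hik with h | rfl
        · exact (h2 i h).trans (le_max_left _ _)
        · exact le_max_right _ _
      · exact max_le (h3 x hx1 hx2) (hx2 k hk)
    have e3 : ∀ M'' : Store Var Arr, (Cmd.denote (.ite (L 0 - V .y - V a)
        (.set a (L 0 - V .y)) skip) M'').var a = max (M''.var a) (-M''.var .y) := by
      intro M''
      rw [Cmd.denote]
      split_ifs with h <;> simp [Cmd.denote, hx] at h ⊢ <;> omega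
    have e4 : ∀ M'' : Store Var Arr, (Cmd.denote (.ite (V .y - V a) (.set a (V .y)) skip) M'').var a
        = max (M''.var a) (M''.var .y) := by
      intro M''
      rw [Cmd.denote]
      split_ifs with h <;> simp [Cmd.denote, hx] at h ⊢ <;> omega
    have e5 : ∀ M'' : Store Var Arr,
        (Cmd.denote (.ite (V .y - V a) (.set a (V .y)) skip) M'').var .y = M''.var .y := by
      intro M''
      simp only [Cmd.denote]
      split_ifs <;> simp [hy.symm]
    rw [Cmd.denote_seq, Cmd.denote_seq, e3, e4, e5]
    simp [Cmd.denote, e1, e2, hy, hi, abs_eq_max_neg, max_assoc, hX]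
  · simp
    omega

lemma IsInput.exists_entry {f : ℤ → ℤ} (hI : IsInput A b c f) {t : ℕ} (ht : t < m * n) :
    ∃ i j, f (2 + t) = A i j := by
  have hm : 0 < m := Nat.pos_of_ne_zero fun h => by simp [h] at ht
  refine ⟨⟨t % m, Nat.mod_lt _ hm⟩, ⟨t / m, Nat.div_lt_of_lt_mul ht⟩, ?_⟩
  rw [← hI.matrix]
  congr 1
  have := Nat.div_add_mod t m
  zify at this
  push_cast
  linarith

lemma index_lt (i : Fin m) (j : Fin n) : (j : ℕ) * m + i < m * n := by
  have h1 := i.2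
  have h2 : ((j : ℕ) + 1) * m ≤ n * m := Nat.mul_le_mul_right _ j.2
  nlinarith

/-- What `bounds` computes: `D` and `K` bound the entries of `A` and of `b`, `K` is positive, and both
are no larger than needed for this. -/
structure IsBounds (A : Matrix (Fin m) (Fin n) ℤ) (b : Fin m → ℤ) (D K : ℕ) : Prop where
  one_le_K : 1 ≤ K
  abs_matrix : ∀ i j, |A i j| ≤ D
  abs_rhs : ∀ i, |b i| ≤ K
  D_le : ∀ Δ : ℕ, 1 ≤ Δ → (∀ i j, (A i j).natAbs ≤ Δ) → D ≤ Δ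
  K_le : K ≤ max 1 (normSup b)

/-- The radius of the cubes around the segment from `0` to `b`. -/
def radius (m D : ℕ) : ℕ := 2 * (m * D) + 2

/-- The base of the encoding of vectors by integers. -/
def base (m D K : ℕ) : ℕ := 2 * (K + radius m D + D) + 1

lemma bounds_spec {M : Store Var Arr} (hI : IsInput A b c (M.arr .io)) (hm : M.var .m = m)
    (hmn : M.var .mn = m * n) :
    Spec bounds M (200 + m * n * 100 + m * 200) fun M' => ∃ D K : ℕ, IsBounds A b D K ∧
      M'.var .D = D ∧ M'.var .K = K ∧ M'.var .R = radius m D ∧ M'.var .B = base m D K := by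
  refine Spec.mono (Spec.set_seq (Spec.set_seq (Spec.seq (maxAbs_spec .D (.inl rfl) (len := m * n)
    (by simp [hmn])) (b := 150 + m * 200) ?_))) ?_ fun M' _ h => h
  · rintro M1 hF1 ⟨hD1, hD2, hD3⟩
    have m1 := hF1.var .m rfl
    have mn1 := hF1.var .mn rfl
    have io1 := hF1.arr .io rfl
    simp [hm] at m1
    simp [hmn] at mn1
    simp at io1 hD2 hD3
    refine Spec.mono (Spec.set_seq (Spec.set_seq (Spec.seq (maxAbs_spec .K (.inr rfl) (len := m)
      (by simp [m1])) (b := 100 + m * 100) ?_))) ?_ fun M' _ h => h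
    · rintro M2 hF2 ⟨hK1, hK2, hK3⟩
      have m2 := hF2.var .m rfl
      have D2 := hF2.var .D rfl
      simp [m1] at m2
      simp at D2
      simp [mn1, io1] at hK2 hK3
      refine Spec.mono (Spec.set_seq (Spec.seq
        (Spec.for_ (fun i M' => M'.var .R = i * M1.var .D) m 20 (by simp [m2]) (by simp) ?_)
        (b := 60) ?_)) ?_ fun M' _ h => h
      · intro i hi M' hF h
        have D' := hF.var .D rfl
        refine Spec.flat rfl ?_
        simp [Cmd.denote, h, D', D2]
        ring
      · intro M3 hF3 h
        have D3 := hF3.var .D rfl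
        have K3 := hF3.var .K rfl
        simp [D2] at D3
        simp at K3
        refine Spec.flat rfl ?_
        have hDn : ((M1.var .D).toNat : ℤ) = M1.var .D := by omega
        have hKn : ((M2.var .K).toNat : ℤ) = M2.var .K := by omega
        refine ⟨(M1.var .D).toNat, (M2.var .K).toNat, ⟨by omega, ?_, ?_, ?_, ?_⟩, ?_⟩
        · intro i j
          rw [hDn, ← hI.matrix]
          have := hD2 (j * m + i) (index_lt i j)
          push_cast at this
          rwa [add_assoc]
        · intro i
          rw [hKn, ← hI.rhs]
          exact hK2 i i.2
        · intro Δ hΔ hA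
          have := hD3 Δ (by exact_mod_cast hΔ) fun t ht => by
            obtain ⟨i, j, hij⟩ := hI.exists_entry ht
            rw [hij, Int.abs_eq_natAbs]
            exact_mod_cast hA i j
          omega
        · have := hK3 (max 1 (normSup b) : ℕ) (by exact_mod_cast le_max_left _ _) fun i hi => by
            rw [hI.rhs ⟨i, hi⟩, Int.abs_eq_natAbs]
            exact_mod_cast (Finset.le_sup (f := fun i => (b i).natAbs)
              (Finset.mem_univ (⟨i, hi⟩ : Fin m))).trans (le_max_right _ _)
          omega
        · simp [Cmd.denote, h, D3, K3, radius, base, hDn, hKn]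
          constructor <;> ring
      · simp
        omega
    · simp
      omega
  · simp
    omega

/-! ### The encoding of vectors by integers -/

/-- The code of an integer vector in base `B`. -/
def enc {m : ℕ} (B : ℤ) (x : Fin m → ℤ) : ℤ := ∑ i : Fin m, x i * B ^ (i : ℕ)

lemma enc_add (B : ℤ) (x y : Fin m → ℤ) : enc B (x + y) = enc B x + enc B y := by
  simp [enc, add_mul, Finset.sum_add_distrib]

@[simp] lemma enc_zero (B : ℤ) : enc B (0 : Fin m → ℤ) = 0 := by simp [enc]

/-- The code determines the residue of the first coordinate modulo the base, hence that coordinate,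
and so on. -/
lemma enc_eq_zero {B : ℤ} : ∀ {m : ℕ} (x : Fin m → ℤ), (∀ i, |x i| < B) → enc B x = 0 → x = 0
  | 0, x, _, _ => Subsingleton.elim _ _
  | m + 1, x, hx, h => by
    have hB : 0 < B := (abs_nonneg _).trans_lt (hx 0)
    have e : enc B x = x 0 + B * enc B (fun i : Fin m => x i.succ) := by
      simp only [enc, Fin.sum_univ_succ, Finset.mul_sum]
      simp only [Fin.val_zero, pow_zero, mul_one, Fin.val_succ, pow_succ]
      congr 1
      exact Finset.sum_congr rfl fun i _ => by ring
    rw [e] at h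
    have h0 : x 0 = 0 :=
      Int.eq_zero_of_abs_lt_dvd ⟨-enc B (fun i : Fin m => x i.succ), by linarith⟩ (hx 0)
    rw [h0, zero_add, mul_eq_zero] at h
    have h1 := enc_eq_zero (fun i : Fin m => x i.succ) (fun i => hx _) (h.resolve_left hB.ne')
    ext i
    refine Fin.cases h0 (fun i => ?_) i
    exact congrFun h1 i

lemma enc_inj {B : ℤ} {x y : Fin m → ℤ} (h : ∀ i, |x i - y i| < B) (he : enc B x = enc B y) :
    x = y := by
  have h1 : enc B (x - y) = 0 := by
    have := enc_add B (x - y) y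
    rw [sub_add_cancel] at this
    linarith
  exact sub_eq_zero.1 (enc_eq_zero (x - y) h h1)

/-! ### Tables and column codes -/

lemma tables_spec {M : Store Var Arr} {D B : ℕ} (hm : M.var .m = m) (hD : M.var .D = D)
    (hB : M.var .B = B) (hDB : 2 * D < B) :
    Spec tables M (100 + m * (500 + D * 100 + B * 20)) fun M' =>
      (∀ i < m, M'.arr .pow i = (B : ℤ) ^ i) ∧
      ∀ i < m, ∀ v : ℤ, |v| ≤ D → M'.arr .tab (i * B + v) = v * (B : ℤ) ^ i := by
  refine Spec.mono (Spec.set_seq (Spec.set_seq (Spec.for_ (fun k M' =>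
      M'.var .g = (B : ℤ) ^ k ∧ M'.var .p = k * B ∧
      (∀ i < k, M'.arr .pow i = (B : ℤ) ^ i) ∧
      ∀ i < k, ∀ v : ℤ, |v| ≤ D → M'.arr .tab (i * B + v) = v * (B : ℤ) ^ i) m
      (460 + D * 100 + B * 20) (by simp [hm]) (by simp) ?_))) ?_
      fun M' _ h => h.2.2
  · rintro k hk M1 hF1 ⟨hg, hp, hpow, htab⟩
    have D1 := hF1.var .D rfl
    have B1 := hF1.var .B rfl
    simp [hD] at D1
    simp [hB] at B1
    refine Spec.mono (Spec.put_seq (Spec.set_seq (Spec.seq (Spec.for_ (fun a M' =>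
      M'.var .w = a * (B : ℤ) ^ k ∧
      (∀ i < k, ∀ v : ℤ, |v| ≤ D → M'.arr .tab (i * B + v) = v * (B : ℤ) ^ i) ∧
      ∀ v : ℤ, |v| < a → M'.arr .tab (k * B + v) = v * (B : ℤ) ^ k) (D + 1) 70
      (by simp [D1]) ?_ ?_) (b := 220 + B * 20) ?_))) ?_ fun M' _ h => h
    · refine ⟨by simp, by simpa using htab, fun v hv => ?_⟩
      have := abs_nonneg v
      push_cast at hv
      omega
    · rintro a ha M2 hF2 ⟨hw, h1, h2⟩
      have g2 := hF2.var .g rfl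
      have p2 := hF2.var .p rfl
      simp [hg] at g2
      simp [hp] at p2
      refine Spec.flat rfl ?_
      simp only [Cmd.denote, Expr.eval, Expr.eval_sub, Store.var_setVar,
        Store.arr_setVar, Store.arr_setArr, Store.var_setArr, reduceCtorEq, if_true, if_false,
        g2, p2, hw]
      have ha' : (a : ℤ) ≤ D := by omega
      refine ⟨by push_cast; ring, fun i hi v hv => ?_, fun v hv => ?_⟩
      · -- earlier rows of the table lie in disjoint windows
        have hik : (i + 1 : ℤ) * B ≤ k * B :=
          mul_le_mul_of_nonneg_right (by exact_mod_cast hi) (by positivity)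
        have hv' := abs_le.1 hv
        have hDB' : (2 * D : ℤ) < B := by exact_mod_cast hDB
        rw [add_mul, one_mul] at hik
        rw [Function.update_of_ne (by omega), Function.update_of_ne (by omega)]
        exact h1 i hi v hv
      · by_cases hva : |v| < a
        · have hv' := abs_lt.1 hva
          rw [Function.update_of_ne (by omega), Function.update_of_ne (by omega)]
          exact h2 v hva
        · have hva' : |v| = a := by push_cast at hv; omega
          rcases (abs_eq (by positivity)).1 hva' with rfl | rfl
          · by_cases h0 : (a : ℤ) = 0
            · rw [h0]; simp
            · rw [Function.update_of_ne (by omega), Function.update_self]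
          · rw [← sub_eq_add_neg, Function.update_self]
            ring
    · rintro M2 hF2 ⟨-, h1, h2⟩
      have g2 := hF2.var .g rfl
      have p2 := hF2.var .p rfl
      have B2 := hF2.var .B rfl
      have pow2 := hF2.arr .pow rfl
      simp [hg] at g2
      simp [hp] at p2
      simp [B1] at B2
      simp at pow2
      refine Spec.mono (Spec.set_seq (Spec.seq (Spec.for_ (fun a M' =>
        M'.var .h = a * (B : ℤ) ^ k) B 14 (by simp [B2]) (by simp) ?_) (b := 100) ?_)) ?_
        fun M' _ h => h
      · intro a ha M3 hF3 h
        have g3 := hF3.var .g rfl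
        simp [g2] at g3
        refine Spec.flat rfl ?_
        simp [Cmd.denote, h, g3]
        ring
      · intro M3 hF3 h
        have p3 := hF3.var .p rfl
        have B3 := hF3.var .B rfl
        have pow3 := hF3.arr .pow rfl
        have tab3 := hF3.arr .tab rfl
        simp [p2] at p3
        simp [B2] at B3
        simp [pow2] at pow3
        simp at tab3
        refine Spec.flat rfl ?_
        simp only [Cmd.denote, Expr.eval, Store.var_setVar, Store.arr_setVar,
          reduceCtorEq, if_true, if_false, h, p3, B3, pow3, tab3]
        refine ⟨by ring, by push_cast; ring, fun i hi => ?_, fun i hi v hv => ?_⟩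
        · rcases Nat.lt_succ_iff_lt_or_eq.1 hi with hi' | rfl
          · rw [Function.update_of_ne (by exact_mod_cast hi'.ne), hpow i hi']
          · rw [Function.update_self, hg]
        · rcases Nat.lt_succ_iff_lt_or_eq.1 hi with hi' | rfl
          · exact h1 i hi' v hv
          · exact h2 v (by push_cast; omega)
      · simp
        omega
    · simp
      ring_nf
      omega
  · simp
    ring_nf
    omega

end Solver

namespace Solver

open Loop StdIP

variable {m n : ℕ} {A : Matrix (Fin m) (Fin n) ℤ} {b : Fin m → ℤ} {c : Fin n → ℤ}

/-- The arrays `cols` and `best` describe the first `k` columns: `L` lists the codes that occur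
among them, and `best` names for each of these codes a column of largest cost, counted from `1`. -/
structure IsColumns (code : Fin n → ℤ) (c : Fin n → ℤ) (k : ℕ) (cols best : ℤ → ℤ)
    (L : List ℤ) : Prop where
  isList : IsList cols L
  nodup : L.Nodup
  mem : ∀ j : Fin n, j < k → code j ∈ L
  exists_best : ∀ s ∈ L, ∃ j : Fin n, best s = j + 1 ∧ code j = s ∧
    ∀ j' : Fin n, j' < k → code j' = s → c j' ≤ c j
  best_eq_zero : ∀ s, s ∉ L → best s = 0

lemma enterColumn_spec {M : Store Var Arr} {code : Fin n → ℤ} (k : Fin n) {L : List ℤ}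
    (hI : IsInput A b c (M.arr .io)) (hcpos : M.var .cpos = 2 + m * n + m)
    (hj : M.var .j = k) (hs : M.var .s = code k) (hnc : M.var .nc = L.length)
    (hL : IsColumns code c k (M.arr .cols) (M.arr .best) L) :
    Spec enterColumn M 200 fun M' => ∃ L', M'.var .nc = L'.length ∧
      IsColumns code c (k + 1) (M'.arr .cols) (M'.arr .best) L' := by
  have hlt : ∀ {j' : Fin n}, (j' : ℕ) < k + 1 → (j' : ℕ) < k ∨ j' = k := by
    intro j' h
    rcases Nat.lt_succ_iff_lt_or_eq.1 h with h | h
    exacts [.inl h, .inr (Fin.ext h)]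
  refine Spec.mono (Spec.ite (N := 180) (fun hp => ?_) (fun hp => ?_)) (by decide)
    fun M' _ h => h
  · -- the code occurred before
    simp only [Expr.eval, hs] at hp
    have hmem : code k ∈ L := by
      by_contra h
      rw [hL.best_eq_zero _ h] at hp
      exact lt_irrefl _ hp
    obtain ⟨j, hbj, hj1, hj2⟩ := hL.exists_best _ hmem
    refine Spec.mono (Spec.ite (N := 100) (fun hq => ?_) (fun hq => ?_)) (by decide)
      fun M' _ h => h
    · simp only [Expr.eval, Expr.eval_sub, hs, hj, hcpos, hbj, add_sub_cancel_right,
        hI.cost] at hq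
      refine Spec.flat rfl ⟨L, ?_, ?_⟩
      · simpa [Cmd.denote] using hnc
      · simp only [Cmd.denote, Store.arr_setArr, reduceCtorEq, if_false, if_true, Expr.eval,
          hs, hj]
        refine ⟨hL.isList, hL.nodup, fun j' hj' => ?_, fun s hsL => ?_, fun s hsL => ?_⟩
        · rcases hlt hj' with h | rfl
          exacts [hL.mem _ h, hmem]
        · by_cases hsk : s = code k
          · subst hsk
            refine ⟨k, by simp, rfl, fun j' hj' hj'2 => ?_⟩
            rcases hlt hj' with h | rfl
            exacts [(hj2 j' h hj'2).trans (by linarith), le_rfl]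
          · obtain ⟨i, h1, h2, h3⟩ := hL.exists_best s hsL
            refine ⟨i, by rw [Function.update_of_ne hsk, h1], h2, fun j' hj' hj'2 => ?_⟩
            rcases hlt hj' with h | rfl
            exacts [h3 j' h hj'2, absurd hj'2.symm hsk]
        · rw [Function.update_of_ne (by rintro rfl; exact hsL hmem), hL.best_eq_zero s hsL]
    · simp only [Expr.eval, Expr.eval_sub, hs, hj, hcpos, hbj, add_sub_cancel_right,
        hI.cost] at hq
      refine Spec.flat rfl ⟨L, ?_, ?_⟩
      · simpa [Cmd.denote] using hnc
      · simp only [Cmd.denote, Store.arr_setVar]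
        refine ⟨hL.isList, hL.nodup, fun j' hj' => ?_, fun s hsL => ?_, hL.best_eq_zero⟩
        · rcases hlt hj' with h | rfl
          exacts [hL.mem _ h, hmem]
        · by_cases hsk : s = code k
          · subst hsk
            refine ⟨j, hbj, hj1, fun j' hj' hj'2 => ?_⟩
            rcases hlt hj' with h | rfl
            exacts [hj2 j' h hj'2, by linarith]
          · obtain ⟨i, h1, h2, h3⟩ := hL.exists_best s hsL
            refine ⟨i, h1, h2, fun j' hj' hj'2 => ?_⟩
            rcases hlt hj' with h | rfl
            exacts [h3 j' h hj'2, absurd hj'2.symm hsk]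
  · simp only [Expr.eval, hs] at hp
    have hnmem : code k ∉ L := by
      intro h
      obtain ⟨j, hbj, _⟩ := hL.exists_best _ h
      rw [hbj] at hp
      omega
    refine Spec.flat rfl ⟨L ++ [code k], ?_, ?_⟩
    · simp [Cmd.denote, hnc]
    · simp only [Cmd.denote, Store.arr_setArr, Store.arr_setVar, Store.var_setArr, Store.var_setVar,
        reduceCtorEq, if_false, if_true, Expr.eval, hs, hj]
      refine ⟨hL.isList.push hnc, ?_, fun j' hj' => ?_, fun s hsL => ?_, fun s hsL => ?_⟩
      · rw [List.nodup_append]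
        refine ⟨hL.nodup, List.nodup_singleton _, fun a ha b hb => ?_⟩
        rw [List.mem_singleton.1 hb]
        exact fun h => hnmem (h ▸ ha)
      · rcases hlt hj' with h | rfl
        exacts [List.mem_append_left _ (hL.mem _ h), by simp]
      · by_cases hsk : s = code k
        · subst hsk
          refine ⟨k, by simp, rfl, fun j' hj' hj'2 => ?_⟩
          rcases hlt hj' with h | rfl
          exacts [absurd (hj'2 ▸ hL.mem _ h) hnmem, le_rfl]
        · have hsL' : s ∈ L := by simpa [hsk] using hsL
          obtain ⟨i, h1, h2, h3⟩ := hL.exists_best s hsL'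
          refine ⟨i, by rw [Function.update_of_ne hsk, h1], h2, fun j' hj' hj'2 => ?_⟩
          rcases hlt hj' with h | rfl
          exacts [h3 j' h hj'2, absurd hj'2.symm hsk]
      · have hsL' : s ∉ L ∧ s ≠ code k := by simpa using hsL
        rw [Function.update_of_ne hsL'.2, hL.best_eq_zero s hsL'.1]

lemma columns_spec {M : Store Var Arr} {D B : ℕ} (hI : IsInput A b c (M.arr .io))
    (hm : M.var .m = m) (hn : M.var .n = n) (hcpos : M.var .cpos = 2 + m * n + m)
    (hB : M.var .B = B) (hA : ∀ i j, |A i j| ≤ D)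
    (htab : ∀ i < m, ∀ v : ℤ, |v| ≤ D → M.arr .tab (i * B + v) = v * (B : ℤ) ^ i)
    (hbest : M.arr .best = fun _ => 0) :
    Spec columns M (100 + n * (400 + m * 100)) fun M' => ∃ Lc, M'.var .nc = Lc.length ∧
      IsColumns (fun j => enc B fun i => A i j) c n (M'.arr .cols) (M'.arr .best) Lc := by
  set code : Fin n → ℤ := fun j => enc B fun i => A i j with hcode
  refine Spec.mono (Spec.set_seq (Spec.set_seq (Spec.for_ (fun k M' => M'.var .pos = 2 + k * m ∧
    ∃ Lc, M'.var .nc = Lc.length ∧ IsColumns code c k (M'.arr .cols) (M'.arr .best) Lc) n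
      (350 + m * 100) (by simp [hn]) ?_ ?_))) ?_ fun M' _ h => h.2
  · refine ⟨by simp, [], by simp, IsList.nil _, List.nodup_nil, by simp, by simp, ?_⟩
    simp [hbest]
  · rintro k hk M1 hF1 ⟨hpos, Lc, hnc, hLc⟩
    have m1 := hF1.var .m rfl
    have B1 := hF1.var .B rfl
    have io1 := hF1.arr .io rfl
    have tab1 := hF1.arr .tab rfl
    have cpos1 := hF1.var .cpos rfl
    simp [hm] at m1
    simp [hB] at B1
    simp [hcpos] at cpos1
    simp at io1 tab1
    refine Spec.mono (Spec.set_seq (Spec.set_seq (Spec.seq (Spec.for_ (fun a M' =>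
      M'.var .pos = 2 + k * m + a ∧ M'.var .p = a * B ∧
      M'.var .s = ∑ i : Fin m, if (i : ℕ) < a then A i ⟨k, hk⟩ * (B : ℤ) ^ (i : ℕ) else 0) m 80
      (by simp [m1]) ?_ ?_) (b := 200) ?_))) ?_ fun M' _ h => h
    · simp [hpos]
    · rintro a ha M2 hF2 ⟨h1, h2, h3⟩
      have B2 := hF2.var .B rfl
      have io2 := hF2.arr .io rfl
      have tab2 := hF2.arr .tab rfl
      simp [B1] at B2
      simp [io1] at io2
      simp [tab1] at tab2
      have hval : M.arr .tab (a * B + A ⟨a, ha⟩ ⟨k, hk⟩) = A ⟨a, ha⟩ ⟨k, hk⟩ * (B : ℤ) ^ a :=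
        htab a ha _ (hA _ _)
      have hio : M.arr .io (2 + k * m + a) = A ⟨a, ha⟩ ⟨k, hk⟩ := hI.matrix ⟨a, ha⟩ ⟨k, hk⟩
      refine Spec.flat rfl ?_
      simp only [Cmd.denote, Expr.eval, Store.var_setVar, Store.arr_setVar,
        reduceCtorEq, if_true, if_false, B2, io2, tab2, h1, h2, h3, hio, hval]
      refine ⟨by push_cast; ring, by push_cast; ring, ?_⟩
      have hsplit : ∀ i : Fin m, (if (i : ℕ) < a + 1 then A i ⟨k, hk⟩ * (B : ℤ) ^ (i : ℕ) else 0)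
          = (if (i : ℕ) < a then A i ⟨k, hk⟩ * (B : ℤ) ^ (i : ℕ) else 0)
            + if i = ⟨a, ha⟩ then A i ⟨k, hk⟩ * (B : ℤ) ^ (i : ℕ) else 0 := by
        intro i
        have : i = ⟨a, ha⟩ ↔ (i : ℕ) = a := Fin.ext_iff
        simp only [this]
        split_ifs <;> omega
      rw [Finset.sum_congr rfl fun i _ => hsplit i, Finset.sum_add_distrib, Finset.sum_ite_eq',
        if_pos (Finset.mem_univ _)]
    · rintro M2 hF2 ⟨h1, h2, h3⟩
      have io2 := hF2.arr .io rfl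
      have cpos2 := hF2.var .cpos rfl
      have j2 := hF2.var .j rfl
      have nc2 := hF2.var .nc rfl
      have cols2 := hF2.arr .cols rfl
      have best2 := hF2.arr .best rfl
      simp [io1] at io2
      simp [cpos1] at cpos2
      simp at j2 cols2 best2
      simp [hnc] at nc2
      refine Spec.mono (enterColumn_spec (A := A) (b := b) (c := c) (code := code) ⟨k, hk⟩ (L := Lc)
        (by rwa [io2]) cpos2 j2 ?_ nc2 (by rwa [cols2, best2])) le_rfl ?_
      · rw [h3, hcode]
        simp [enc]
      · rintro M3 hF3 ⟨L', h4, h5⟩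
        refine ⟨?_, L', h4, h5⟩
        rw [hF3.var .pos rfl, h1]
        push_cast
        ring
    · simp
      omega
  · simp
    ring_nf
    omega

end Solver

namespace Solver

open Loop StdIP

variable {m n : ℕ} {A : Matrix (Fin m) (Fin n) ℤ} {b : Fin m → ℤ} {c : Fin n → ℤ}

/-! ### The points near the segment -/

lemma enc_update (B : ℤ) (x : Fin m → ℤ) (i : Fin m) (v : ℤ) :
    enc B (Function.update x i v) = enc B x + (v - x i) * B ^ (i : ℕ) := by
  have : Function.update x i v = x + Pi.single i (v - x i) := by
    ext j
    by_cases h : j = i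
    · subst h; simp
    · simp [h]
  rw [this, enc_add]
  congr 1
  simp only [enc]
  rw [Finset.sum_eq_single i]
  · simp
  · intro j _ hj
    simp [hj]
  · simp

lemma boxPoints_spec {M : Store Var Arr} {R B : ℕ} (hm : M.var .m = m) (hR : M.var .R = R)
    (hpow : ∀ i < m, M.arr .pow i = (B : ℤ) ^ i) :
    Spec boxPoints M (100 + m * (100 + (2 * R + 1) ^ m * 200)) fun M' =>
      ∃ Lb : List ℤ, IsList (M'.arr .box) Lb ∧ M'.var .top = Lb.length ∧
        Lb.length = (2 * R + 1) ^ m ∧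
        ∀ x, x ∈ Lb ↔ ∃ z : Fin m → ℤ, (∀ i, |z i| ≤ R) ∧ x = enc B z := by
  refine Spec.mono (Spec.put_seq (Spec.set_seq (Spec.for_ (fun k M' =>
      ∃ Lb : List ℤ, IsList (M'.arr .box) Lb ∧ M'.var .top = Lb.length ∧
        Lb.length = (2 * R + 1) ^ k ∧
        ∀ x, x ∈ Lb ↔ ∃ z : Fin m → ℤ, (∀ i, |z i| ≤ R) ∧ (∀ i : Fin m, k ≤ i → z i = 0) ∧
          x = enc B z) m (60 + (2 * R + 1) ^ m * 200) (by simp [hm]) ?_ ?_))) ?_ ?_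
  · refine ⟨[0], ?_, by simp, by simp, fun x => ?_⟩
    · intro i hi
      have : i = 0 := by simpa using hi
      subst this
      simp
    · simp only [List.mem_singleton]
      constructor
      · rintro rfl
        exact ⟨0, by simp, by simp, by simp⟩
      · rintro ⟨z, _, hz, rfl⟩
        have : z = 0 := by ext i; exact hz i (Nat.zero_le _)
        simp [this]
  · rintro k hk M1 hF1 ⟨L0, hL0, htop, hlen, hmem⟩
    have R1 := hF1.var .R rfl
    have pow1 := hF1.arr .pow rfl
    simp [hR] at R1
    simp at pow1
    have hh : M.arr .pow k = (B : ℤ) ^ k := hpow k hk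
    refine Spec.mono (Spec.set_seq (Spec.set_seq (Spec.for_ (fun l M' => ∃ E : List ℤ,
      IsList (M'.arr .box) (L0 ++ E) ∧ M'.var .top = (L0 ++ E).length ∧ E.length = l * (2 * R) ∧
      ∀ x, x ∈ E ↔ ∃ (a : ℕ) (ha : a < L0.length), a < l ∧ ∃ t : ℤ, t ≠ 0 ∧ |t| ≤ R ∧
        x = L0[a] + t * (B : ℤ) ^ k) L0.length (50 + R * 100) (by simp [htop]) ?_ ?_))) ?_ ?_
    · exact ⟨[], by simpa using hL0, by simp [htop], by simp, by simp⟩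
    · rintro l hl M2 hF2 ⟨E, hE, htop2, hElen, hEmem⟩
      have R2 := hF2.var .R rfl
      have h2 := hF2.var .h rfl
      simp [R1] at R2
      simp [pow1, hh] at h2
      have hbox : M2.arr .box l = L0[l] := by
        rw [hE l (by simp; omega), List.getElem_append_left hl]
      refine Spec.mono (Spec.set_seq (Spec.set_seq (Spec.for_ (fun v M' => ∃ F : List ℤ,
        IsList (M'.arr .box) (L0 ++ (E ++ F)) ∧ M'.var .top = (L0 ++ (E ++ F)).length ∧
        F.length = v * 2 ∧ M'.var .y = L0[l] + v * (B : ℤ) ^ k ∧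
        M'.var .z = L0[l] - v * (B : ℤ) ^ k ∧
        ∀ x, x ∈ F ↔ ∃ t : ℤ, t ≠ 0 ∧ |t| ≤ v ∧ x = L0[l] + t * (B : ℤ) ^ k) R 80
        (by simp [R2]) ?_ ?_))) ?_ ?_
      · refine ⟨[], by simpa using hE, by simp [htop2], by simp, by simp [hbox], by simp [hbox],
          fun x => ?_⟩
        simp only [List.not_mem_nil, false_iff]
        rintro ⟨t, h1, h2, _⟩
        exact h1 (abs_eq_zero.1 (le_antisymm (by simpa using h2) (abs_nonneg t)))
      · rintro v hv M3 hF3 ⟨F, hF, htop3, hFlen, hy, hz, hFmem⟩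
        have h3 := hF3.var .h rfl
        simp [h2] at h3
        refine Spec.flat rfl ⟨F ++ [L0[l] + (v + 1) * (B : ℤ) ^ k, L0[l] - (v + 1) * (B : ℤ) ^ k],
          ?_⟩
        have e1 : L0[l] + v * (B : ℤ) ^ k + (B : ℤ) ^ k = L0[l] + (v + 1) * (B : ℤ) ^ k := by ring
        have e2 : L0[l] - v * (B : ℤ) ^ k - (B : ℤ) ^ k = L0[l] - (v + 1) * (B : ℤ) ^ k := by ring
        simp only [Cmd.denote, Expr.eval, Expr.eval_sub, Store.var_setVar,
          Store.arr_setVar, Store.arr_setArr, Store.var_setArr, reduceCtorEq, if_true, if_false,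
          h3, hy, hz, e1, e2]
        refine ⟨?_, ?_, ?_, ?_, ?_, fun x => ?_⟩
        · have p1 := hF.push (x := L0[l] + (v + 1) * (B : ℤ) ^ k) htop3
          have p2 := p1.push (k := M3.var .top + 1) (x := L0[l] - (v + 1) * (B : ℤ) ^ k)
            (by rw [htop3]; simp [add_assoc])
          simpa [List.append_assoc] using p2
        · rw [htop3]
          simp
          ring
        · simp [hFlen]
          ring
        · push_cast
          ring
        · push_cast
          ring
        · rw [List.mem_append, hFmem]
          simp only [List.mem_cons, List.not_mem_nil, or_false]
          constructor
          · rintro (⟨t, h1, h2, rfl⟩ | rfl | rfl)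
            · exact ⟨t, h1, by push_cast; omega, rfl⟩
            · exact ⟨v + 1, by omega, by push_cast; rw [abs_of_nonneg (by positivity)], rfl⟩
            · exact ⟨-(v + 1), by omega,
                by push_cast; rw [abs_neg, abs_of_nonneg (by positivity)], by ring⟩
          · rintro ⟨t, h1, h2, rfl⟩
            push_cast at h2
            by_cases h : |t| ≤ v
            · exact .inl ⟨t, h1, h, rfl⟩
            · have h5 : |t| = v + 1 := by omega
              rcases (abs_eq (by positivity)).1 h5 with rfl | rfl
              · exact .inr (.inl rfl)
              · exact .inr (.inr (by ring))
      · simp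
        omega
      · rintro M3 hF3 ⟨F, hF, htop3, hFlen, hy, hz, hFmem⟩
        refine ⟨E ++ F, hF, htop3, ?_, fun x => ?_⟩
        · rw [List.length_append, hElen, hFlen]
          ring
        · rw [List.mem_append, hEmem, hFmem]
          constructor
          · rintro (⟨a, ha, h1, h2⟩ | h1)
            · exact ⟨a, ha, by omega, h2⟩
            · exact ⟨l, hl, by omega, h1⟩
          · rintro ⟨a, ha, h1, h2⟩
            rcases Nat.lt_succ_iff_lt_or_eq.1 h1 with h | rfl
            · exact .inl ⟨a, ha, h, h2⟩
            · exact .inr h2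
    · have hmul : L0.length * (50 + R * 100 + 6) ≤ (2 * R + 1) ^ m * 150 := by
        calc L0.length * (50 + R * 100 + 6) ≤ (2 * R + 1) ^ k * ((2 * R + 1) * 150) := by
              rw [hlen]; exact Nat.mul_le_mul_left _ (by omega)
          _ = (2 * R + 1) ^ (k + 1) * 150 := by ring
          _ ≤ (2 * R + 1) ^ m * 150 :=
              Nat.mul_le_mul_right _ (Nat.pow_le_pow_right (by omega) hk)
      simp
      omega
    · rintro M2 hF2 ⟨E, hE, htop2, hElen, hEmem⟩
      refine ⟨L0 ++ E, hE, htop2, ?_, fun x => ?_⟩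
      · rw [List.length_append, hElen, hlen]
        ring
      · rw [List.mem_append, hEmem]
        constructor
        · rintro (h | ⟨a, ha, _, t, _, ht, rfl⟩)
          · obtain ⟨z, h1, h2, h3⟩ := (hmem x).1 h
            exact ⟨z, h1, fun i hi => h2 i (by omega), h3⟩
          · obtain ⟨z, h1, h2, h3⟩ := (hmem _).1 (List.getElem_mem ha)
            refine ⟨Function.update z ⟨k, hk⟩ t, fun i => ?_, fun i hi => ?_, ?_⟩
            · by_cases h : i = ⟨k, hk⟩
              · subst h; simpa using ht
              · rw [Function.update_of_ne h]; exact h1 i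
            · rw [Function.update_of_ne (fun h => by rw [h] at hi; simp at hi)]
              exact h2 i (by omega)
            · rw [enc_update, h2 ⟨k, hk⟩ le_rfl, h3]
              simp
        · rintro ⟨z, h1, h2, rfl⟩
          by_cases h0 : z ⟨k, hk⟩ = 0
          · refine .inl ((hmem _).2 ⟨z, h1, fun i hi => ?_, rfl⟩)
            rcases Nat.eq_or_lt_of_le hi with h | h
            · have : i = ⟨k, hk⟩ := Fin.ext h.symm
              rw [this, h0]
            · exact h2 i h
          · right
            have hz' : enc B (Function.update z ⟨k, hk⟩ 0) ∈ L0 := by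
              refine (hmem _).2 ⟨_, fun i => ?_, fun i hi => ?_, rfl⟩
              · by_cases h : i = ⟨k, hk⟩
                · subst h; simp
                · rw [Function.update_of_ne h]; exact h1 i
              · rcases Nat.eq_or_lt_of_le hi with h | h
                · have : i = ⟨k, hk⟩ := Fin.ext h.symm
                  simp [this]
                · rw [Function.update_of_ne (fun h' => by rw [h'] at h; simp at h)]
                  exact h2 i h
            obtain ⟨a, ha, ha2⟩ := List.getElem_of_mem hz'
            refine ⟨a, ha, ha, z ⟨k, hk⟩, h0, h1 _, ?_⟩
            rw [ha2, enc_update]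
            ring
  · simp
    ring_nf
    omega
  · rintro M' _ ⟨Lb, h1, h2, h3, h4⟩
    refine ⟨Lb, h1, h2, h3, fun x => (h4 x).trans ?_⟩
    constructor
    · rintro ⟨z, h5, _, h6⟩
      exact ⟨z, h5, h6⟩
    · rintro ⟨z, h5, h6⟩
      exact ⟨z, h5, fun i hi => absurd i.2 (by omega), h6⟩

/-- The `k`-th of `K + 1` lattice points that follow the segment from `0` to `b`. -/
def segPoint (b : Fin m → ℤ) (K k : ℕ) (i : Fin m) : ℤ := k * b i / K

/-- Quotient and remainder of `k β / K` are updated by an addition and at most one carry. -/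
lemma carry {K : ℕ} (hK : 1 ≤ K) {β : ℤ} (hβ : |β| ≤ K) (k : ℕ) :
    (((k + 1 : ℕ) * β) / K = k * β / K +
      (if (K : ℤ) ≤ k * β % K + β then 1 else if k * β % K + β < 0 then -1 else 0)) ∧
    ((k + 1 : ℕ) * β) % K = k * β % K + β -
      K * (if (K : ℤ) ≤ k * β % K + β then 1 else if k * β % K + β < 0 then -1 else 0) := by
  have hK' : (0 : ℤ) < K := by exact_mod_cast hK
  have h1 := Int.emod_add_mul_ediv (k * β) K
  have h2 := Int.emod_nonneg (k * β) hK'.ne'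
  have h3 := Int.emod_lt_of_pos (k * β) hK'
  have h4 := abs_le.1 hβ
  rw [Int.ediv_emod_unique hK']
  push_cast
  refine ⟨by linear_combination h1, ?_, ?_⟩ <;> split_ifs <;> omega

lemma advance_spec {M : Store Var Arr} {K B k : ℕ} (hI : IsInput A b c (M.arr .io))
    (hm : M.var .m = m) (hmn : M.var .mn = m * n) (hK : M.var .K = K) (hK1 : 1 ≤ K)
    (hb : ∀ i, |b i| ≤ K) (hpow : ∀ i < m, M.arr .pow i = (B : ℤ) ^ i)
    (hq : M.var .q = enc B (segPoint b K k))
    (hfrac : ∀ i : Fin m, M.arr .frac i = k * b i % K) :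
    Spec advance M (50 + m * 200) fun M' => M'.var .q = enc B (segPoint b K (k + 1)) ∧
      ∀ i : Fin m, M'.arr .frac i = (k + 1 : ℕ) * b i % K := by
  refine Spec.mono (Spec.for_ (fun a M' =>
    M'.var .q = enc B (fun i => segPoint b K (if (i : ℕ) < a then k + 1 else k) i) ∧
    ∀ i : Fin m, M'.arr .frac i = (if (i : ℕ) < a then k + 1 else k : ℕ) * b i % K) m 190
    (by simp [hm]) (by simpa using ⟨hq, hfrac⟩) ?_) (by simp; omega) ?_
  · rintro a ha M1 hF1 ⟨hq1, hf1⟩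
    have mn1 := hF1.var .mn rfl
    have K1 := hF1.var .K rfl
    have pow1 := hF1.arr .pow rfl
    have io1 := hF1.arr .io rfl
    rw [hmn] at mn1
    rw [hK] at K1
    have hio : M.arr .io (2 + m * n + a) = b ⟨a, ha⟩ := hI.rhs ⟨a, ha⟩
    have hpw : M.arr .pow a = (B : ℤ) ^ a := hpow a ha
    have hfr : M1.arr .frac a = k * b ⟨a, ha⟩ % K := by simpa using hf1 ⟨a, ha⟩
    obtain ⟨c1, c2⟩ := carry hK1 (hb ⟨a, ha⟩) k
    -- the carry `d` determines the new quotient and remainder in coordinate `a`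
    have key : ∀ (M' : Store Var Arr) (d : ℤ),
        d = (if (K : ℤ) ≤ k * b ⟨a, ha⟩ % K + b ⟨a, ha⟩ then 1
          else if k * b ⟨a, ha⟩ % K + b ⟨a, ha⟩ < 0 then -1 else 0) →
        M'.var .q = M1.var .q + d * (B : ℤ) ^ a →
        M'.arr .frac = Function.update (M1.arr .frac) a
          (k * b ⟨a, ha⟩ % K + b ⟨a, ha⟩ - K * d) →
        M'.var .q = enc B (fun i => segPoint b K (if (i : ℕ) < a + 1 then k + 1 else k) i) ∧
        ∀ i : Fin m, M'.arr .frac i = (if (i : ℕ) < a + 1 then k + 1 else k : ℕ) * b i % K := by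
      intro M' d hd h1 h2
      rw [← hd] at c1 c2
      constructor
      · rw [h1, hq1]
        have : (fun i : Fin m => segPoint b K (if (i : ℕ) < a + 1 then k + 1 else k) i) =
            Function.update (fun i : Fin m => segPoint b K (if (i : ℕ) < a then k + 1 else k) i)
              ⟨a, ha⟩ (segPoint b K (k + 1) ⟨a, ha⟩) := by
          ext i
          by_cases h : i = ⟨a, ha⟩
          · subst h; simp
          · have h' : (i : ℕ) ≠ a := fun h' => h (Fin.ext h')
            rw [Function.update_of_ne h]
            have : (i : ℕ) < a + 1 ↔ (i : ℕ) < a := by omega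
            simp only [this]
        rw [this, enc_update]
        simp only [segPoint, lt_self_iff_false, if_false, c1]
        ring
      · intro i
        rw [h2]
        by_cases h : i = ⟨a, ha⟩
        · subst h
          simp only [Function.update_self, Nat.lt_succ_self, if_true, c2]
        · have h' : (i : ℕ) ≠ a := fun h' => h (Fin.ext h')
          rw [Function.update_of_ne (by exact_mod_cast h'), hf1]
          have : (i : ℕ) < a + 1 ↔ (i : ℕ) < a := by omega
          simp only [this]
    refine Spec.flat rfl ?_
    simp only [Cmd.denote_seq, Cmd.denote_set]
    rw [Cmd.denote_ite]
    have hy : ∀ M' : Store Var Arr, M' = (M1.setVar .i a).setVar .y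
        (k * b ⟨a, ha⟩ % K + b ⟨a, ha⟩) → M'.var .y = k * b ⟨a, ha⟩ % K + b ⟨a, ha⟩ ∧
        M'.var .K = K ∧ M'.arr .pow = M.arr .pow ∧ M'.var .i = a ∧ M'.var .q = M1.var .q ∧
        M'.arr .frac = M1.arr .frac := by
      rintro _ rfl
      simp [K1, pow1]
    have hY : (G .frac (V .i) + G .io (L 2 + V .mn + V .i)).eval (M1.setVar .i a)
        = k * b ⟨a, ha⟩ % K + b ⟨a, ha⟩ := by
      simp [hfr, io1, mn1, hio]
    rw [hY]
    generalize hM2 : (M1.setVar .i a).setVar .y (k * b ⟨a, ha⟩ % K + b ⟨a, ha⟩) = M2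
    obtain ⟨y2, K2, pow2, i2, q2, f2⟩ := hy M2 hM2.symm
    by_cases h1 : (K : ℤ) ≤ k * b ⟨a, ha⟩ % K + b ⟨a, ha⟩
    · rw [if_pos (by simp [y2, K2]; omega)]
      refine key _ 1 (by rw [if_pos h1]) ?_ ?_ <;>
        simp [Cmd.denote, y2, K2, pow2, i2, q2, f2, hpw]
    · rw [if_neg (by simp [y2, K2]; omega), Cmd.denote_ite]
      by_cases h2 : k * b ⟨a, ha⟩ % K + b ⟨a, ha⟩ < 0
      · rw [if_pos (by simp [y2]; omega)]
        refine key _ (-1) (by rw [if_neg h1, if_pos h2]) ?_ ?_ <;>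
          simp [Cmd.denote, y2, K2, pow2, i2, q2, f2, hpw, sub_eq_add_neg]
      · rw [if_neg (by simp [y2]; omega)]
        refine key _ 0 (by rw [if_neg h1, if_neg h2]) ?_ ?_ <;>
          simp [Cmd.denote, y2, i2, q2, f2]
  · rintro M' _ ⟨h1, h2⟩
    refine ⟨?_, fun i => by simpa using h2 i⟩
    simpa using h1

end Solver

namespace Solver

open Loop StdIP

variable {m n : ℕ} {A : Matrix (Fin m) (Fin n) ℤ} {b : Fin m → ℤ} {c : Fin n → ℤ}

/-- The arrays `node` and `mark` describe the node list `L`. -/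
structure IsNodes (node mark : ℤ → ℤ) (L : List ℤ) : Prop where
  isList : IsList node L
  mark : ∀ u, 0 < mark u ↔ u ∈ L

lemma enterNode_spec {M : Store Var Arr} {Ln : List ℤ} (hN : M.var .N = Ln.length)
    (hLn : IsNodes (M.arr .node) (M.arr .mark) Ln) :
    Spec enterNode M 130 fun M' => ∃ L', M'.var .N = L'.length ∧
      IsNodes (M'.arr .node) (M'.arr .mark) L' ∧ L'.length ≤ Ln.length + 1 ∧
      ∀ x, x ∈ L' ↔ x ∈ Ln ∨ x = M.var .q + M.arr .box (M.var .l) := by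
  set u := M.var .q + M.arr .box (M.var .l) with hu
  refine Spec.mono (Spec.set_seq (Spec.ite (N := 80) (fun hp => ?_) (fun hp => ?_))) (by decide)
    fun M' _ h => h
  · have hmem : u ∈ Ln := by
      rw [← hLn.mark]
      simpa using hp
    refine Spec.flat rfl ⟨Ln, by simpa [Cmd.denote] using hN, by simpa [Cmd.denote] using hLn,
      by omega, fun x => ?_⟩
    constructor
    · exact .inl
    · rintro (h | rfl)
      exacts [h, hmem]
  · have hmem : u ∉ Ln := by
      rw [← hLn.mark]
      simpa using hp
    refine Spec.flat rfl ⟨Ln ++ [u], ?_, ?_, by simp, by simp⟩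
    · simp [Cmd.denote, hN]
    · simp only [Cmd.denote, Expr.eval, Store.arr_setArr, Store.arr_setVar,
        Store.var_setArr, Store.var_setVar, reduceCtorEq, if_false, if_true, ← hu]
      refine ⟨hLn.isList.push hN, fun x => ?_⟩
      · by_cases hx : x = u
        · subst hx; simp
        · simp [hx, hLn.mark]

/-- The nodes of the graph on which the program works: the lattice points in the cubes of radius `R`
around the points that follow the segment from `0` to `b`. -/
def cubeNodes (b : Fin m → ℤ) (K R : ℕ) : Set (Fin m → ℤ) :=
  {x | ∃ k ≤ K, ∀ i, |x i - segPoint b K k i| ≤ R}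

lemma segPoint_self {K : ℕ} (hK : 1 ≤ K) : segPoint b K K = b := by
  ext i
  exact Int.mul_ediv_cancel_left _ (by omega)

lemma nodePoints_spec {M : Store Var Arr} {K B R : ℕ} {Lb : List ℤ}
    (hI : IsInput A b c (M.arr .io))
    (hm : M.var .m = m) (hmn : M.var .mn = m * n) (hK : M.var .K = K) (hK1 : 1 ≤ K)
    (hb : ∀ i, |b i| ≤ K) (hpow : ∀ i < m, M.arr .pow i = (B : ℤ) ^ i)
    (hLb : IsList (M.arr .box) Lb) (htop : M.var .top = Lb.length)
    (hbox : ∀ x, x ∈ Lb ↔ ∃ z : Fin m → ℤ, (∀ i, |z i| ≤ R) ∧ x = enc B z)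
    (hfrac : M.arr .frac = fun _ => 0) (hmark : M.arr .mark = fun _ => 0) :
    Spec nodePoints M (100 + (K + 1) * (200 + Lb.length * 200 + m * 200)) fun M' =>
      M'.var .bc = enc B b ∧ ∃ Ln : List ℤ, IsNodes (M'.arr .node) (M'.arr .mark) Ln ∧
        M'.var .N = Ln.length ∧ Ln.length ≤ (K + 1) * Lb.length ∧
        ∀ u, u ∈ Ln ↔ u ∈ enc (B : ℤ) '' cubeNodes b K R := by
  have hshift : ∀ (k : ℕ) (u : ℤ), (∃ x : Fin m → ℤ, (∀ i, |x i - segPoint b K k i| ≤ R) ∧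
      enc B x = u) ↔ ∃ (l : ℕ) (hl : l < Lb.length), u = enc B (segPoint b K k) + Lb[l] := by
    intro k u
    constructor
    · rintro ⟨x, hx, rfl⟩
      have : enc B (x - segPoint b K k) ∈ Lb := (hbox _).2 ⟨_, hx, rfl⟩
      obtain ⟨l, hl, hl2⟩ := List.getElem_of_mem this
      refine ⟨l, hl, ?_⟩
      rw [hl2, ← enc_add, add_sub_cancel]
    · rintro ⟨l, hl, rfl⟩
      obtain ⟨z, hz, hz2⟩ := (hbox _).1 (List.getElem_mem hl)
      refine ⟨segPoint b K k + z, fun i => ?_, by rw [enc_add, hz2]⟩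
      simpa using hz i
  refine Spec.mono (Spec.set_seq (Spec.set_seq (Spec.for_ (fun k M' =>
    M'.var .q = enc B (segPoint b K k) ∧ (∀ i : Fin m, M'.arr .frac i = k * b i % K) ∧
    (∀ k', k' + 1 = k → M'.var .bc = enc B (segPoint b K k')) ∧
    ∃ Ln : List ℤ, IsNodes (M'.arr .node) (M'.arr .mark) Ln ∧
      M'.var .N = Ln.length ∧ Ln.length ≤ k * Lb.length ∧
      ∀ u, u ∈ Ln ↔ ∃ k' < k, ∃ x : Fin m → ℤ, (∀ i, |x i - segPoint b K k' i| ≤ R) ∧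
        enc B x = u)
    (K + 1) (150 + Lb.length * 150 + m * 200) (by simp [hK]) ?_ ?_))) ?_ ?_
  · refine ⟨?_, ?_, by simp, [], ⟨IsList.nil _, by simp [hmark]⟩, by simp,
      by simp, by simp⟩
    · have : segPoint b K 0 = 0 := by ext i; simp [segPoint]
      simp [this]
    · intro i
      simp [hfrac]
  · rintro k hk M1 hF1 ⟨hq1, hf1, -, Ln, hLn, hN, hlen, hmem⟩
    have top1 := hF1.var .top rfl
    have box1 := hF1.arr .box rfl
    simp [htop] at top1
    simp at box1
    refine Spec.mono (Spec.set_seq (Spec.seq (Spec.for_ (fun l M' =>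
      ∃ L' : List ℤ, IsNodes (M'.arr .node) (M'.arr .mark) L' ∧ M'.var .N = L'.length ∧
        L'.length ≤ k * Lb.length + l ∧
        ∀ u, u ∈ L' ↔ u ∈ Ln ∨ ∃ (l' : ℕ) (hl : l' < Lb.length), l' < l ∧
          u = enc B (segPoint b K k) + Lb[l'])
      Lb.length 130 (by simp [top1]) ?_ ?_) (b := 80 + m * 200) ?_)) ?_ fun M' _ h => h
    · refine ⟨Ln, by simpa using hLn, by simpa using hN, by simpa using hlen, by simp⟩
    · rintro l hl M2 hF2 ⟨L', hL', hN', hlen', hmem'⟩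
      have q2 := hF2.var .q rfl
      have box2 := hF2.arr .box rfl
      simp [hq1] at q2
      simp [box1] at box2
      refine Spec.mono (enterNode_spec (Ln := L') (by simpa using hN') (by simpa using hL')) le_rfl
        ?_
      rintro M3 - ⟨L'', h1, h2, h3, h4⟩
      refine ⟨L'', h2, h1, by omega, fun u => ?_⟩
      rw [h4, hmem']
      simp only [Store.var_setVar, Store.arr_setVar, reduceCtorEq, if_false, if_true, q2, box2,
        hLb l hl]
      constructor
      · rintro ((h | ⟨l', hl', h5, h6⟩) | h)
        · exact .inl h
        · exact .inr ⟨l', hl', by omega, h6⟩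
        · exact .inr ⟨l, hl, by omega, h⟩
      · rintro (h | ⟨l', hl', h5, h6⟩)
        · exact .inl (.inl h)
        · rcases Nat.lt_succ_iff_lt_or_eq.1 h5 with h | rfl
          · exact .inl (.inr ⟨l', hl', h, h6⟩)
          · exact .inr h6
    · rintro M2 hF2 ⟨L', hL', hN', hlen', hmem'⟩
      have io2 : M2.arr .io = M.arr .io := (hF2.arr .io rfl).trans (hF1.arr .io rfl)
      have pow2 : M2.arr .pow = M.arr .pow := (hF2.arr .pow rfl).trans (hF1.arr .pow rfl)
      have m2 : M2.var .m = m := by rw [hF2.var .m rfl, ← hm]; exact hF1.var .m rfl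
      have mn2 : M2.var .mn = m * n := by rw [hF2.var .mn rfl, ← hmn]; exact hF1.var .mn rfl
      have K2 : M2.var .K = K := by rw [hF2.var .K rfl, ← hK]; exact hF1.var .K rfl
      have q2 := hF2.var .q rfl
      have bc2 := hF2.var .bc rfl
      have frac2 := hF2.arr .frac rfl
      simp [hq1] at q2 bc2
      simp at frac2
      refine Spec.mono (advance_spec (A := A) (b := b) (c := c) (K := K) (B := B) (k := k)
        (by rwa [io2]) m2 mn2 K2 hK1 hb (by rwa [pow2]) q2
        (by rwa [frac2])) (N' := 80 + m * 200) (by omega) ?_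
      rintro M3 hF3 ⟨h1, h2⟩
      refine ⟨h1, h2, ?_, L', ?_, ?_, ?_, fun u => ?_⟩
      · intro k' hk'
        obtain rfl : k' = k := by omega
        rw [hF3.var .bc rfl, bc2]
      · rwa [hF3.arr .node rfl, hF3.arr .mark rfl]
      · rw [hF3.var .N rfl, hN']
      · rw [add_mul, one_mul]
        exact hlen'
      · rw [hmem', hmem]
        constructor
        · rintro (⟨k', hk', h⟩ | ⟨l', hl', _, h⟩)
          · exact ⟨k', by omega, h⟩
          · exact ⟨k, by omega, (hshift k u).2 ⟨l', hl', h⟩⟩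
        · rintro ⟨k', hk', h⟩
          rcases Nat.lt_succ_iff_lt_or_eq.1 hk' with h3 | rfl
          · exact .inl ⟨k', h3, h⟩
          · obtain ⟨l', hl', h4⟩ := (hshift k' u).1 h
            exact .inr ⟨l', hl', hl', h4⟩
    · simp
      omega
  · simp
    ring_nf
    omega
  · rintro M' - ⟨-, -, h1, Ln, h2, h3, h4, h5⟩
    refine ⟨by rw [h1 K rfl, segPoint_self hK1], Ln, h2, h3, h4, fun u => (h5 u).trans ?_⟩
    simp only [Set.mem_image, cubeNodes, Set.mem_ofPred_eq, Nat.lt_succ_iff]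
    constructor
    · rintro ⟨k, hk, x, hx, rfl⟩
      exact ⟨x, ⟨k, hk, hx⟩, rfl⟩
    · rintro ⟨x, ⟨k, hk, hx⟩, rfl⟩
      exact ⟨k, hk, x, hx, rfl⟩

end Solver

/-! ### Walks on codes -/

namespace Solver

open Loop StdIP

variable {m n : ℕ} {A : Matrix (Fin m) (Fin n) ℤ} {b : Fin m → ℤ} {c : Fin n → ℤ}
  {s : Fin n → ℤ} {U : Set ℤ}

/-- The end of the walk from `0` whose arcs, last arc first, are those of `p`; an arc labelled `j`
adds `s j`. -/
def endpoint (s : Fin n → ℤ) (p : List (Fin n)) : ℤ := (p.map s).sum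

/-- The walk from `0` with the arcs `p`, last arc first, stays in `U`. -/
def StaysIn (s : Fin n → ℤ) (U : Set ℤ) (p : List (Fin n)) : Prop :=
  ∀ q, q <:+ p → endpoint s q ∈ U

@[simp] lemma endpoint_nil : endpoint s [] = 0 := rfl

@[simp] lemma endpoint_cons (j : Fin n) (p : List (Fin n)) :
    endpoint s (j :: p) = s j + endpoint s p := by simp [endpoint]

lemma endpoint_append (p q : List (Fin n)) :
    endpoint s (p ++ q) = endpoint s p + endpoint s q := by simp [endpoint]

lemma staysIn_nil : StaysIn s U [] ↔ (0 : ℤ) ∈ U := by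
  simp [StaysIn]

lemma staysIn_cons (j : Fin n) (p : List (Fin n)) :
    StaysIn s U (j :: p) ↔ s j + endpoint s p ∈ U ∧ StaysIn s U p := by
  simp only [StaysIn, List.suffix_cons_iff]
  constructor
  · intro h
    exact ⟨by simpa using h _ (.inl rfl), fun q hq => h q (.inr hq)⟩
  · rintro ⟨h1, h2⟩ q (rfl | hq)
    · simpa using h1
    · exact h2 q hq

lemma StaysIn.suffix {p q : List (Fin n)} (h : StaysIn s U p) (hq : q <:+ p) : StaysIn s U q :=
  fun r hr => h r (hr.trans hq)

lemma StaysIn.endpoint_mem {p : List (Fin n)} (h : StaysIn s U p) : endpoint s p ∈ U :=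
  h p List.suffix_rfl

/-- The first part of a walk can be replaced by any other walk to the same node. -/
lemma StaysIn.replace {p q q' : List (Fin n)} (h : StaysIn s U (p ++ q)) (hq' : StaysIn s U q')
    (he : endpoint s q = endpoint s q') : StaysIn s U (p ++ q') := by
  induction p with
  | nil => exact hq'
  | cons j p ih =>
    rw [List.cons_append, staysIn_cons] at h ⊢
    refine ⟨?_, ih h.2⟩
    rw [endpoint_append, ← he, ← endpoint_append]
    exact h.1

/-- A closed walk of positive weight can be reached from `0`. -/
def PosCycle (s : Fin n → ℤ) (U : Set ℤ) (c : Fin n → ℤ) : Prop :=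
  ∃ p q, StaysIn s U (q ++ p) ∧ endpoint s q = 0 ∧ 0 < weight c q

/-- Without positive cycles every walk can be shortened, without loss of weight, to at most as many
arcs as there are nodes: a longer walk visits a node twice. -/
lemma exists_short {Ln : List ℤ} (hU : ∀ u, u ∈ U → u ∈ Ln) (hc : ¬ PosCycle s U c) :
    ∀ (t : ℕ) (p : List (Fin n)), p.length = t → StaysIn s U p →
      ∃ q, StaysIn s U q ∧ endpoint s q = endpoint s p ∧ q.length ≤ Ln.length ∧
        weight c p ≤ weight c q := by
  intro t
  induction t using Nat.strong_induction_on with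
  | _ t ih =>
  intro p hp hpU
  by_cases hle : p.length ≤ Ln.length
  · exact ⟨p, hpU, rfl, hle, le_rfl⟩
  · obtain ⟨i, j, hij, hijp, he⟩ : ∃ i j, i < j ∧ j ≤ p.length ∧
        endpoint s (p.drop i) = endpoint s (p.drop j) := by
      have hcard : Ln.toFinset.card < (Finset.range (p.length + 1)).card := by
        rw [Finset.card_range]
        exact (List.toFinset_card_le _).trans_lt (by omega)
      obtain ⟨i, hi, j, hj, hne, he⟩ := Finset.exists_ne_map_eq_of_card_lt_of_maps_to hcard
        (f := fun i => endpoint s (p.drop i)) fun i _ =>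
          List.mem_toFinset.2 (hU _ (hpU _ (List.drop_suffix _ _)))
      rw [Finset.mem_range] at hi hj
      rcases lt_or_gt_of_ne hne with h | h
      · exact ⟨i, j, h, by omega, he⟩
      · exact ⟨j, i, h, by omega, he.symm⟩
    have h1 : p = p.take i ++ ((p.drop i).take (j - i) ++ p.drop j) := by
      conv_lhs => rw [← List.take_append_drop i p, ← List.take_append_drop (j - i) (p.drop i)]
      rw [List.drop_drop, Nat.add_sub_cancel' hij.le]
    have h2 : p.drop i = (p.drop i).take (j - i) ++ p.drop j := by
      conv_lhs => rw [← List.take_append_drop (j - i) (p.drop i)]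
      rw [List.drop_drop, Nat.add_sub_cancel' hij.le]
    have hcyc : endpoint s ((p.drop i).take (j - i)) = 0 := by
      have h3 := endpoint_append (s := s) ((p.drop i).take (j - i)) (p.drop j)
      rw [← h2, he] at h3
      linarith
    have hw : weight c ((p.drop i).take (j - i)) ≤ 0 := by
      by_contra! h
      exact hc ⟨p.drop j, _, by rw [← h2]; exact hpU.suffix (List.drop_suffix _ _), hcyc, h⟩
    have hU' : StaysIn s U (p.take i ++ p.drop j) :=
      StaysIn.replace (q := p.drop i) (by rwa [List.take_append_drop])
        (hpU.suffix (List.drop_suffix _ _)) he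
    obtain ⟨q, hq1, hq2, hq3, hq4⟩ := ih (p.take i ++ p.drop j).length
      (by rw [List.length_append, List.length_take, List.length_drop]; omega) _ rfl hU'
    refine ⟨q, hq1, ?_, hq3, le_trans ?_ hq4⟩
    · rw [hq2, endpoint_append, ← he, ← endpoint_append, List.take_append_drop]
    · have := congrArg (weight c) h1
      rw [weight_append, weight_append] at this
      rw [weight_append]
      linarith

lemma endpoint_enc {B : ℤ} (p : List (Fin n)) :
    endpoint (fun j => enc B fun i => A i j) p = enc B (colSum A p) := by
  induction p with
  | nil =>
    rw [show colSum A [] = 0 from rfl, enc_zero, endpoint_nil]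
  | cons j p ih =>
    have : colSum A (j :: p) = (fun i => A i j) + colSum A p := by
      ext i
      simp [colSum]
    rw [endpoint_cons, ih, this, enc_add]

/-- As long as the codes of the points of `S` and of their neighbours are distinct, walks on the codes
of `S` are walks in `S`. -/
lemma staysIn_iff {B : ℤ} {S : Set (Fin m → ℤ)} (h0 : (0 : Fin m → ℤ) ∈ S)
    (hS : ∀ x ∈ S, ∀ y ∈ S, ∀ j i, |x i + A i j - y i| < B) (p : List (Fin n)) :
    StaysIn (fun j => enc B fun i => A i j) (enc B '' S) p ↔ ∀ q, q <:+ p → colSum A q ∈ S := by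
  induction p with
  | nil =>
    rw [staysIn_nil]
    simp only [List.suffix_nil, forall_eq]
    rw [show colSum A [] = 0 from rfl]
    exact ⟨fun _ => h0, fun _ => ⟨0, h0, enc_zero B⟩⟩
  | cons j p ih =>
    rw [staysIn_cons, ih]
    simp only [List.suffix_cons_iff]
    have hcons : colSum A (j :: p) = colSum A p + fun i => A i j := by
      ext i
      simp [colSum, add_comm]
    constructor
    · rintro ⟨⟨y, hy, hy2⟩, h2⟩ q (rfl | hq)
      · rw [endpoint_enc, ← enc_add] at hy2
        have hx := h2 p List.suffix_rfl
        have : (colSum A p + fun i => A i j) = y :=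
          enc_inj (fun i => hS _ hx _ hy j i) (by rw [hy2, add_comm])
        rwa [hcons, this]
      · exact h2 q hq
    · intro h
      refine ⟨?_, fun q hq => h q (.inr hq)⟩
      rw [endpoint_enc, ← enc_add, add_comm, ← hcons]
      exact ⟨_, h _ (.inl rfl), rfl⟩

lemma isWalk_reverse_iff {S : Set (Fin m → ℤ)} (p : List (Fin n)) (y : Fin m → ℤ) :
    IsWalk A S 0 p.reverse y ↔ (∀ q, q <:+ p → colSum A q ∈ S) ∧ y = colSum A p := by
  have hrev : ∀ q, colSum A q.reverse = colSum A q := fun q => colSum_perm q.reverse_perm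
  rw [isWalk_iff, zero_add, hrev]
  refine and_congr_left fun _ => ⟨fun h q hq => ?_, fun h a => ?_⟩
  · have hq' := List.prefix_iff_eq_take.1 (List.reverse_prefix.2 hq)
    have := h q.reverse.length
    rwa [← hq', zero_add, hrev] at this
  · rw [zero_add, ← hrev]
    exact h _ (List.reverse_prefix.1 (by rw [List.reverse_reverse]; exact List.take_prefix _ _))

end Solver

/-! ### The Bellman-Ford method -/

namespace Solver

open Loop StdIP

variable {m n : ℕ} {A : Matrix (Fin m) (Fin n) ℤ} {b : Fin m → ℤ} {c : Fin n → ℤ}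
  {s : Fin n → ℤ} {U : Set ℤ}

/-- The data on which the Bellman-Ford method works: for every code a pointer to a recorded walk, or
`0`, and its weight; the cells of the recorded walks, and the number of the last cell in use. -/
structure Snap where
  ptr : ℤ → ℤ
  val : ℤ → ℤ
  lab : ℤ → ℤ
  prv : ℤ → ℤ
  cells : ℤ

/-- The Bellman-Ford data of a store. -/
def snap (M : Store Var Arr) : Snap :=
  ⟨M.arr .ptr, M.arr .val, M.arr .lab, M.arr .prv, M.var .cells⟩

/-- The cell `t` represents the walk with the arcs `p`, last arc first. Pointers lead to cells of
smaller number, and cell `1` stands for the empty walk. -/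
def Chain (lab prv : ℤ → ℤ) : List (Fin n) → ℤ → Prop
  | [], t => t = 1
  | j :: p, t => 1 < t ∧ lab t = j + 1 ∧ prv t < t ∧ Chain lab prv p (prv t)

/-- Using new cells does not disturb the walks recorded before. -/
lemma Chain.congr {lab prv lab' prv' : ℤ → ℤ} {N : ℤ} (hl : ∀ t ≤ N, lab' t = lab t)
    (hp : ∀ t ≤ N, prv' t = prv t) : ∀ {p : List (Fin n)} {t : ℤ}, t ≤ N →
    Chain lab prv p t → Chain lab' prv' p t
  | [], _, _, h => h
  | j :: p, t, ht, ⟨h1, h2, h3, h4⟩ => by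
    refine ⟨h1, by rw [hl t ht, h2], by rwa [hp t ht], ?_⟩
    rw [hp t ht]
    exact Chain.congr hl hp (h3.le.trans ht) h4

/-- Every recorded pointer and weight belongs to a walk. -/
structure Sound (s : Fin n → ℤ) (U : Set ℤ) (c : Fin n → ℤ) (S : Snap) : Prop where
  one_le : 1 ≤ S.cells
  exists_walk : ∀ u, 0 < S.ptr u → S.ptr u ≤ S.cells ∧ ∃ p, StaysIn s U p ∧ endpoint s p = u ∧
    weight c p = S.val u ∧ Chain S.lab S.prv p (S.ptr u)

/-- The recorded weights are at least those of all walks with at most `k` arcs. -/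
def Complete (s : Fin n → ℤ) (U : Set ℤ) (c : Fin n → ℤ) (k : ℕ) (S : Snap) : Prop :=
  ∀ p, StaysIn s U p → p.length ≤ k →
    0 < S.ptr (endpoint s p) ∧ weight c p ≤ S.val (endpoint s p)

/-- The change from `S` to `S'`: what is recorded grows; something improves strictly if and only if
new cells are used; at most `N` new cells are used. -/
structure Grows (S S' : Snap) (N : ℕ) : Prop where
  le : ∀ x, 0 < S.ptr x → 0 < S'.ptr x ∧ S.val x ≤ S'.val x
  cells_le : S.cells ≤ S'.cells
  le_cells : S'.cells ≤ S.cells + N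
  eq : S'.cells = S.cells → S'.ptr = S.ptr ∧ S'.val = S.val
  improves : S.cells < S'.cells → ∃ x, 0 < S'.ptr x ∧ (0 < S.ptr x → S.val x < S'.val x)

lemma Grows.refl (S : Snap) : Grows S S 0 :=
  ⟨fun _ h => ⟨h, le_rfl⟩, le_rfl, by simp, fun _ => ⟨rfl, rfl⟩, fun h => absurd h (lt_irrefl _)⟩

lemma Grows.trans {S S' S'' : Snap} {N N' : ℕ} (h : Grows S S' N) (h' : Grows S' S'' N') :
    Grows S S'' (N + N') := by
  refine ⟨fun x hx => ?_, h.cells_le.trans h'.cells_le, ?_, fun he => ?_, fun hlt => ?_⟩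
  · have h1 := h.le x hx
    have h2 := h'.le x h1.1
    exact ⟨h2.1, h1.2.trans h2.2⟩
  · have h1 := h.le_cells
    have h2 := h'.le_cells
    push_cast
    linarith
  · have h1 := h.cells_le
    have h2 := h'.cells_le
    have h3 := h.eq (by omega)
    have h4 := h'.eq (by omega)
    exact ⟨h4.1.trans h3.1, h4.2.trans h3.2⟩
  · by_cases h1 : S.cells < S'.cells
    · obtain ⟨x, hx1, hx2⟩ := h.improves h1
      have h2 := h'.le x hx1
      exact ⟨x, h2.1, fun hx => (hx2 hx).trans_le h2.2⟩
    · have h2 : S'.cells = S.cells := le_antisymm (not_lt.1 h1) h.cells_le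
      obtain ⟨x, hx1, hx2⟩ := h'.improves (by omega)
      obtain ⟨h3, h4⟩ := h.eq h2
      exact ⟨x, hx1, by rw [← h3, ← h4]; exact hx2⟩

/-- After the arcs of code `σ` out of `u` have been relaxed, what is recorded for their end in `S'`
is at least what results from `S`. -/
def Relaxed (s : Fin n → ℤ) (U : Set ℤ) (c : Fin n → ℤ) (S S' : Snap) (u σ : ℤ) : Prop :=
  0 < S.ptr u → u + σ ∈ U →
    0 < S'.ptr (u + σ) ∧ ∀ j, s j = σ → S.val u + c j ≤ S'.val (u + σ)

lemma Relaxed.left {S S' S'' : Snap} {N : ℕ} {u σ : ℤ} (h : Grows S S' N)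
    (h' : Relaxed s U c S' S'' u σ) : Relaxed s U c S S'' u σ := by
  intro hu hv
  have h1 := h.le u hu
  have h2 := h' h1.1 hv
  exact ⟨h2.1, fun j hj => (by linarith [h1.2] : _ ≤ S'.val u + c j).trans (h2.2 j hj)⟩

lemma Relaxed.right {S S' S'' : Snap} {N : ℕ} {u σ : ℤ} (h : Relaxed s U c S S' u σ)
    (h' : Grows S' S'' N) : Relaxed s U c S S'' u σ := by
  intro hu hv
  have h1 := h hu hv
  have h2 := h'.le _ h1.1
  exact ⟨h2.1, fun j hj => (h1.2 j hj).trans h2.2⟩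

lemma Complete.succ {k : ℕ} {S S' : Snap} {N : ℕ} (hS : Complete s U c k S) (h : Grows S S' N)
    (hr : ∀ u ∈ U, ∀ j, Relaxed s U c S S' u (s j)) : Complete s U c (k + 1) S' := by
  intro p hp hlen
  cases p with
  | nil =>
    obtain ⟨h1, h2⟩ := hS [] hp (Nat.zero_le _)
    obtain ⟨h3, h4⟩ := h.le _ h1
    exact ⟨h3, h2.trans h4⟩
  | cons j p =>
    have hp' := (staysIn_cons j p).1 hp
    have hlen' : p.length ≤ k := by simpa using hlen
    obtain ⟨h1, h2⟩ := hS p hp'.2 hlen'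
    have hv := hp'.1
    rw [add_comm] at hv
    obtain ⟨h3, h4⟩ := hr _ hp'.2.endpoint_mem j h1 hv
    rw [endpoint_cons, add_comm]
    refine ⟨h3, le_trans ?_ (h4 j rfl)⟩
    rw [show weight c (j :: p) = c j + weight c p by simp [weight]]
    linarith

/-- An improvement after as many rounds as there are nodes betrays a positive cycle. -/
lemma posCycle_of_improves {Ln : List ℤ} (hU : ∀ u, u ∈ U → u ∈ Ln) {S S' : Snap}
    (hS : Complete s U c Ln.length S) (hS' : Sound s U c S')
    (h : ∃ x, 0 < S'.ptr x ∧ (0 < S.ptr x → S.val x < S'.val x)) : PosCycle s U c := by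
  by_contra hc
  obtain ⟨x, hx1, hx2⟩ := h
  obtain ⟨-, p, hp1, hp2, hp3, -⟩ := hS'.exists_walk x hx1
  obtain ⟨q, hq1, hq2, hq3, hq4⟩ := exists_short hU hc _ p rfl hp1
  obtain ⟨h1, h2⟩ := hS q hq1 hq3
  rw [hq2, hp2] at h1 h2
  linarith [hx2 h1]

/-- A round without effect proves the recorded weights to be at least those of all walks. -/
lemma le_of_fixed {S : Snap} (h0 : 0 < S.ptr 0 ∧ 0 ≤ S.val 0)
    (hr : ∀ u ∈ U, ∀ j, Relaxed s U c S S u (s j)) :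
    ∀ p, StaysIn s U p → 0 < S.ptr (endpoint s p) ∧ weight c p ≤ S.val (endpoint s p) := by
  intro p hp
  have : ∀ k, Complete s U c k S := by
    intro k
    induction k with
    | zero =>
      intro p _ hlen
      obtain rfl := List.length_eq_zero_iff.1 (Nat.le_zero.1 hlen)
      simpa [weight] using h0
    | succ k ih => exact ih.succ (Grows.refl S) hr
  exact this _ p hp le_rfl

lemma relax_spec {M : Store Var Arr} {Ln Lc : List ℤ} {l : ℕ} {u : ℤ}
    (hI : IsInput A b c (M.arr .io)) (hcpos : M.var .cpos = 2 + m * n + m)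
    (hcols : IsColumns s c n (M.arr .cols) (M.arr .best) Lc)
    (hmark : ∀ u, 0 < M.arr .mark u ↔ u ∈ Ln) (hl : M.var .l = l) (hlt : l < Lc.length)
    (hu : M.var .u = u) (hS : Sound s {u | u ∈ Ln} c (snap M)) :
    Spec relax M 300 fun M' => Sound s {u | u ∈ Ln} c (snap M') ∧ Grows (snap M) (snap M') 1 ∧
      Relaxed s {u | u ∈ Ln} c (snap M) (snap M') u Lc[l] := by
  obtain ⟨j, hj1, hj2, hj3⟩ := hcols.exists_best Lc[l] (List.getElem_mem hlt)
  have hcol := hcols.isList l hlt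
  refine Spec.flat rfl ?_
  simp only [relax, Cmd.denote_seq, Cmd.denote_set]
  set M1 := (M.setVar .s ((G .cols (V .l)).eval M)).setVar .v
    ((V .u + V .s).eval (M.setVar .s ((G .cols (V .l)).eval M))) with hM1
  have s1 : M1.var .s = Lc[l] := by simp [hM1, hl, hcol]
  have v1 : M1.var .v = u + Lc[l] := by simp [hM1, hl, hcol, hu]
  have u1 : M1.var .u = u := by simp [hM1, hu]
  have cpos1 : M1.var .cpos = 2 + m * n + m := by simp [hM1, hcpos]
  have arr1 : M1.arr = M.arr := by simp [hM1]
  have snap1 : snap M1 = snap M := by simp [snap, hM1]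
  rw [← snap1] at hS ⊢
  -- in the three cases where nothing is recorded the data stay the same
  have hsame : ∀ M', snap M' = snap M1 →
      (0 < M1.arr .ptr u → u + Lc[l] ∈ Ln → 0 < M1.arr .ptr (u + Lc[l]) ∧
        M1.arr .val u + c j ≤ M1.arr .val (u + Lc[l])) →
      Sound s {u | u ∈ Ln} c (snap M') ∧ Grows (snap M1) (snap M') 1 ∧
        Relaxed s {u | u ∈ Ln} c (snap M1) (snap M') u Lc[l] := by
    intro M' h h'
    rw [h]
    refine ⟨hS, ⟨fun _ h => ⟨h, le_rfl⟩, le_rfl, by simp, fun _ => ⟨rfl, rfl⟩,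
      fun h => absurd h (lt_irrefl _)⟩, fun hp hq => ?_⟩
    obtain ⟨h1, h2⟩ := h' hp hq
    exact ⟨h1, fun j' hj' => le_trans (by simpa [snap] using hj3 j' j'.2 hj') h2⟩
  have hskip : ∀ M', snap (skip.denote M') = snap M' := fun M' => by simp [snap, Cmd.denote]
  rw [Cmd.denote_ite]
  by_cases hpu : 0 < M1.arr .ptr u
  · rw [if_pos (by simpa [u1] using hpu), Cmd.denote_ite]
    by_cases hmv : u + Lc[l] ∈ Ln
    · rw [if_pos (by simpa [v1, arr1, hmark] using hmv)]
      simp only [Cmd.denote_seq, Cmd.denote_set]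
      have hw : (G .val (V .u) + G .io (V .cpos + (G .best (V .s) - L 1))).eval M1
          = M1.arr .val u + c j := by
        have := hI.cost j
        simp [u1, cpos1, s1, arr1, hj1, this]
      rw [hw]
      set M2 := M1.setVar .w (M1.arr .val u + c j) with hM2
      have s2 : M2.var .s = Lc[l] := by simp [hM2, s1]
      have v2 : M2.var .v = u + Lc[l] := by simp [hM2, v1]
      have u2 : M2.var .u = u := by simp [hM2, u1]
      have w2 : M2.var .w = M1.arr .val u + c j := by simp [hM2]
      have arr2 : M2.arr = M1.arr := by simp [hM2]
      have cells2 : M2.var .cells = M1.var .cells := by simp [hM2]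
      have snap2 : snap M2 = snap M1 := by simp [snap, hM2]
      -- the case where the new walk is better than what is recorded for its end
      have hrec : (0 < M1.arr .ptr (u + Lc[l]) →
            M1.arr .val (u + Lc[l]) < M1.arr .val u + c j) →
          Sound s {u | u ∈ Ln} c (snap (record.denote M2)) ∧
          Grows (snap M1) (snap (record.denote M2)) 1 ∧
          Relaxed s {u | u ∈ Ln} c (snap M1) (snap (record.denote M2)) u Lc[l] := by
        intro hbetter
        have hnew : snap (record.denote M2) =
            ⟨Function.update (M1.arr .ptr) (u + Lc[l]) (M1.var .cells + 1),
              Function.update (M1.arr .val) (u + Lc[l]) (M1.arr .val u + c j),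
              Function.update (M1.arr .lab) (M1.var .cells + 1) (j + 1),
              Function.update (M1.arr .prv) (M1.var .cells + 1) (M1.arr .ptr u),
              M1.var .cells + 1⟩ := by
          have hj1' : M1.arr .best Lc[l] = j + 1 := by rw [arr1, hj1]
          simp [record, snap, Cmd.denote, s2, v2, u2, w2, arr2, cells2, hj1']
        rw [hnew]
        have hone : 1 ≤ M1.var .cells := hS.one_le
        have hcongr : ∀ {p : List (Fin n)} {t : ℤ}, t ≤ M1.var .cells →
            Chain (M1.arr .lab) (M1.arr .prv) p t →
            Chain (Function.update (M1.arr .lab) (M1.var .cells + 1) (j + 1))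
              (Function.update (M1.arr .prv) (M1.var .cells + 1) (M1.arr .ptr u)) p t :=
          fun ht h => Chain.congr (N := M1.var .cells)
            (fun t ht => by rw [Function.update_of_ne (by omega)])
            (fun t ht => by rw [Function.update_of_ne (by omega)]) ht h
        refine ⟨⟨by dsimp only; omega, fun x hx => ?_⟩, ⟨fun x hx => ?_, ?_, ?_, ?_, fun _ => ?_⟩,
          fun _ _ => ?_⟩
        · dsimp only at hx ⊢
          by_cases hxv : x = u + Lc[l]
          · subst hxv
            obtain ⟨h1, p, hp1, hp2, hp3, hp4⟩ := hS.exists_walk u hpu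
            rw [Function.update_self, Function.update_self]
            refine ⟨le_rfl, j :: p, ?_, ?_, ?_, ?_⟩
            · rw [staysIn_cons]
              refine ⟨?_, hp1⟩
              rw [hp2, hj2, add_comm]
              exact hmv
            · rw [endpoint_cons, hp2, hj2, add_comm]
            · rw [show weight c (j :: p) = c j + weight c p by simp [weight], hp3, add_comm]
              rfl
            · refine ⟨by omega, by simp, ?_, ?_⟩
              · rw [Function.update_self]
                exact lt_of_le_of_lt h1 (lt_add_one _)
              · rw [Function.update_self]
                exact hcongr h1 hp4
          · rw [Function.update_of_ne hxv] at hx ⊢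
            rw [Function.update_of_ne hxv]
            obtain ⟨h1, p, hp1, hp2, hp3, hp4⟩ := hS.exists_walk x hx
            exact ⟨le_trans h1 (lt_add_one _).le, p, hp1, hp2, hp3, hcongr h1 hp4⟩
        · dsimp only [snap] at hx ⊢
          by_cases hxv : x = u + Lc[l]
          · subst hxv
            rw [Function.update_self, Function.update_self]
            exact ⟨by omega, (hbetter hx).le⟩
          · rw [Function.update_of_ne hxv, Function.update_of_ne hxv]
            exact ⟨hx, le_rfl⟩
        · dsimp only [snap]
          omega
        · dsimp only [snap]
          simp
        · dsimp only [snap]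
          intro h
          omega
        · refine ⟨u + Lc[l], ?_, fun h => ?_⟩
          · dsimp only
            rw [Function.update_self]
            omega
          · dsimp only [snap] at h ⊢
            rw [Function.update_self]
            exact hbetter h
        · dsimp only [snap]
          rw [Function.update_self, Function.update_self]
          refine ⟨by omega, fun j' hj' => ?_⟩
          have := hj3 j' j'.2 hj'
          linarith
      rw [Cmd.denote_ite]
      by_cases hpv : 0 < M1.arr .ptr (u + Lc[l])
      · rw [if_pos (by simpa [v2, arr2] using hpv), Cmd.denote_ite]
        by_cases hlt' : M1.arr .val (u + Lc[l]) < M1.arr .val u + c j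
        · rw [if_pos (by simpa [v2, arr2, w2] using hlt')]
          exact hrec fun _ => hlt'
        · rw [if_neg (by simpa [v2, arr2, w2] using hlt')]
          exact hsame _ (by rw [hskip, snap2]) fun _ _ => ⟨hpv, not_lt.1 hlt'⟩
      · rw [if_neg (by simpa [v2, arr2] using hpv)]
        exact hrec fun h => absurd h hpv
    · rw [if_neg (by simpa [v1, arr1, hmark] using hmv)]
      exact hsame _ (hskip _) fun _ h => absurd h hmv
  · rw [if_neg (by simpa [u1] using hpu)]
    exact hsame _ (hskip _) fun h => absurd h hpu

/-- What the program knows after all rounds. -/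
structure IsFinal (s : Fin n → ℤ) (U : Set ℤ) (c : Fin n → ℤ) (N : ℕ) (save : ℤ) (S : Snap) :
    Prop where
  sound : Sound s U c S
  complete : Complete s U c N S
  save_le : save ≤ S.cells
  fixed : S.cells = save → ∀ u ∈ U, ∀ j, Relaxed s U c S S u (s j)
  improves : save < S.cells → PosCycle s U c

lemma bellmanFord_spec {M : Store Var Arr} {Ln Lc : List ℤ}
    (hI : IsInput A b c (M.arr .io)) (hcpos : M.var .cpos = 2 + m * n + m)
    (hcols : IsColumns s c n (M.arr .cols) (M.arr .best) Lc) (hnc : M.var .nc = Lc.length)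
    (hLn : IsNodes (M.arr .node) (M.arr .mark) Ln) (hN : M.var .N = Ln.length)
    (h0 : (0 : ℤ) ∈ Ln) (hptr : M.arr .ptr = fun _ => 0) (hval : M.arr .val = fun _ => 0) :
    Spec bellmanFord M (100 + (Ln.length + 1) * (100 + Ln.length * (100 + Lc.length * 400)))
      fun M' => IsFinal s {u | u ∈ Ln} c Ln.length (M'.var .save) (snap M') ∧
        M'.var .cells ≤ 1 + (Ln.length + 1) * (Ln.length * Lc.length) := by
  set U : Set ℤ := {u | u ∈ Ln} with hU
  refine Spec.mono (Spec.set_seq (Spec.put_seq (Spec.for_ (fun k M' =>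
    Sound s U c (snap M') ∧ Complete s U c k (snap M') ∧
    M'.var .cells ≤ 1 + k * (Ln.length * Lc.length) ∧
    ∀ k', k' + 1 = k → ∃ S : Snap, Complete s U c k' S ∧ M'.var .save = S.cells ∧
      Grows S (snap M') (Ln.length * Lc.length) ∧
      ∀ u ∈ U, ∀ j, Relaxed s U c S (snap M') u (s j))
    (Ln.length + 1) (50 + Ln.length * (100 + Lc.length * 400)) (by simp [hN]) ?_ ?_))) ?_ ?_
  · refine ⟨⟨by simp [snap], fun u hu => ?_⟩, fun p hp hlen => ?_, by simp, by simp⟩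
    · by_cases hu0 : u = 0
      · subst hu0
        refine ⟨by simp [snap], [], ?_, rfl, by simp [weight, snap, hval], by simp [snap, Chain]⟩
        exact staysIn_nil.2 h0
      · simp [snap, hptr, Function.update_of_ne hu0] at hu
    · obtain rfl := List.length_eq_zero_iff.1 (Nat.le_zero.1 hlen)
      simp [snap, weight, hval]
  · rintro k hk M1 hF1 ⟨hS1, hC1, hcells1, -⟩
    have N1 : M1.var .N = Ln.length := by rw [← hN]; exact hF1.var .N rfl
    refine Spec.mono (Spec.set_seq (Spec.for_ (fun i M' => M'.var .save = M1.var .cells ∧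
      Sound s U c (snap M') ∧ Grows (snap M1) (snap M') (i * Lc.length) ∧
      ∀ (a : ℕ) (ha : a < Ln.length), a < i → ∀ (l : ℕ) (hl : l < Lc.length),
        Relaxed s U c (snap M1) (snap M') Ln[a] Lc[l]) Ln.length (60 + Lc.length * 310)
        (by simp [N1]) ?_ ?_)) ?_ ?_
    · refine ⟨by simp, by simpa [snap] using hS1, ?_, by simp⟩
      simpa [snap] using Grows.refl (snap M1)
    · rintro i hi M2 hF2 ⟨hsave2, hS2, hG2, hR2⟩
      have nc2 : M2.var .nc = Lc.length := by
        rw [← hnc, hF2.var .nc rfl]; exact hF1.var .nc rfl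
      have node2 : M2.arr .node = M.arr .node := (hF2.arr .node rfl).trans (hF1.arr .node rfl)
      have hnode : M2.arr .node i = Ln[i] := by rw [node2]; exact hLn.isList i hi
      refine Spec.mono (Spec.set_seq (Spec.for_ (fun l M' => M'.var .save = M1.var .cells ∧
        Sound s U c (snap M') ∧ Grows (snap M1) (snap M') (i * Lc.length + l) ∧
        (∀ (a : ℕ) (ha : a < Ln.length), a < i → ∀ (l' : ℕ) (hl : l' < Lc.length),
          Relaxed s U c (snap M1) (snap M') Ln[a] Lc[l']) ∧
        ∀ (l' : ℕ) (hl : l' < Lc.length), l' < l →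
          Relaxed s U c (snap M1) (snap M') Ln[i] Lc[l']) Lc.length 300
        (by simp [nc2]) ?_ ?_)) ?_ ?_
      · refine ⟨by simpa using hsave2, by simpa [snap] using hS2, by simpa [snap] using hG2,
          by simpa [snap] using hR2, by simp⟩
      · rintro l hl M3 hF3 ⟨hsave3, hS3, hG3, hR3, hR3'⟩
        have io3 : M3.arr .io = M.arr .io :=
          (hF3.arr .io rfl).trans ((hF2.arr .io rfl).trans (hF1.arr .io rfl))
        have cols3 : M3.arr .cols = M.arr .cols :=
          (hF3.arr .cols rfl).trans ((hF2.arr .cols rfl).trans (hF1.arr .cols rfl))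
        have best3 : M3.arr .best = M.arr .best :=
          (hF3.arr .best rfl).trans ((hF2.arr .best rfl).trans (hF1.arr .best rfl))
        have mark3 : M3.arr .mark = M.arr .mark :=
          (hF3.arr .mark rfl).trans ((hF2.arr .mark rfl).trans (hF1.arr .mark rfl))
        have cpos3 : M3.var .cpos = 2 + m * n + m := by
          rw [← hcpos, hF3.var .cpos rfl]
          exact (hF2.var .cpos rfl).trans (hF1.var .cpos rfl)
        have u3 : M3.var .u = Ln[i] := by
          rw [hF3.var .u rfl]
          simp [hnode]
        have hsnap : snap (M3.setVar .l l) = snap M3 := by simp [snap]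
        refine Spec.mono (relax_spec (A := A) (b := b) (c := c) (s := s) (Ln := Ln) (Lc := Lc)
          (l := l) (u := Ln[i]) (by simpa [io3] using hI) (by simpa using cpos3)
          (by simpa [cols3, best3] using hcols) (by simpa [mark3] using hLn.mark) (by simp) hl
          (by simpa using u3) (by simpa only [hsnap] using hS3)) le_rfl ?_
        rintro M4 hF4 ⟨hS4, hG4, hR4⟩
        rw [hsnap] at hG4 hR4
        refine ⟨?_, hS4, hG3.trans hG4, fun a ha hai l' hl' => (hR3 a ha hai l' hl').right hG4,
          fun l' hl' hll => ?_⟩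
        · rw [hF4.var .save rfl]
          simpa using hsave3
        · rcases Nat.lt_succ_iff_lt_or_eq.1 hll with h | rfl
          · exact (hR3' l' hl' h).right hG4
          · exact hR4.left hG3
      · simp
        omega
      · rintro M3 hF3 ⟨hsave3, hS3, hG3, hR3, hR3'⟩
        refine ⟨hsave3, hS3, by rw [add_mul, one_mul]; exact hG3, fun a ha hai l hl => ?_⟩
        rcases Nat.lt_succ_iff_lt_or_eq.1 hai with h | rfl
        · exact hR3 a ha h l hl
        · exact hR3' l hl hl
    · simp
      ring_nf
      omega
    · rintro M2 hF2 ⟨hsave2, hS2, hG2, hR2⟩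
      have hrel : ∀ u ∈ U, ∀ j, Relaxed s U c (snap M1) (snap M2) u (s j) := by
        intro u hu j
        obtain ⟨a, ha, rfl⟩ := List.getElem_of_mem hu
        obtain ⟨l, hl, hl2⟩ := List.getElem_of_mem (hcols.mem j j.2)
        rw [← hl2]
        exact hR2 a ha ha l hl
      refine ⟨hS2, hC1.succ hG2 hrel, ?_, ?_⟩
      · have := hG2.le_cells
        simp only [snap] at this
        push_cast at this ⊢
        linarith
      · intro k' hk'
        obtain rfl : k' = k := by omega
        exact ⟨snap M1, hC1, hsave2, hG2, hrel⟩
  · simp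
    ring_nf
    omega
  · rintro M' - ⟨h1, h2, h3, h4⟩
    obtain ⟨S, h5, h6, h7, h8⟩ := h4 Ln.length rfl
    refine ⟨⟨h1, fun p hp hlen => h2 p hp (by omega), ?_, fun he => ?_, fun hlt => ?_⟩, ?_⟩
    · rw [h6]
      exact h7.cells_le
    · obtain ⟨h9, h10⟩ := h7.eq (by rw [he, h6])
      intro u hu j hp hv
      rw [h9] at hp
      have := h8 u hu j hp hv
      rwa [← h10] at this
    · exact posCycle_of_improves (fun u hu => hu) h5 h1 (h7.improves (by rw [← h6]; exact hlt))
    · push_cast at h3 ⊢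
      exact h3

end Solver

/-! ### Reporting the result -/

namespace Solver

open Loop StdIP

variable {m n : ℕ} {A : Matrix (Fin m) (Fin n) ℤ} {b : Fin m → ℤ} {c : Fin n → ℤ}
  {s : Fin n → ℤ} {U : Set ℤ}

lemma countVec_cons (j : Fin n) (p : List (Fin n)) (i : Fin n) :
    countVec (j :: p) i = countVec p i + if i = j then 1 else 0 := by
  simp only [countVec, List.count_cons]
  by_cases h : i = j
  · subst h; simp
  · simp [h, Ne.symm h]

lemma traceback_spec {M : Store Var Arr} {p : List (Fin n)} {N : ℕ} (hn : M.var .n = n)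
    (hN : M.var .cells = N) (hp : Chain (M.arr .lab) (M.arr .prv) p (M.arr .ptr (M.var .bc)))
    (hle : M.arr .ptr (M.var .bc) ≤ N) :
    Spec traceback M (100 + n * 50 + N * 150) fun M' =>
      M'.var .ans = 1 ∧ ∀ j : Fin n, M'.arr .io j = countVec p j := by
  refine Spec.mono (Spec.seq (Q' := fun M' => ∀ j : Fin n, M'.arr .io j = 0)
    (b := 80 + N * 150) (Spec.mono (Spec.for_ (fun i M' => ∀ j : Fin n, j < i → M'.arr .io j = 0)
      n 20 (by simp [hn]) (by simp) ?_) (N' := 10 + n * 30) (by simp; omega) ?_) ?_)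
      (by omega) fun M' _ h => h
  · intro i hi M' hF h
    refine Spec.flat rfl fun j hj => ?_
    rcases Nat.lt_succ_iff_lt_or_eq.1 hj with h1 | h1
    · have : (j : ℤ) ≠ i := by omega
      simpa [Cmd.denote, this] using h j h1
    · simp [Cmd.denote, h1]
  · intro M' _ h j
    exact h j j.2
  · intro M1 hF1 h1
    have bc1 : M1.var .bc = M.var .bc := hF1.var .bc rfl
    have cells1 : M1.var .cells = N := by rw [← hN]; exact hF1.var .cells rfl
    have ptr1 : M1.arr .ptr = M.arr .ptr := hF1.arr .ptr rfl
    have lab1 : M1.arr .lab = M.arr .lab := hF1.arr .lab rfl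
    have prv1 : M1.arr .prv = M.arr .prv := hF1.arr .prv rfl
    refine Spec.mono (Spec.set_seq (Spec.seq (b := 3)
      (Q' := fun M' => ∀ j : Fin n, M'.arr .io j = countVec p j) (Spec.mono (Spec.for_ (fun i M' =>
      ∃ p', Chain (M.arr .lab) (M.arr .prv) p' (M'.var .p) ∧
        (∀ j : Fin n, M'.arr .io j + countVec p' j = countVec p j) ∧
        (M'.var .p ≤ N - i ∨ p' = [])) N 100 (by simp [cells1]) ?_ ?_)
        (N' := 10 + N * 110) (by simp; omega) ?_) ?_)) (by simp; omega) fun M' _ h => h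
    · exact ⟨p, by simpa [ptr1, bc1] using hp, by simpa using h1,
        .inl (by simpa [ptr1, bc1] using hle)⟩
    · rintro k hk M2 hF2 ⟨p', hp', hio, hdec⟩
      have lab2 : M2.arr .lab = M.arr .lab := by rw [← lab1]; exact hF2.arr .lab rfl
      have prv2 : M2.arr .prv = M.arr .prv := by rw [← prv1]; exact hF2.arr .prv rfl
      refine Spec.flat rfl ?_
      rw [Cmd.denote_ite]
      cases p' with
      | nil =>
        have ht : M2.var .p = 1 := hp'
        rw [if_neg (by simp [ht])]
        exact ⟨[], by simpa [Cmd.denote] using hp', by simpa [Cmd.denote] using hio, .inr rfl⟩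
      | cons j p' =>
        obtain ⟨c1, c2, c3, c4⟩ := hp'
        have hdec' : M2.var .p ≤ N - k := by simpa using hdec
        rw [if_pos (by simpa using c1)]
        refine ⟨p', by simpa [Cmd.denote, prv2] using c4, fun i => ?_, .inl ?_⟩
        · rw [← hio i, countVec_cons]
          by_cases hij : i = j
          · subst hij
            simp [Cmd.denote, lab2, c2]
            ring
          · have : (i : ℤ) ≠ j := fun h => hij (Fin.ext (by exact_mod_cast h))
            simp [Cmd.denote, lab2, c2, hij, this]
        · have : M.arr .prv (M2.var .p) ≤ N - (k + 1) := by omega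
          simpa [Cmd.denote, prv2] using this
    · rintro M2 - ⟨p', hp', hio, hdec⟩ j
      cases p' with
      | nil => simpa [countVec] using hio j
      | cons i p' =>
        obtain ⟨c1, -⟩ := hp'
        simp at hdec
        omega
    · intro M2 hF2 h2
      exact Spec.flat rfl ⟨by simp [Cmd.denote], by simpa [Cmd.denote] using h2⟩

lemma report_spec {M : Store Var Arr} {N : ℕ} (hn : M.var .n = n) (hN : M.var .cells = N)
    (hS : Sound s U c (snap M)) :
    Spec report M (150 + n * 50 + N * 150) fun M' =>
      (M.arr .ptr (M.var .bc) ≤ 0 ∧ M'.var .ans = 0) ∨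
      (0 < M.arr .ptr (M.var .bc) ∧ M.var .save < M.var .cells ∧ M'.var .ans = 2) ∨
      (0 < M.arr .ptr (M.var .bc) ∧ M.var .cells ≤ M.var .save ∧ M'.var .ans = 1 ∧
        ∃ p, StaysIn s U p ∧ endpoint s p = M.var .bc ∧ weight c p = M.arr .val (M.var .bc) ∧
          ∀ j : Fin n, M'.arr .io j = countVec p j) := by
  refine Spec.mono (Spec.ite (N := 120 + n * 50 + N * 150) (fun hp => ?_) fun hp =>
    Spec.mono (N := 10) (Spec.flat rfl (.inl ⟨by simpa using hp, by simp [Cmd.denote]⟩)) (by omega)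
      fun _ _ h => h) (by simp; omega) fun _ _ h => h
  have hp' : 0 < M.arr .ptr (M.var .bc) := by simpa using hp
  refine Spec.mono (Spec.ite (N := 100 + n * 50 + N * 150) (fun hc => ?_) fun hc => ?_)
    (by simp; omega) fun _ _ h => h
  · refine Spec.mono (N := 10) (Spec.flat rfl (.inr (.inl ⟨hp', by simpa using hc, ?_⟩)))
      (by omega) fun _ _ h => h
    simp [Cmd.denote]
  · obtain ⟨h1, p, h2, h3, h4, h5⟩ := hS.exists_walk _ hp'
    refine Spec.mono (traceback_spec hn hN h5 (h1.trans_eq hN)) le_rfl fun M' _ h =>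
      .inr (.inr ⟨hp', by simpa using hc, h.1, p, h2, h3, h4, h.2⟩)

end Solver

/-! ### Correctness of the result -/

namespace Solver

open Loop StdIP Matrix

variable {m n : ℕ} {A : Matrix (Fin m) (Fin n) ℤ} {b : Fin m → ℤ} {c : Fin n → ℤ} {D K : ℕ}

/-- A point at parameter `s` of the segment is followed by `⌊k b / K⌋` with `k = ⌊s K⌋`: each of the
two roundings changes a coordinate by at most `1`. -/
lemma nodes_subset_cubeNodes (h : IsBounds A b D K) : nodes b D ⊆ cubeNodes b K (radius m D) := by
  rintro x ⟨s, hs0, hs1, hx⟩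
  have hK : (0 : ℝ) < K := by exact_mod_cast h.one_le_K
  have hsK : 0 ≤ s * K := by positivity
  refine ⟨⌊s * K⌋₊, ?_, fun i => ?_⟩
  · refine Nat.floor_le_of_le ?_
    nlinarith
  · set k := ⌊s * K⌋₊ with hk
    have hk1 : (k : ℝ) ≤ s * K := Nat.floor_le hsK
    have hk2 : s * K < k + 1 := Nat.lt_floor_add_one _
    have hb : |(b i : ℝ)| ≤ K := by exact_mod_cast h.abs_rhs i
    have hKz : (0 : ℤ) < K := by exact_mod_cast h.one_le_K
    -- the rounding of the quotient
    have e1 : (K : ℝ) * segPoint b K k i ≤ k * b i := by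
      have := Int.mul_ediv_self_le (x := k * b i) hKz.ne'
      exact_mod_cast this
    have e2 : (k * b i : ℝ) < K * segPoint b K k i + K := by
      have := Int.lt_mul_ediv_self_add (x := k * b i) hKz
      exact_mod_cast this
    -- the rounding of the parameter
    have e3 : |(s * K - k) * b i| ≤ K := by
      rw [abs_mul]
      have : |s * K - k| ≤ 1 := by rw [abs_le]; constructor <;> linarith
      nlinarith [abs_nonneg (b i : ℝ), abs_nonneg (s * K - k)]
    have e4 : |s * b i - segPoint b K k i| ≤ 2 := by
      rw [abs_le] at e3 ⊢
      constructor <;> nlinarith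
    have e5 : |(x i : ℝ) - segPoint b K k i| ≤ 2 * m * D + 2 := by
      have := abs_add_le ((x i : ℝ) - s * b i) (s * b i - segPoint b K k i)
      rw [sub_add_sub_cancel] at this
      linarith [hx i]
    have e6 : ((|x i - segPoint b K k i| : ℤ) : ℝ) ≤ ((radius m D : ℕ) : ℤ) := by
      push_cast [radius]
      linarith
    exact_mod_cast e6

lemma zero_mem_cubeNodes (R : ℕ) : (0 : Fin m → ℤ) ∈ cubeNodes b K R :=
  ⟨0, Nat.zero_le _, fun i => by simp [segPoint]⟩

lemma rhs_mem_cubeNodes (hK : 1 ≤ K) (R : ℕ) : b ∈ cubeNodes b K R :=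
  ⟨K, le_rfl, fun i => by simp [segPoint_self hK]⟩

lemma abs_le_of_mem_cubeNodes (h : IsBounds A b D K) {R : ℕ} {x : Fin m → ℤ}
    (hx : x ∈ cubeNodes b K R) (i : Fin m) : |x i| ≤ K + R := by
  obtain ⟨k, hk, hx⟩ := hx
  have hK : (0 : ℤ) < K := by exact_mod_cast h.one_le_K
  have hk' : (k : ℤ) ≤ K := by exact_mod_cast hk
  have h1 : |segPoint b K k i| ≤ K := by
    have hb := abs_le.1 (h.abs_rhs i)
    rw [abs_le, segPoint]
    constructor
    · rw [Int.le_ediv_iff_mul_le hK]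
      nlinarith
    · rw [← Int.lt_add_one_iff, Int.ediv_lt_iff_lt_mul hK]
      nlinarith
  have h2 := abs_add_le (x i - segPoint b K k i) (segPoint b K k i)
  rw [sub_add_cancel] at h2
  linarith [hx i]

lemma abs_sub_lt_base (h : IsBounds A b D K) {x y : Fin m → ℤ}
    (hx : x ∈ cubeNodes b K (radius m D)) (hy : y ∈ cubeNodes b K (radius m D)) (i : Fin m)
    {a : ℤ} (ha : |a| ≤ D) : |x i + a - y i| < (base m D K : ℕ) := by
  have h1 := abs_le.1 (abs_le_of_mem_cubeNodes h hx i)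
  have h2 := abs_le.1 (abs_le_of_mem_cubeNodes h hy i)
  have h3 := abs_le.1 ha
  rw [abs_lt]
  push_cast [base]
  constructor <;> linarith

variable {Ln : List ℤ} {save : ℤ} {S : Snap}

lemma eq_of_enc_eq (h : IsBounds A b D K) {x y : Fin m → ℤ}
    (hx : x ∈ cubeNodes b K (radius m D)) (hy : y ∈ cubeNodes b K (radius m D))
    (he : enc (base m D K : ℕ) x = enc (base m D K : ℕ) y) : x = y :=
  enc_inj (fun i => by simpa using abs_sub_lt_base h hx hy i (a := 0) (by simp)) he

/-- Walks on the codes are walks on the lattice points. -/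
lemma staysIn_cubeNodes_iff (h : IsBounds A b D K)
    (hLn : ∀ u, u ∈ Ln ↔ u ∈ enc (base m D K : ℕ) '' cubeNodes b K (radius m D))
    (p : List (Fin n)) :
    StaysIn (fun j => enc (base m D K : ℕ) fun i => A i j) {u | u ∈ Ln} p ↔
      ∀ q, q <:+ p → colSum A q ∈ cubeNodes b K (radius m D) := by
  have hU : {u | u ∈ Ln} = enc (base m D K : ℕ) '' cubeNodes b K (radius m D) := Set.ext hLn
  rw [hU]
  exact staysIn_iff (zero_mem_cubeNodes _)
    (fun x hx y hy j i => abs_sub_lt_base h hx hy i (h.abs_matrix i j)) p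

lemma exists_staysIn_of_mem (h : IsBounds A b D K)
    (hLn : ∀ u, u ∈ Ln ↔ u ∈ enc (base m D K : ℕ) '' cubeNodes b K (radius m D))
    {x : Fin n → ℤ} (hx : x ∈ feasibleSet A b) :
    ∃ p, StaysIn (fun j => enc (base m D K : ℕ) fun i => A i j) {u | u ∈ Ln} p ∧
      endpoint (fun j => enc (base m D K : ℕ) fun i => A i j) p = enc (base m D K : ℕ) b ∧
      weight c p = c ⬝ᵥ x := by
  obtain ⟨p, hp, hw⟩ := exists_isWalk_of_mem (Δ := D)
    (fun i j => by
      have := h.abs_matrix i j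
      rw [Int.abs_eq_natAbs] at this
      exact_mod_cast this) hx c
  have hp' := hp.mono (nodes_subset_cubeNodes h)
  rw [← p.reverse_reverse, isWalk_reverse_iff] at hp'
  refine ⟨p.reverse, (staysIn_cubeNodes_iff h hLn _).2 hp'.1, ?_, ?_⟩
  · rw [endpoint_enc, ← hp'.2]
  · rw [weight_perm p.reverse_perm, hw]

lemma countVec_mem_of_endpoint (h : IsBounds A b D K)
    (hLn : ∀ u, u ∈ Ln ↔ u ∈ enc (base m D K : ℕ) '' cubeNodes b K (radius m D))
    {p : List (Fin n)}
    (hp : StaysIn (fun j => enc (base m D K : ℕ) fun i => A i j) {u | u ∈ Ln} p)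
    (he : endpoint (fun j => enc (base m D K : ℕ) fun i => A i j) p = enc (base m D K : ℕ) b) :
    countVec p ∈ feasibleSet A b := by
  rw [staysIn_cubeNodes_iff h hLn] at hp
  rw [endpoint_enc] at he
  refine ⟨?_, countVec_nonneg p⟩
  rw [mulVec_countVec]
  exact eq_of_enc_eq h (hp p List.suffix_rfl) (rhs_mem_cubeNodes h.one_le_K _) he

lemma eq_empty_of_isFinal (h : IsBounds A b D K)
    (hLn : ∀ u, u ∈ Ln ↔ u ∈ enc (base m D K : ℕ) '' cubeNodes b K (radius m D))
    (hS : IsFinal (fun j => enc (base m D K : ℕ) fun i => A i j) {u | u ∈ Ln} c Ln.length save S)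
    (hb : S.ptr (enc (base m D K : ℕ) b) ≤ 0) : feasibleSet A b = ∅ := by
  rw [Set.eq_empty_iff_forall_notMem]
  intro x hx
  obtain ⟨p, hp, he, -⟩ := exists_staysIn_of_mem (c := 0) h hLn hx
  -- without weights there are no positive cycles, so that a short walk to `b` exists
  have hc : ¬ PosCycle (fun j => enc (base m D K : ℕ) fun i => A i j) {u | u ∈ Ln} 0 := by
    rintro ⟨p, q, -, -, hq⟩
    rw [← dotProduct_countVec, zero_dotProduct] at hq
    exact lt_irrefl _ hq
  obtain ⟨q, hq1, hq2, hq3, -⟩ := exists_short (Ln := Ln) (fun u hu => hu) hc _ p rfl hp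
  have := (hS.complete q hq1 hq3).1
  rw [hq2, he] at this
  omega

lemma isUnbounded_of_isFinal (h : IsBounds A b D K)
    (hLn : ∀ u, u ∈ Ln ↔ u ∈ enc (base m D K : ℕ) '' cubeNodes b K (radius m D))
    (hS : IsFinal (fun j => enc (base m D K : ℕ) fun i => A i j) {u | u ∈ Ln} c Ln.length save S)
    (hb : 0 < S.ptr (enc (base m D K : ℕ) b)) (hlt : save < S.cells) : IsUnbounded A b c := by
  obtain ⟨-, p, hp1, hp2, -⟩ := hS.sound.exists_walk _ hb
  obtain ⟨r, q, hq1, hq2, hq3⟩ := hS.improves hlt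
  refine isUnbounded_of_ray (countVec_mem_of_endpoint h hLn hp1 hp2) (y := countVec q)
    ⟨?_, countVec_nonneg q⟩ (by rwa [dotProduct_countVec])
  rw [staysIn_cubeNodes_iff h hLn] at hq1
  have he : colSum A (q ++ r) = colSum A r :=
    eq_of_enc_eq h (hq1 _ List.suffix_rfl) (hq1 _ (List.suffix_append _ _)) (by
      rw [← endpoint_enc, ← endpoint_enc, endpoint_append, hq2, zero_add])
  rw [mulVec_countVec]
  ext i
  have := congrFun he i
  simpa [colSum] using this

lemma isOptimal_of_isFinal (h : IsBounds A b D K)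
    (hLn : ∀ u, u ∈ Ln ↔ u ∈ enc (base m D K : ℕ) '' cubeNodes b K (radius m D))
    (hS : IsFinal (fun j => enc (base m D K : ℕ) fun i => A i j) {u | u ∈ Ln} c Ln.length save S)
    (hle : S.cells ≤ save) {p : List (Fin n)}
    (hp : StaysIn (fun j => enc (base m D K : ℕ) fun i => A i j) {u | u ∈ Ln} p)
    (he : endpoint (fun j => enc (base m D K : ℕ) fun i => A i j) p = enc (base m D K : ℕ) b)
    (hw : weight c p = S.val (enc (base m D K : ℕ) b)) : IsOptimal A b c (countVec p) := by
  refine ⟨countVec_mem_of_endpoint h hLn hp he, fun x hx => ?_⟩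
  obtain ⟨q, hq, hqe, hqw⟩ := exists_staysIn_of_mem (c := c) h hLn hx
  have h0 := hS.complete [] (hq.suffix List.nil_suffix) (Nat.zero_le _)
  have := (le_of_fixed (by simpa [weight] using h0) (hS.fixed (le_antisymm hle hS.save_le)) q hq).2
  rw [hqe, ← hw, hqw] at this
  rwa [dotProduct_countVec]

end Solver

/-! ### The whole program -/

namespace Solver

open Loop StdIP

variable {m n : ℕ} {A : Matrix (Fin m) (Fin n) ℤ} {b : Fin m → ℤ} {c : Fin n → ℤ}

lemma IsColumns.length_le_card {code : Fin n → ℤ} {cols best : ℤ → ℤ} {L : List ℤ}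
    (h : IsColumns code c n cols best L) : L.length ≤ n := by
  rw [← List.toFinset_card_of_nodup h.nodup]
  refine (Finset.card_le_card (t := Finset.univ.image code) fun s hs => ?_).trans
    (Finset.card_image_le.trans (by simp))
  obtain ⟨j, -, hj, -⟩ := h.exists_best s (List.mem_toFinset.1 hs)
  exact Finset.mem_image.2 ⟨j, Finset.mem_univ _, hj⟩

lemma IsColumns.length_le_pow {B : ℤ} {D : ℕ} (hA : ∀ i j, |A i j| ≤ D) {cols best : ℤ → ℤ}
    {L : List ℤ} (h : IsColumns (fun j => enc B fun i => A i j) c n cols best L) :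
    L.length ≤ (2 * D + 1) ^ m := by
  rw [← List.toFinset_card_of_nodup h.nodup]
  have hcard : (Fintype.piFinset fun _ : Fin m => Finset.Icc (-(D : ℤ)) D).card
      = (2 * D + 1) ^ m := by
    rw [Fintype.card_piFinset, Finset.prod_const, Finset.card_univ, Fintype.card_fin, Int.card_Icc]
    congr 1
    omega
  rw [← hcard]
  refine (Finset.card_le_card (t := (Fintype.piFinset fun _ : Fin m =>
    Finset.Icc (-(D : ℤ)) D).image (enc B)) fun s hs => ?_).trans Finset.card_image_le
  obtain ⟨j, -, hj, -⟩ := h.exists_best s (List.mem_toFinset.1 hs)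
  refine Finset.mem_image.2 ⟨fun i => A i j, ?_, hj⟩
  rw [Fintype.mem_piFinset]
  intro i
  rw [Finset.mem_Icc]
  exact abs_le.1 (hA i j)

/-- A bound for the time of the program in terms of the dimensions, a bound `Δ` for the entries of
`A`, a bound `K` for those of `b`, and a bound `L` for the number of distinct columns. -/
def solverCost (m n Δ K L : ℕ) : ℕ :=
  (100 + n * 100) + ((200 + m * n * 100 + m * 200) +
  ((100 + m * (500 + Δ * 100 + base m Δ K * 20)) + ((100 + n * (400 + m * 100)) +
  ((100 + m * (100 + (2 * radius m Δ + 1) ^ m * 200)) +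
  ((100 + (K + 1) * (200 + (2 * radius m Δ + 1) ^ m * 200 + m * 200)) +
  ((100 + ((K + 1) * (2 * radius m Δ + 1) ^ m + 1) *
      (100 + (K + 1) * (2 * radius m Δ + 1) ^ m * (100 + L * 400))) +
  (150 + n * 50 + (1 + ((K + 1) * (2 * radius m Δ + 1) ^ m + 1) *
      ((K + 1) * (2 * radius m Δ + 1) ^ m * L)) * 150)))))))

/-- The variable `ans` and the array `io` hold a correct answer. -/
def IsResult (A : Matrix (Fin m) (Fin n) ℤ) (b : Fin m → ℤ) (c : Fin n → ℤ) (M : Store Var Arr) :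
    Prop :=
  (M.var .ans = 0 ∧ feasibleSet A b = ∅) ∨
  (M.var .ans = 1 ∧ IsOptimal A b c fun j : Fin n => M.arr .io j) ∨
  (M.var .ans = 2 ∧ IsUnbounded A b c)

lemma solver_spec {M : Store Var Arr} (hI : IsInput A b c (M.arr .io))
    (h0 : ∀ t, t ≠ .io → M.arr t = fun _ => 0) {Δ : ℕ} (hΔ : 1 ≤ Δ)
    (hA : ∀ i j, (A i j).natAbs ≤ Δ) :
    Spec solver M (solverCost m n Δ (max 1 (normSup b)) (min n ((2 * Δ + 1) ^ m)))
      (IsResult A b c) := by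
  refine Spec.seq (readDims_spec hI) ?_
  rintro M1 hF1 ⟨m1, n1, mn1, cpos1⟩
  have io1 : M1.arr .io = M.arr .io := hF1.arr .io rfl
  refine Spec.seq (bounds_spec (A := A) (b := b) (c := c) (by rwa [io1]) m1 mn1) ?_
  rintro M2 hF2 ⟨D, K, hDK, D2, K2, R2, B2⟩
  have hD := hDK.D_le Δ hΔ hA
  have hK := hDK.K_le
  set K0 := max 1 (normSup b) with hK0
  have hR : radius m D ≤ radius m Δ := by
    unfold radius
    gcongr
  have hB : base m D K ≤ base m Δ K0 := by
    unfold base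
    gcongr
  have hW : (2 * radius m D + 1) ^ m ≤ (2 * radius m Δ + 1) ^ m := by gcongr
  have io2 : M2.arr .io = M.arr .io := (hF2.arr .io rfl).trans io1
  have m2 : M2.var .m = m := (hF2.var .m rfl).trans m1
  have n2 : M2.var .n = n := (hF2.var .n rfl).trans n1
  have mn2 : M2.var .mn = m * n := (hF2.var .mn rfl).trans mn1
  have cpos2 : M2.var .cpos = 2 + m * n + m := (hF2.var .cpos rfl).trans cpos1
  refine Spec.seq (Spec.mono (tables_spec m2 D2 B2 (by unfold base; omega)) (by gcongr)
    fun _ _ h => h) ?_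
  rintro M3 hF3 ⟨pow3, tab3⟩
  have io3 : M3.arr .io = M.arr .io := (hF3.arr .io rfl).trans io2
  have best3 : M3.arr .best = fun _ => 0 :=
    ((hF3.arr .best rfl).trans ((hF2.arr .best rfl).trans (hF1.arr .best rfl))).trans
      (h0 .best (by decide))
  refine Spec.seq (columns_spec (D := D) (B := base m D K) (A := A) (b := b) (c := c)
    (by rwa [io3]) ((hF3.var .m rfl).trans m2) ((hF3.var .n rfl).trans n2)
    ((hF3.var .cpos rfl).trans cpos2) ((hF3.var .B rfl).trans B2) hDK.abs_matrix tab3 best3) ?_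
  rintro M4 hF4 ⟨Lc, nc4, hLc⟩
  have hLc' : Lc.length ≤ min n ((2 * Δ + 1) ^ m) :=
    le_min hLc.length_le_card ((hLc.length_le_pow hDK.abs_matrix).trans (by gcongr))
  set L := min n ((2 * Δ + 1) ^ m)
  have pow4 : ∀ i < m, M4.arr .pow i = ((base m D K : ℕ) : ℤ) ^ i := by
    rw [hF4.arr .pow rfl]
    exact pow3
  have m4 : M4.var .m = m := (hF4.var .m rfl).trans ((hF3.var .m rfl).trans m2)
  refine Spec.seq (Spec.mono (boxPoints_spec (R := radius m D) (B := base m D K) m4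
    ((hF4.var .R rfl).trans ((hF3.var .R rfl).trans R2)) pow4) (by gcongr) fun _ _ h => h) ?_
  rintro M5 hF5 ⟨Lb, hLb, top5, hLb', hbox⟩
  have io5 : M5.arr .io = M.arr .io :=
    (hF5.arr .io rfl).trans ((hF4.arr .io rfl).trans io3)
  have frac5 : M5.arr .frac = fun _ => 0 :=
    ((hF5.arr .frac rfl).trans ((hF4.arr .frac rfl).trans ((hF3.arr .frac rfl).trans
      ((hF2.arr .frac rfl).trans (hF1.arr .frac rfl))))).trans (h0 .frac (by decide))
  have mark5 : M5.arr .mark = fun _ => 0 :=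
    ((hF5.arr .mark rfl).trans ((hF4.arr .mark rfl).trans ((hF3.arr .mark rfl).trans
      ((hF2.arr .mark rfl).trans (hF1.arr .mark rfl))))).trans (h0 .mark (by decide))
  have hLbW : Lb.length ≤ (2 * radius m Δ + 1) ^ m := hLb'.trans_le hW
  refine Spec.seq (Spec.mono (nodePoints_spec (A := A) (b := b) (c := c) (R := radius m D)
    (B := base m D K) (K := K) (by rwa [io5]) ((hF5.var .m rfl).trans m4)
    ((hF5.var .mn rfl).trans ((hF4.var .mn rfl).trans ((hF3.var .mn rfl).trans mn2)))
    ((hF5.var .K rfl).trans ((hF4.var .K rfl).trans ((hF3.var .K rfl).trans K2)))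
    hDK.one_le_K hDK.abs_rhs (by rw [hF5.arr .pow rfl]; exact pow4) hLb top5 hbox frac5 mark5)
    (by gcongr) fun _ _ h => h) ?_
  rintro M6 hF6 ⟨bc6, Ln, hLn, N6, hlen, hmem⟩
  have hlen' : Ln.length ≤ (K0 + 1) * (2 * radius m Δ + 1) ^ m :=
    hlen.trans (by gcongr)
  have io6 : M6.arr .io = M.arr .io := (hF6.arr .io rfl).trans io5
  have ptr6 : M6.arr .ptr = fun _ => 0 :=
    ((hF6.arr .ptr rfl).trans ((hF5.arr .ptr rfl).trans ((hF4.arr .ptr rfl).trans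
      ((hF3.arr .ptr rfl).trans ((hF2.arr .ptr rfl).trans (hF1.arr .ptr rfl)))))).trans
      (h0 .ptr (by decide))
  have val6 : M6.arr .val = fun _ => 0 :=
    ((hF6.arr .val rfl).trans ((hF5.arr .val rfl).trans ((hF4.arr .val rfl).trans
      ((hF3.arr .val rfl).trans ((hF2.arr .val rfl).trans (hF1.arr .val rfl)))))).trans
      (h0 .val (by decide))
  have cpos6 : M6.var .cpos = 2 + m * n + m :=
    ((hF6.var .cpos rfl).trans ((hF5.var .cpos rfl).trans ((hF4.var .cpos rfl).trans
      (hF3.var .cpos rfl)))).trans cpos2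
  have nc6 : M6.var .nc = Lc.length := ((hF6.var .nc rfl).trans (hF5.var .nc rfl)).trans nc4
  have cols6 : M6.arr .cols = M4.arr .cols := (hF6.arr .cols rfl).trans (hF5.arr .cols rfl)
  have best6 : M6.arr .best = M4.arr .best := (hF6.arr .best rfl).trans (hF5.arr .best rfl)
  have n6 : M6.var .n = n :=
    ((hF6.var .n rfl).trans ((hF5.var .n rfl).trans ((hF4.var .n rfl).trans
      (hF3.var .n rfl)))).trans n2
  refine Spec.seq (Spec.mono (bellmanFord_spec (A := A) (b := b) (c := c) (by rwa [io6]) cpos6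
    (by rw [cols6, best6]; exact hLc) nc6 hLn N6
    ((hmem 0).2 ⟨0, zero_mem_cubeNodes _, enc_zero _⟩) ptr6 val6) (by gcongr) fun _ _ h => h) ?_
  rintro M7 hF7 ⟨hfin, hcells⟩
  have bc7 : M7.var .bc = enc (base m D K : ℕ) b := (hF7.var .bc rfl).trans bc6
  have hone : 1 ≤ M7.var .cells := hfin.sound.one_le
  obtain ⟨N, hN⟩ := Int.eq_ofNat_of_zero_le (by omega : 0 ≤ M7.var .cells)
  have hN' : N ≤ 1 + ((K0 + 1) * (2 * radius m Δ + 1) ^ m + 1) *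
      ((K0 + 1) * (2 * radius m Δ + 1) ^ m * L) := by
    rw [hN] at hcells
    have : N ≤ 1 + (Ln.length + 1) * (Ln.length * Lc.length) := by exact_mod_cast hcells
    exact this.trans (by gcongr)
  refine Spec.mono (report_spec ((hF7.var .n rfl).trans n6) hN hfin.sound) (by gcongr) ?_
  rw [bc7]
  rintro M' - (⟨h1, h2⟩ | ⟨h1, h2, h3⟩ | ⟨h1, h2, h3, p, h4, h5, h6, h7⟩)
  · exact .inl ⟨h2, eq_empty_of_isFinal hDK hmem hfin h1⟩
  · exact .inr (.inr ⟨h3, isUnbounded_of_isFinal hDK hmem hfin h1 h2⟩)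
  · refine .inr (.inl ⟨h3, ?_⟩)
    rw [show (fun j : Fin n => M'.arr .io j) = countVec p from funext h7]
    exact isOptimal_of_isFinal hDK hmem hfin h2 h4 h5 h6

/-- The store at the start of the program. -/
def initialStore (A : Matrix (Fin m) (Fin n) ℤ) (b : Fin m → ℤ) (c : Fin n → ℤ) :
    Store Var Arr where
  var _ := 0
  arr t i := if t = .io then (if 0 ≤ i then (inputWord A b c).getD i.toNat 0 else 0) else 0

lemma rep_initialStore : Rep layout (initialState A b c) (initialStore A b c) := by
  refine ⟨fun _ => rfl, fun t i => ?_⟩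
  by_cases ht : t = .io
  · subst ht
    have h : layout.arr .io = 0 := rfl
    by_cases hi : 0 ≤ i
    · simp [initialState, initialStore, h, adr, hi]
    · have : ¬ (0 : ℤ) ≤ 32 * i := by omega
      simp [initialState, initialStore, h, adr, hi, this]
  · have h : layout.arr t ≠ 0 := fun h => ht (layout.arr_inj h)
    -- all other arrays live at negative addresses
    have : ¬ (0 : ℤ) ≤ adr (layout.arr t) i := by
      unfold adr
      rw [if_neg h]
      split_ifs <;> omega
    simp [initialState, initialStore, ht, this]

lemma getD_flatten_columns (i : Fin m) (j : Fin n) :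
    (List.ofFn fun j : Fin n => List.ofFn fun i : Fin m => A i j).flatten.getD (j * m + i) 0
      = A i j := by
  have h : (List.ofFn fun j : Fin n => List.ofFn fun i : Fin m => A i j).flatten
      = List.ofFn fun t : Fin (n * m) => A t.modNat t.divNat := by
    rw [List.ofFn_mul]
    congr 2
    ext1 j
    congr 1
    ext1 i
    have hm : 0 < m := i.pos
    congr 1
    · ext
      simp [Fin.modNat, Nat.mod_eq_of_lt i.2]
    · ext
      simp [Fin.divNat, Nat.add_div_of_dvd_right, Nat.div_eq_of_lt i.2, hm]
  have hlt : (j : ℕ) * m + i < n * m := by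
    rw [mul_comm n m]
    exact index_lt i j
  rw [h, List.getD_eq_getElem _ _ (by simpa using hlt), List.getElem_ofFn]
  have hm : 0 < m := i.pos
  congr 1
  · ext
    simp [Fin.modNat, Nat.mod_eq_of_lt i.2]
  · ext
    simp [Fin.divNat, Nat.add_div_of_dvd_right, Nat.div_eq_of_lt i.2, hm]

lemma isInput_initialStore : IsInput A b c ((initialStore A b c).arr .io) := by
  set F := (List.ofFn fun j : Fin n => List.ofFn fun i : Fin m => A i j).flatten with hF
  have hlen : F.length = m * n := by
    simp [hF, List.length_flatten, List.map_ofFn, Function.comp_def, mul_comm]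
  have hio : ∀ t : ℕ, (initialStore A b c).arr .io t =
      ([(m : ℤ), (n : ℤ)] ++ (F ++ (List.ofFn b ++ List.ofFn c))).getD t 0 := by
    intro t
    simp [initialStore, inputWord, hF]
  have hio2 : ∀ t : ℕ, (initialStore A b c).arr .io (2 + t : ℕ) =
      (F ++ (List.ofFn b ++ List.ofFn c)).getD t 0 := by
    intro t
    rw [hio, List.getD_append_right _ _ _ _ (by simp)]
    congr 1
    simp
  refine ⟨hio 0, hio 1, fun i j => ?_, fun i => ?_, fun j => ?_⟩
  · have h1 := hio2 (j * m + i)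
    rw [List.getD_append _ _ _ _ (by rw [hlen]; exact index_lt i j), getD_flatten_columns] at h1
    rw [← h1]
    push_cast
    ring_nf
  · have h1 := hio2 (m * n + i)
    rw [List.getD_append_right _ _ _ _ (by omega), hlen, Nat.add_sub_cancel_left,
      List.getD_append _ _ _ _ (by simp), List.getD_eq_getElem _ _ (by simp),
      List.getElem_ofFn] at h1
    rw [← h1]
    push_cast
    ring_nf
  · have h1 := hio2 (m * n + m + j)
    rw [List.getD_append_right _ _ _ _ (by omega), hlen,
      List.getD_append_right _ _ _ _ (by simp; omega), List.length_ofFn,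
      show m * n + m + (j : ℕ) - m * n - m = j by omega, List.getD_eq_getElem _ _ (by simp),
      List.getElem_ofFn] at h1
    rw [← h1]
    push_cast
    ring_nf

/-- The machine program solves every integer program, in a time bounded by `solverCost`. -/
theorem exists_runs_isAnswer {Δ : ℕ} (hΔ : 1 ≤ Δ) (hA : ∀ i j, (A i j).natAbs ≤ Δ) :
    ∃ T σ, RAM.Runs (solver.compile layout 0) (initialState A b c) T σ ∧ IsAnswer A b c σ ∧
      T ≤ solverCost m n Δ (max 1 (normSup b)) (min n ((2 * Δ + 1) ^ m)) := by
  obtain ⟨hres, hcost⟩ := solver_spec (M := initialStore A b c) isInput_initialStore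
    (fun t ht => by ext i; simp [initialStore, ht]) hΔ hA
  obtain ⟨T, σ, hrun, hT, hrep, -⟩ :=
    solver.compile_ends layout (initialStore A b c) 0 (initialState A b c) rep_initialStore
  refine ⟨T, σ, hrun, ?_, hT.trans hcost⟩
  have hans : σ.reg 0 = (solver.denote (initialStore A b c)).var .ans := hrep.var .ans
  have hio : ∀ j : Fin n, σ.mem ((j : ℕ) : ℤ) =
      (solver.denote (initialStore A b c)).arr .io j := by
    intro j
    rw [← hrep.arr .io j]
    congr 1
  unfold IsAnswer
  simp only [hans, hio]
  exact hres

end Solver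

/-! ### The time bounds -/

namespace Solver

open Loop StdIP

lemma solverCost_le {m n Δ K L : ℕ} (hm : 1 ≤ m) (hn : 1 ≤ n) (hK : 1 ≤ K) (hL : 1 ≤ L)
    (hΔ : 1 ≤ Δ) :
    solverCost m n Δ K L ≤ 6000 * (m * n) + 6000 * (K ^ 2 * ((9 * (m * Δ)) ^ m) ^ 2 * L) := by
  have hmΔ : 1 ≤ m * Δ := Nat.mul_pos hm hΔ
  have hR : 2 * radius m Δ + 1 ≤ 9 * (m * Δ) := by
    unfold radius
    omega
  have hW : (2 * radius m Δ + 1) ^ m ≤ (9 * (m * Δ)) ^ m := by gcongr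
  have hRW : 9 * (m * Δ) ≤ (9 * (m * Δ)) ^ m := Nat.le_self_pow (by omega) _
  have hmm : m ≤ m * Δ := Nat.le_mul_of_pos_right _ hΔ
  have hΔΔ : Δ ≤ m * Δ := Nat.le_mul_of_pos_left _ hm
  have hbase : base m Δ K ≤ K * (9 * (m * Δ)) ^ m * 7 := by
    have h1 : base m Δ K ≤ 2 * K + 5 * (9 * (m * Δ)) ^ m := by
      unfold base radius
      omega
    have h2 : K ≤ K * (9 * (m * Δ)) ^ m := Nat.le_mul_of_pos_right _ (by omega)
    have h3 : (9 * (m * Δ)) ^ m ≤ K * (9 * (m * Δ)) ^ m := Nat.le_mul_of_pos_left _ hK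
    omega
  have hmW : m ≤ (9 * (m * Δ)) ^ m := by omega
  have hΔW : Δ ≤ (9 * (m * Δ)) ^ m := by omega
  have hW1 : 1 ≤ (9 * (m * Δ)) ^ m := by omega
  generalize (9 * (m * Δ)) ^ m = W at *
  have hmn1 : m ≤ m * n := Nat.le_mul_of_pos_right _ hn
  have hmn2 : n ≤ m * n := Nat.le_mul_of_pos_left _ hm
  set Y := m * n with hY
  set Z := K ^ 2 * W ^ 2 * L with hZ
  have hKK : K ≤ K ^ 2 := Nat.le_self_pow (by norm_num) _
  have hWW : W ≤ W ^ 2 := Nat.le_self_pow (by norm_num) _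
  have hZ' : K ^ 2 * W ^ 2 ≤ Z := Nat.le_mul_of_pos_right _ hL
  have z1 : W ^ 2 ≤ Z := (Nat.le_mul_of_pos_left _ (by positivity)).trans hZ'
  have z2 : K * W ^ 2 ≤ Z := (Nat.mul_le_mul_right _ hKK).trans hZ'
  have z3 : K * W ≤ Z := (Nat.mul_le_mul_left _ hWW).trans z2
  have z0 : K ≤ Z := (Nat.le_mul_of_pos_right _ hW1).trans z3
  have t1 : m * Δ ≤ Z := le_trans (by nlinarith) z1
  have t2 : m * base m Δ K ≤ 7 * Z := by
    calc m * base m Δ K ≤ W * (K * W * 7) := by gcongr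
      _ = 7 * (K * W ^ 2) := by ring
      _ ≤ 7 * Z := by gcongr
  have t3 : m * W ≤ Z := le_trans (by nlinarith) z1
  have t4 : (K + 1) * (200 + W * 200 + m * 200) ≤ 1200 * Z := by
    calc (K + 1) * (200 + W * 200 + m * 200) ≤ (2 * K) * (600 * W) := by
          gcongr <;> omega
      _ = 1200 * (K * W) := by ring
      _ ≤ 1200 * Z := by gcongr
  have hN : (K + 1) * W ≤ 2 * (K * W) := by nlinarith
  have hN1 : (K + 1) * W + 1 ≤ 3 * (K * W) := by nlinarith
  have t5 : ((K + 1) * W + 1) * (100 + (K + 1) * W * (100 + L * 400)) ≤ 3300 * Z := by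
    calc ((K + 1) * W + 1) * (100 + (K + 1) * W * (100 + L * 400))
        ≤ (3 * (K * W)) * (100 + 2 * (K * W) * (500 * L)) := by
          gcongr
          omega
      _ = 300 * (K * W) + 3000 * (K ^ 2 * W ^ 2 * L) := by ring
      _ ≤ 3300 * Z := by omega
  have t6 : ((K + 1) * W + 1) * ((K + 1) * W * L) ≤ 6 * Z := by
    calc ((K + 1) * W + 1) * ((K + 1) * W * L) ≤ (3 * (K * W)) * (2 * (K * W) * L) := by gcongr
      _ = 6 * Z := by ring
  calc solverCost m n Δ K L
      ≤ (100 + n * 100) + ((200 + m * n * 100 + m * 200) +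
        ((100 + m * (500 + Δ * 100 + base m Δ K * 20)) + ((100 + n * (400 + m * 100)) +
        ((100 + m * (100 + W * 200)) + ((100 + (K + 1) * (200 + W * 200 + m * 200)) +
        ((100 + ((K + 1) * W + 1) * (100 + (K + 1) * W * (100 + L * 400))) +
        (150 + n * 50 + (1 + ((K + 1) * W + 1) * ((K + 1) * W * L)) * 150))))))) := by
        unfold solverCost
        gcongr
    _ = 1100 + 550 * n + 200 * Y + 800 * m + 100 * (m * Δ) + 20 * (m * base m Δ K) + 200 * (m * W) +
        (K + 1) * (200 + W * 200 + m * 200) +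
        ((K + 1) * W + 1) * (100 + (K + 1) * W * (100 + L * 400)) +
        150 * (((K + 1) * W + 1) * ((K + 1) * W * L)) := by
        rw [hY]
        ring
    _ ≤ 6000 * Y + 6000 * Z := by omega

lemma normSup_le_norm1 {m : ℕ} (b : Fin m → ℤ) : normSup b ≤ norm1 b :=
  Finset.sup_le fun i _ =>
    Finset.single_le_sum (f := fun i => (b i).natAbs) (fun _ _ => Nat.zero_le _) (Finset.mem_univ i)

/-- All columns count: there are at most `n` of them. -/
lemma solverCost_le_norm1 {m n Δ C : ℕ} (b : Fin m → ℤ) (hm : 1 ≤ m) (hn : 1 ≤ n) (hΔ : 1 ≤ Δ)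
    (hC : 990 ≤ C) :
    solverCost m n Δ (max 1 (normSup b)) (min n ((2 * Δ + 1) ^ m)) ≤
      n * (C * (m * Δ)) ^ (2 * m) * (max 1 (norm1 b)) ^ 2 := by
  have hL : 1 ≤ min n ((2 * Δ + 1) ^ m) := le_min hn (Nat.one_le_pow _ _ (by omega))
  refine (solverCost_le hm hn (le_max_left _ _) hL hΔ).trans ?_
  have hmΔ : 1 ≤ m * Δ := Nat.mul_pos hm hΔ
  have hK : max 1 (normSup b) ≤ max 1 (norm1 b) := max_le_max le_rfl (normSup_le_norm1 b)
  have hK1 : 1 ≤ max 1 (norm1 b) := le_max_left _ _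
  have h1 : m ≤ (9 * (m * Δ)) ^ m :=
    (by nlinarith : m ≤ 9 * (m * Δ)).trans (Nat.le_self_pow (by omega) _)
  have h2 : m * n ≤ n * ((9 * (m * Δ)) ^ m) ^ 2 * (max 1 (norm1 b)) ^ 2 := by
    calc m * n = n * m := mul_comm _ _
      _ ≤ n * ((9 * (m * Δ)) ^ m) ^ 2 :=
        Nat.mul_le_mul_left _ (h1.trans (Nat.le_self_pow (by norm_num) _))
      _ ≤ _ := Nat.le_mul_of_pos_right _ (by positivity)
  have h3 : (max 1 (normSup b)) ^ 2 * ((9 * (m * Δ)) ^ m) ^ 2 * min n ((2 * Δ + 1) ^ m) ≤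
      n * ((9 * (m * Δ)) ^ m) ^ 2 * (max 1 (norm1 b)) ^ 2 := by
    calc (max 1 (normSup b)) ^ 2 * ((9 * (m * Δ)) ^ m) ^ 2 * min n ((2 * Δ + 1) ^ m)
        ≤ (max 1 (norm1 b)) ^ 2 * ((9 * (m * Δ)) ^ m) ^ 2 * n := by
          gcongr
          exact min_le_left _ _
      _ = _ := by ring
  have h4 : 12000 * ((9 * (m * Δ)) ^ m) ^ 2 ≤ (C * (m * Δ)) ^ (2 * m) := by
    calc 12000 * ((9 * (m * Δ)) ^ m) ^ 2 ≤ (110 ^ 2) ^ m * ((9 * (m * Δ)) ^ m) ^ 2 := by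
          gcongr
          exact (by norm_num : 12000 ≤ 110 ^ 2).trans (Nat.le_self_pow (by omega) _)
      _ = (990 * (m * Δ)) ^ (2 * m) := by
          rw [show 990 * (m * Δ) = 110 * (9 * (m * Δ)) by ring, mul_pow 110, ← pow_mul, ← pow_mul,
            mul_comm m 2]
      _ ≤ _ := by gcongr
  calc 6000 * (m * n) +
        6000 * ((max 1 (normSup b)) ^ 2 * ((9 * (m * Δ)) ^ m) ^ 2 * min n ((2 * Δ + 1) ^ m))
      ≤ n * (12000 * ((9 * (m * Δ)) ^ m) ^ 2) * (max 1 (norm1 b)) ^ 2 := by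
        rw [show n * (12000 * ((9 * (m * Δ)) ^ m) ^ 2) * (max 1 (norm1 b)) ^ 2 =
          12000 * (n * ((9 * (m * Δ)) ^ m) ^ 2 * (max 1 (norm1 b)) ^ 2) by ring]
        omega
    _ ≤ _ := by gcongr

/-- Only distinct columns count: there are at most `(2 Δ + 1) ^ m` of them. -/
lemma solverCost_le_normSup {m n Δ C : ℕ} (b : Fin m → ℤ) (hm : 1 ≤ m) (hn : 1 ≤ n) (hΔ : 1 ≤ Δ)
    (hC : 6000 * 9 ^ 3 ≤ C) :
    solverCost m n Δ (max 1 (normSup b)) (min n ((2 * Δ + 1) ^ m)) ≤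
      C * (m * n) + C * (m * Δ) ^ (C * m) * (max 1 (normSup b)) ^ 2 := by
  have hL : 1 ≤ min n ((2 * Δ + 1) ^ m) := le_min hn (Nat.one_le_pow _ _ (by omega))
  refine (solverCost_le hm hn (le_max_left _ _) hL hΔ).trans ?_
  have hmΔ : 1 ≤ m * Δ := Nat.mul_pos hm hΔ
  refine Nat.add_le_add (Nat.mul_le_mul_right _ (by omega)) ?_
  have h1 : min n ((2 * Δ + 1) ^ m) ≤ (9 * (m * Δ)) ^ m :=
    (min_le_right _ _).trans (Nat.pow_le_pow_left (by nlinarith) _)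
  have h2 : 6000 * (9 * (m * Δ)) ^ (3 * m) ≤ C * (m * Δ) ^ (C * m) := by
    rcases hmΔ.eq_or_lt with h | h
    · have hm1 : m = 1 := Nat.eq_one_of_mul_eq_one_right h.symm
      rw [← h, hm1]
      simpa using hC
    · have h9 : 9 ≤ (m * Δ) ^ 4 :=
        (by norm_num : 9 ≤ 2 ^ 4).trans (Nat.pow_le_pow_left h 4)
      have h3 : (9 * (m * Δ)) ^ (3 * m) ≤ (m * Δ) ^ (C * m) := by
        calc (9 * (m * Δ)) ^ (3 * m) ≤ ((m * Δ) ^ 4 * (m * Δ)) ^ (3 * m) := by gcongr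
          _ = (m * Δ) ^ (15 * m) := by
            rw [← pow_succ, ← pow_mul]
            congr 1
            ring
          _ ≤ _ := Nat.pow_le_pow_right (by omega) (Nat.mul_le_mul_right _ (by omega))
      exact Nat.mul_le_mul (by omega) h3
  calc 6000 * ((max 1 (normSup b)) ^ 2 * ((9 * (m * Δ)) ^ m) ^ 2 * min n ((2 * Δ + 1) ^ m))
      ≤ 6000 * ((max 1 (normSup b)) ^ 2 * ((9 * (m * Δ)) ^ m) ^ 2 * (9 * (m * Δ)) ^ m) := by gcongr
    _ = (6000 * (9 * (m * Δ)) ^ (3 * m)) * (max 1 (normSup b)) ^ 2 := by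
      rw [mul_comm 3 m, pow_mul]
      ring
    _ ≤ _ := by gcongr

end Solver

theorem mainTheorem2 :
    -- one fixed program solves all integer programs in standard form within the stated time
    (∃ (P : RAM.Prog) (C : ℕ), ∀ (m n Δ : ℕ) (A : Matrix (Fin m) (Fin n) ℤ) (b : Fin m → ℤ)
      (c : Fin n → ℤ), 1 ≤ m → 1 ≤ n → 1 ≤ Δ → (∀ i j, (A i j).natAbs ≤ Δ) →
      ∃ (T : ℕ) (σ : RAM.State), RAM.Runs P (StdIP.initialState A b c) T σ ∧
        StdIP.IsAnswer A b c σ ∧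
        T ≤ n * (C * (m * Δ)) ^ (2 * m) * (max 1 (StdIP.norm1 b)) ^ 2 ∧
        T ≤ C * (m * n) + C * (m * Δ) ^ (C * m) * (max 1 (StdIP.normSup b)) ^ 2) ∧
    -- the integer program as a longest path problem, and unboundedness as a positive cycle
    (∀ (m n Δ : ℕ) (A : Matrix (Fin m) (Fin n) ℤ) (b : Fin m → ℤ) (c : Fin n → ℤ),
      (∀ i j, (A i j).natAbs ≤ Δ) →
      ((StdIP.feasibleSet A b).Nonempty ↔ ∃ p, StdIP.IsWalk A (StdIP.nodes b Δ) 0 p b) ∧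
      ((StdIP.feasibleSet A b).Nonempty →
        (StdIP.IsUnbounded A b c ↔
          ∃ x p q, StdIP.IsWalk A (StdIP.nodes b Δ) 0 p x ∧
            StdIP.IsWalk A (StdIP.nodes b Δ) x q x ∧ 0 < StdIP.weight c q)) ∧
      (∀ v : ℤ,
        (∃ x, StdIP.IsOptimal A b c x ∧ c ⬝ᵥ x = v) ↔
          IsGreatest {w | ∃ p, StdIP.IsWalk A (StdIP.nodes b Δ) 0 p b ∧ StdIP.weight c p = w} v)) := by
  refine ⟨⟨Solver.solver.compile Solver.layout 0, 6000 * 9 ^ 3,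
    fun m n Δ A b c hm hn hΔ hA => ?_⟩, fun m n Δ A b c hA => ⟨?_, ?_, ?_⟩⟩
  · obtain ⟨T, σ, hrun, hans, hT⟩ := Solver.exists_runs_isAnswer (b := b) (c := c) hΔ hA
    exact ⟨T, σ, hrun, hans, hT.trans (Solver.solverCost_le_norm1 b hm hn hΔ (by norm_num)),
      hT.trans (Solver.solverCost_le_normSup b hm hn hΔ le_rfl)⟩
  · exact StdIP.feasible_iff hA subset_rfl
  · exact StdIP.isUnbounded_iff hA subset_rfl
  · exact StdIP.optimal_value_iff hA subset_rfl
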